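/- Let $n\ge 1$ and let $(S^{2n-1},\phi,\xi,\eta,g)$ be a (non-empty) Sasakian manifold, i.e. a normal contact metric manifold: $\phi^2=-\mathrm{Id}+\eta\otimes\xi$, $\eta(\xi)=1$, $g(\phi X,\phi Y)=g(X,Y)-\eta(X)\eta(Y)$, $d\eta(X,Y)=2g(X,\phi Y)$ and $[\phi,\phi]+d\eta\otimes\xi=0$, where $d\eta(X,Y)=X\eta(Y)-Y\eta(X)-\eta([X,Y])$. Let $\mathcal C(S)=(0,\infty)\times S$ be its cone, with the metric $\hat g=dr^2+r^2g$ and the almost complex structure $$J\left(X+f\,r\partial_r\right)=\phi X-f\xi+\eta(X)\,r\partial_r ,$$ where $X$ is tangent to $S$. Then: 1. $(\mathcal C(S),J,\hat g)$ is a Kähler manifold (of complex dimension $n$). 2. For a smooth radial function $\gamma=\gamma(r)$ on $\mathcal C(S)$ one has, with respect to $\hat g$, $$\Delta\gamma+(n-1)|\operatorname{grad}\gamma|^2=\gamma''+(2n-1)\frac{\gamma'}{r}+(n-1)(\gamma')^2 ,$$ and this expression vanishes identically for $\gamma=-\ln r^2$. 3. For $\gamma=-\ln r^2$ the vector field $J(e^{(n-3)\gamma}\operatorname{grad}\gamma)$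 is a Killing field of $\hat g$ if and only if $n=2$. For $n\neq 3$, the vector field $\operatorname{grad} r^{6-2n}$ is holomorphic (its flow preserves $J$) if and only if $n=2$. 4. If $n\ge 2$, a smooth radial function $\gamma=\gamma(r)$ satisfies both that $J(e^{(n-3)\gamma}\operatorname{grad}\gamma)$ is Killing and that $\Delta\gamma+(n-1)|\operatorname{grad}\gamma|^2=0$ if and only if either $\gamma$ is constant, or $n=2$ and $\gamma=-\ln r^2+k$ for a constant $k$. 5. If $n=2$, i.e. if $S$ is a Sasakian 3-manifold, then every smooth holomorphic map from $(\mathcal C(S),J,r^{-4}\hat g)$ into a $(1,2)$-symplectic almost Hermitian manifold $(N,J^N,h)$ (that is, $(\nabla_XJ^N)Y+(\nabla_{J^NX}J^N)J^NY=0$) is biharmonic, i.e. its bitension field vanishes. -/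

import Mathlib

open scoped Manifold ContDiff

noncomputable section

namespace HoloBiharmonic

/-! ### Riemannian calculus in a coordinate patch

`G` is a (pseudo-)metric on (an open subset of) the vector space `E`, i.e. a function with values in
bilinear forms, and all vectors are constant coordinate vectors. -/

section Coordinates

variable {E F W : Type*} [NormedAddCommGroup E] [NormedSpace ℝ E]
  [NormedAddCommGroup F] [NormedSpace ℝ F]

/-- The vector that represents the linear form `α` with respect to the nondegenerate form `B`. -/
def sharp {V : Type*} [AddCommGroup V] [Module ℝ V] [TopologicalSpace V]
    [IsTopologicalAddGroup V] [ContinuousSMul ℝ V]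
    (B : V →L[ℝ] V →L[ℝ] ℝ) (α : V →L[ℝ] ℝ) : V :=
  ContinuousLinearMap.inverse B α

/-- The bilinear form `(v, w) ↦ B(A v, A w)`. -/
def pullbackForm {V V' : Type*} [AddCommGroup V] [Module ℝ V] [TopologicalSpace V]
    [AddCommGroup V'] [Module ℝ V'] [TopologicalSpace V']
    [IsTopologicalAddGroup V] [ContinuousSMul ℝ V] [IsTopologicalAddGroup V'] [ContinuousSMul ℝ V']
    (A : V →L[ℝ] V') (B : V' →L[ℝ] V' →L[ℝ] ℝ) : V →L[ℝ] V →L[ℝ] ℝ :=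
  (ContinuousLinearMap.precomp ℝ A).comp (B.comp A)

/-- The trace of a bilinear map `T` with respect to the inner product `B`: this is
`∑ B^{ij} T(b_i, b_j)` in a basis `b`, since `B^{ij} b_j` is the vector representing the `i`-th
coordinate form. -/
def metricTrace [FiniteDimensional ℝ E] [AddCommGroup W]
    (B : E →L[ℝ] E →L[ℝ] ℝ) (T : E → E → W) : W :=
  ∑ i, T (Module.finBasis ℝ E i)
    (sharp B (LinearMap.toContinuousLinearMap ((Module.finBasis ℝ E).coord i)))

/-- The Christoffel symbol `Γ(v, w) = ∇_v w` of the Levi-Civita connection of `G`: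
`2 G(Γ(v, w), z) = D_v G(w, z) + D_w G(v, z) - D_z G(v, w)`. -/
def christoffel (G : E → E →L[ℝ] E →L[ℝ] ℝ) (y : E) (v w : E) : E :=
  sharp (G y) ((1 / 2 : ℝ) • (fderiv ℝ G y v w + fderiv ℝ G y w v
    - ((fderiv ℝ G y).flip v).flip w))

/-- The curvature `R(v, w)z = ∇_v ∇_w z - ∇_w ∇_v z` (the vectors being constant, `[v, w] = 0`). -/
def curvature (G : E → E →L[ℝ] E →L[ℝ] ℝ) (y : E) (v w z : E) : E :=
  fderiv ℝ (fun y' => christoffel G y' w z) y v - fderiv ℝ (fun y' => christoffel G y' v z) y w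
    + christoffel G y v (christoffel G y w z) - christoffel G y w (christoffel G y v z)

/-- The covariant derivative `∇^u_v V` of a section `V` of `u⁻¹ T F`, the map `u` having values in
the space `F` with metric `H`. -/
def pullbackDeriv (H : F → F →L[ℝ] F →L[ℝ] ℝ) (u V : E → F) (v : E) (y : E) : F :=
  fderiv ℝ V y v + christoffel H (u y) (fderiv ℝ u y v) (V y)

/-- The second fundamental form `(∇ du)(v, w) = ∇^u_v (du w) - du (∇_v w)`. -/
def secondFundamentalForm (G : E → E →L[ℝ] E →L[ℝ] ℝ) (H : F → F →L[ℝ] F →L[ℝ] ℝ)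
    (u : E → F) (y : E) (v w : E) : F :=
  pullbackDeriv H u (fun y' => fderiv ℝ u y' w) v y - fderiv ℝ u y (christoffel G y v w)

/-- The tension field `τ(u) = trace ∇ du`. -/
def tensionField [FiniteDimensional ℝ E] (G : E → E →L[ℝ] E →L[ℝ] ℝ)
    (H : F → F →L[ℝ] F →L[ℝ] ℝ) (u : E → F) (y : E) : F :=
  metricTrace (G y) (secondFundamentalForm G H u y)

/-- The rough Laplacian `trace (∇^u)² V` of a section `V` of `u⁻¹ T F`. -/
def roughLaplacian [FiniteDimensional ℝ E] (G : E → E →L[ℝ] E →L[ℝ] ℝ)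
    (H : F → F →L[ℝ] F →L[ℝ] ℝ) (u V : E → F) (y : E) : F :=
  metricTrace (G y) fun v w =>
    pullbackDeriv H u (pullbackDeriv H u V w) v y - pullbackDeriv H u V (christoffel G y v w) y

/-- The bitension field
`τ₂(u) = trace (∇^u)² τ(u) + trace R(τ(u), du ·) du ·`. -/
def bitensionField [FiniteDimensional ℝ E] (G : E → E →L[ℝ] E →L[ℝ] ℝ)
    (H : F → F →L[ℝ] F →L[ℝ] ℝ) (u : E → F) (y : E) : F :=
  roughLaplacian G H u (tensionField G H u) y
    + metricTrace (G y) fun v w =>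
        curvature H (u y) (tensionField G H u y) (fderiv ℝ u y v) (fderiv ℝ u y w)

end Coordinates

/-! ### Tensor fields on a manifold and their coordinate expressions

All manifolds are modelled on finite-dimensional real vector spaces and have no boundary. The
coordinate expressions at a point `x` are taken in the chart at `x`. -/

section Manifolds

variable {E : Type*} [NormedAddCommGroup E] [NormedSpace ℝ E]
  {H : Type*} [TopologicalSpace H] (I : ModelWithCorners ℝ E H)
  {M : Type*} [TopologicalSpace M] [ChartedSpace H M]
  {F : Type*} [NormedAddCommGroup F] [NormedSpace ℝ F]
  {H' : Type*} [TopologicalSpace H'] (I' : ModelWithCorners ℝ F H')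
  {N : Type*} [TopologicalSpace N] [ChartedSpace H' N]

/-- The coordinate frame of the chart at `x`, at the point with coordinates `y`. -/
def chartFrame (x : M) (y : E) : E →L[ℝ] TangentSpace I ((extChartAt I x).symm y) :=
  mfderiv 𝓘(ℝ, E) I (extChartAt I x).symm y

/-- A field of bilinear forms, in the chart at `x`. -/
def chartMetric (g : ∀ p : M, TangentSpace I p →L[ℝ] TangentSpace I p →L[ℝ] ℝ) (x : M) (y : E) :
    E →L[ℝ] E →L[ℝ] ℝ :=
  pullbackForm (chartFrame I x y) (g ((extChartAt I x).symm y))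

/-- A one-form, in the chart at `x`. -/
def chartForm (η : ∀ p : M, TangentSpace I p →L[ℝ] ℝ) (x : M) (y : E) : E →L[ℝ] ℝ :=
  (η ((extChartAt I x).symm y)).comp (chartFrame I x y)

/-- A vector field, in the chart at `x`. -/
def chartField (X : ∀ p : M, TangentSpace I p) (x : M) (y : E) : E :=
  (chartFrame I x y).inverse (X ((extChartAt I x).symm y))

/-- A field of endomorphisms, in the chart at `x`. -/
def chartEnd (J : ∀ p : M, TangentSpace I p →L[ℝ] TangentSpace I p) (x : M) (y : E) :
    E →L[ℝ] E :=
  (chartFrame I x y).inverse.comp ((J ((extChartAt I x).symm y)).comp (chartFrame I x y))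

/-- A smooth Riemannian metric. -/
abbrev SmoothMetric (M : Type*) [TopologicalSpace M] [ChartedSpace H M] [IsManifold I ∞ M] :=
  Bundle.ContMDiffRiemannianMetric I ∞ E (fun x : M => TangentSpace I x)

/-- Smoothness of a field of endomorphisms. -/
def SmoothEnd [IsManifold I ∞ M]
    (J : ∀ p : M, TangentSpace I p →L[ℝ] TangentSpace I p) : Prop :=
  ContMDiff I (I.prod 𝓘(ℝ, E →L[ℝ] E)) ∞
    (fun p => Bundle.TotalSpace.mk' (E →L[ℝ] E)
      (E := fun p : M => TangentSpace I p →L[ℝ] TangentSpace I p) p (J p))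

/-- Smoothness of a vector field. -/
def SmoothField [IsManifold I ∞ M] (X : ∀ p : M, TangentSpace I p) : Prop :=
  ContMDiff I I.tangent ∞ (fun p => (⟨p, X p⟩ : TangentBundle I M))

/-- Smoothness of a one-form. -/
def SmoothForm [IsManifold I ∞ M] (η : ∀ p : M, TangentSpace I p →L[ℝ] ℝ) : Prop :=
  ContMDiff I (I.prod 𝓘(ℝ, E →L[ℝ] ℝ)) ∞
    (fun p => Bundle.TotalSpace.mk' (E →L[ℝ] ℝ)
      (E := fun p : M => TangentSpace I p →L[ℝ] ℝ) p (η p))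

/-- The exterior derivative `dη(v, w) = v(η(w)) - w(η(v)) - η([v, w])` at `x`, on coordinate vectors
`v`, `w` of the chart at `x`. -/
def extDerivOneForm (η : ∀ p : M, TangentSpace I p →L[ℝ] ℝ) (x : M) (v w : E) : ℝ :=
  fderiv ℝ (chartForm I η x) (extChartAt I x x) v w
    - fderiv ℝ (chartForm I η x) (extChartAt I x x) w v

/-- The Nijenhuis torsion `[φ, φ](v, w) = [φv, φw] - φ[φv, w] - φ[v, φw] + φ²[v, w]` at `x`, on
coordinate vectors `v`, `w` of the chart at `x` (for which `[v, w] = 0`). -/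
def nijenhuis (φ : ∀ p : M, TangentSpace I p →L[ℝ] TangentSpace I p) (x : M) (v w : E) : E :=
  let y := extChartAt I x x
  let A := chartEnd I φ x
  fderiv ℝ A y (A y v) w - fderiv ℝ A y (A y w) v
    + A y (fderiv ℝ A y w v) - A y (fderiv ℝ A y v w)

/-- The covariant derivative `(∇_v J)(w) = ∇_v (Jw) - J(∇_v w)` at `x` for the Levi-Civita
connection of `g`, on coordinate vectors `v`, `w` of the chart at `x`. -/
def covDerivEnd (g : ∀ p : M, TangentSpace I p →L[ℝ] TangentSpace I p →L[ℝ] ℝ)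
    (J : ∀ p : M, TangentSpace I p →L[ℝ] TangentSpace I p) (x : M) (v w : E) : E :=
  let y := extChartAt I x x
  let G := chartMetric I g x
  let A := chartEnd I J x
  fderiv ℝ A y v w + christoffel G y v (A y w) - A y (christoffel G y v w)

/-- `J` is an almost complex structure for which `g` is Hermitian. -/
def IsAlmostHermitian (g : ∀ p : M, TangentSpace I p →L[ℝ] TangentSpace I p →L[ℝ] ℝ)
    (J : ∀ p : M, TangentSpace I p →L[ℝ] TangentSpace I p) : Prop :=
  (∀ (p : M) (v : TangentSpace I p), J p (J p v) = -v) ∧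
    ∀ (p : M) (v w : TangentSpace I p), g p (J p v) (J p w) = g p v w

/-- `(g, J)` is Kähler: almost Hermitian with `∇J = 0`. -/
def IsKahler (g : ∀ p : M, TangentSpace I p →L[ℝ] TangentSpace I p →L[ℝ] ℝ)
    (J : ∀ p : M, TangentSpace I p →L[ℝ] TangentSpace I p) : Prop :=
  IsAlmostHermitian I g J ∧ ∀ (x : M) (v w : E), covDerivEnd I g J x v w = 0

/-- `(g, J)` is (1,2)-symplectic (or quasi-Kähler, the Gray-Hervella class `W₁ ⊕ W₂`): almost
Hermitian with `(∇_v J) w + (∇_{Jv} J) (Jw) = 0`. -/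
def IsOneTwoSymplectic (g : ∀ p : M, TangentSpace I p →L[ℝ] TangentSpace I p →L[ℝ] ℝ)
    (J : ∀ p : M, TangentSpace I p →L[ℝ] TangentSpace I p) : Prop :=
  IsAlmostHermitian I g J ∧ ∀ (x : M) (v w : E),
    covDerivEnd I g J x v w + covDerivEnd I g J x (chartEnd I J x (extChartAt I x x) v)
      (chartEnd I J x (extChartAt I x x) w) = 0

/-- The gradient of a function. -/
def riemGrad (g : ∀ p : M, TangentSpace I p →L[ℝ] TangentSpace I p →L[ℝ] ℝ) (f : M → ℝ) (p : M) :
    TangentSpace I p :=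
  sharp (g p) (mfderiv I 𝓘(ℝ, ℝ) f p)

/-- The Laplacian `Δf = trace ∇ df` on functions. -/
def laplaceBeltrami [FiniteDimensional ℝ E]
    (g : ∀ p : M, TangentSpace I p →L[ℝ] TangentSpace I p →L[ℝ] ℝ) (f : M → ℝ) (x : M) : ℝ :=
  let y := extChartAt I x x
  let G := chartMetric I g x
  let u : E → ℝ := fun y' => f ((extChartAt I x).symm y')
  metricTrace (G y) fun v w => fderiv ℝ (fderiv ℝ u) y v w - fderiv ℝ u y (christoffel G y v w)

/-- The operator `Δγ + (n - 1) |grad γ|²`, on a manifold of real dimension `2n`. -/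
def conformalOperator [FiniteDimensional ℝ E] (n : ℕ)
    (g : ∀ p : M, TangentSpace I p →L[ℝ] TangentSpace I p →L[ℝ] ℝ) (γ : M → ℝ) (p : M) : ℝ :=
  laplaceBeltrami I g γ p + ((n : ℝ) - 1) * g p (riemGrad I g γ p) (riemGrad I g γ p)

/-- The vector field `J (e^{(n-3)γ} grad γ)`, on a manifold of real dimension `2n`. -/
def twistedGradient (n : ℕ) (g : ∀ p : M, TangentSpace I p →L[ℝ] TangentSpace I p →L[ℝ] ℝ)
    (J : ∀ p : M, TangentSpace I p →L[ℝ] TangentSpace I p) (γ : M → ℝ) (p : M) :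
    TangentSpace I p :=
  J p (Real.exp (((n : ℝ) - 3) * γ p) • riemGrad I g γ p)

/-- `X` is a Killing vector field: `L_X g = 0`, i.e.
`D_X g(v, w) + g(D_v X, w) + g(v, D_w X) = 0` in coordinates. -/
def IsKilling (g : ∀ p : M, TangentSpace I p →L[ℝ] TangentSpace I p →L[ℝ] ℝ)
    (X : ∀ p : M, TangentSpace I p) : Prop :=
  ∀ (x : M) (v w : E),
    let y := extChartAt I x x
    let G := chartMetric I g x
    let Y := chartField I X x
    fderiv ℝ G y (Y y) v w + G y (fderiv ℝ Y y v) w + G y v (fderiv ℝ Y y w) = 0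

/-- `X` is a (real) holomorphic vector field: `L_X J = 0`, i.e. `[X, Jv] = J[X, v]` for all
coordinate vectors `v`. -/
def IsHolomorphicField (J : ∀ p : M, TangentSpace I p →L[ℝ] TangentSpace I p)
    (X : ∀ p : M, TangentSpace I p) : Prop :=
  ∀ (x : M) (v : E),
    let y := extChartAt I x x
    let A := chartEnd I J x
    let Y := chartField I X x
    fderiv ℝ A y (Y y) v - fderiv ℝ Y y (A y v) + A y (fderiv ℝ Y y v) = 0

/-- A smooth map that intertwines the almost complex structures. -/
def IsHolomorphicMap (J : ∀ p : M, TangentSpace I p →L[ℝ] TangentSpace I p)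
    (J' : ∀ q : N, TangentSpace I' q →L[ℝ] TangentSpace I' q) (f : M → N) : Prop :=
  ContMDiff I I' ∞ f ∧ ∀ (p : M) (v : TangentSpace I p),
    mfderiv I I' f p (J p v) = J' (f p) (mfderiv I I' f p v)

/-- A map between Riemannian manifolds is biharmonic if its bitension field vanishes at every
point. -/
def IsBiharmonic [FiniteDimensional ℝ E]
    (g : ∀ p : M, TangentSpace I p →L[ℝ] TangentSpace I p →L[ℝ] ℝ)
    (h : ∀ q : N, TangentSpace I' q →L[ℝ] TangentSpace I' q →L[ℝ] ℝ) (f : M → N) : Prop :=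
  ∀ x : M, bitensionField (chartMetric I g x) (chartMetric I' h (f x))
    (writtenInExtChartAt I I' x f) (extChartAt I x x) = 0

end Manifolds

/-! ### Sasakian manifolds and their cones -/

section Sasakian

variable (E : Type*) [NormedAddCommGroup E] [NormedSpace ℝ E]
  (S : Type*) [TopologicalSpace S] [ChartedSpace E S] [IsManifold 𝓘(ℝ, E) ∞ S]

/-- A Sasakian structure, i.e. a normal contact metric structure. The exterior derivative is
normalised by `dη(v, w) = v(η(w)) - w(η(v)) - η([v, w])`, so that the contact metric condition is
`dη(v, w) = 2 g(v, φw)` and normality is `[φ, φ] + dη ⊗ ξ = 0`. -/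
structure SasakianStructure where
  /-- the metric -/
  g : SmoothMetric 𝓘(ℝ, E) S
  /-- the structure endomorphism -/
  φ : ∀ p : S, TangentSpace 𝓘(ℝ, E) p →L[ℝ] TangentSpace 𝓘(ℝ, E) p
  /-- the Reeb field -/
  ξ : ∀ p : S, TangentSpace 𝓘(ℝ, E) p
  /-- the contact form -/
  η : ∀ p : S, TangentSpace 𝓘(ℝ, E) p →L[ℝ] ℝ
  smooth_φ : SmoothEnd 𝓘(ℝ, E) φ
  smooth_ξ : SmoothField 𝓘(ℝ, E) ξ
  smooth_η : SmoothForm 𝓘(ℝ, E) η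
  η_ξ : ∀ p, η p (ξ p) = 1
  φ_φ : ∀ (p : S) (v : TangentSpace 𝓘(ℝ, E) p), φ p (φ p v) = -v + η p v • ξ p
  compatible : ∀ (p : S) (v w : TangentSpace 𝓘(ℝ, E) p),
    g.inner p (φ p v) (φ p w) = g.inner p v w - η p v * η p w
  contact : ∀ (x : S) (v w : E), extDerivOneForm 𝓘(ℝ, E) η x v w =
    2 * chartMetric 𝓘(ℝ, E) g.inner x (extChartAt 𝓘(ℝ, E) x x) v
      (chartEnd 𝓘(ℝ, E) φ x (extChartAt 𝓘(ℝ, E) x x) w)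
  normal : ∀ (x : S) (v w : E), nijenhuis 𝓘(ℝ, E) φ x v w
    + extDerivOneForm 𝓘(ℝ, E) η x v w •
      chartField 𝓘(ℝ, E) ξ x (extChartAt 𝓘(ℝ, E) x x) = 0

/-- A smooth (1,2)-symplectic almost Hermitian structure. -/
structure OneTwoSymplecticStructure where
  /-- the metric -/
  h : SmoothMetric 𝓘(ℝ, E) S
  /-- the almost complex structure -/
  J : ∀ p : S, TangentSpace 𝓘(ℝ, E) p →L[ℝ] TangentSpace 𝓘(ℝ, E) p
  smooth_J : SmoothEnd 𝓘(ℝ, E) J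
  oneTwoSymplectic : IsOneTwoSymplectic 𝓘(ℝ, E) h.inner J

/-- The open half-line of positive real numbers, an open submanifold of `ℝ`. -/
abbrev HalfLine : TopologicalSpace.Opens ℝ := ⟨Set.Ioi 0, isOpen_Ioi⟩

/-- The cone `(0, ∞) × S`; a tangent vector `(a, X)` at `(r, s)` stands for `a ∂_r + X`. -/
abbrev Cone := HalfLine × S

/-- The model of the cone. -/
abbrev coneModel : ModelWithCorners ℝ (ℝ × E) (ModelProd ℝ E) := 𝓘(ℝ, ℝ).prod 𝓘(ℝ, E)

variable {E S}

/-- The cone metric `dr² + r² g`. -/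
def SasakianStructure.coneMetric (σ : SasakianStructure E S) (p : Cone S) :
    TangentSpace (coneModel E) p →L[ℝ] TangentSpace (coneModel E) p →L[ℝ] ℝ :=
  let pr₁ : TangentSpace (coneModel E) p →L[ℝ] ℝ := ContinuousLinearMap.fst ℝ ℝ E
  let pr₂ : TangentSpace (coneModel E) p →L[ℝ] TangentSpace 𝓘(ℝ, E) p.2 :=
    ContinuousLinearMap.snd ℝ ℝ E
  pr₁.smulRight pr₁ + (p.1 : ℝ) ^ 2 • pullbackForm pr₂ (σ.g.inner p.2)

/-- The complex structure of the cone: `J X = φ X + η(X) r ∂_r` and `J (r ∂_r) = -ξ`, that is,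
`J (X + a ∂_r) = (φ X - (a / r) ξ) + r η(X) ∂_r`. -/
def SasakianStructure.coneJ (σ : SasakianStructure E S) (p : Cone S) :
    TangentSpace (coneModel E) p →L[ℝ] TangentSpace (coneModel E) p :=
  let pr₁ : TangentSpace (coneModel E) p →L[ℝ] ℝ := ContinuousLinearMap.fst ℝ ℝ E
  let pr₂ : TangentSpace (coneModel E) p →L[ℝ] TangentSpace 𝓘(ℝ, E) p.2 :=
    ContinuousLinearMap.snd ℝ ℝ E
  ContinuousLinearMap.prod ((p.1 : ℝ) • (σ.η p.2).comp pr₂)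
    ((σ.φ p.2).comp pr₂ - (p.1 : ℝ)⁻¹ • pr₁.smulRight (σ.ξ p.2))

end Sasakian

end HoloBiharmonic

end

open HoloBiharmonic

/-! Kähler property. The contact condition makes the fundamental form `ω(v, w) = ĝ(v, Jw)` of the
cone exact, `ω = d(r²η/2)`, so `dω = 0`. Normality, together with its consequence `L_ξ φ = 0`, makes
the Nijenhuis tensor of `J` vanish (`SasakianAt.nijenhuis_cone`). An almost Hermitian structure with
`dω = 0` and `N = 0` has `∇J = 0` (`AlmostHermitianAt.localCovDeriv_eq_zero`).

Radial statements. Since `grad γ = γ' ∂_r` and `J ∂_r = -ξ/r`, the field `J(e^{(n-3)γ} grad γ)` has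
the form `F(r) ξ`. The Reeb field is Killing, so `F ξ` is Killing exactly when `F' = 0`
(`isKilling_xi_iff`); likewise `F ∂_r` is holomorphic exactly when `F = r F'`
(`isHolomorphicField_radial_iff`). What remains is ordinary differential equations: the two
conditions of point 4 force `γ' = 0` everywhere or `γ' = -n/r` everywhere, and the latter is
compatible with the Killing equation only if `n(n-1)(n-2) = 0`.

Biharmonicity. Let `u` be holomorphic from the cone to a (1,2)-symplectic target, with second
fundamental form `B` relative to `ĝ`. Then `B(Jv, Jw) = -B(v, w)`, so its trace vanishes and `u` is
harmonic for `ĝ`. In real dimension 4, passing to `r⁻⁴ ĝ` gives `τ(u) = -4r² V` with `V = du(r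
∂_r)`. The dilations of the cone are affine and holomorphic, so `u` composed with dilations is a
family of holomorphic, hence harmonic, maps, and its variation field `V` is a Jacobi field.
Concretely, the anti-invariance of `B` is differentiated along the dilations, which makes the
summand of the Jacobi operator anti-invariant (`metricTrace_jacobiForm_eq_zero`). The other terms of
the bitension field involve only `V` and `∇_{∂_r} V`, and their coefficients cancel because the
trace of the metric is 4 (`bitensionField_conformalForm`).

Passage to charts. The tensor conditions on manifolds are stated at the centre of each chart only,
while these arguments differentiate identities on a neighbourhood in one fixed chart. The
transformation laws under coordinate changes bridge the gap. -/

set_option maxSynthPendingDepth 3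

namespace HoloBiharmonic

/-! ### Forms, musical isomorphisms and metric traces on a vector space -/

section LinearAlgebra

variable {E W : Type*} [NormedAddCommGroup E] [NormedSpace ℝ E] [AddCommGroup W] [Module ℝ W]

theorem isInvertible_of_posDef [FiniteDimensional ℝ E] {B : E →L[ℝ] E →L[ℝ] ℝ}
    (hB : ∀ v, v ≠ 0 → 0 < B v v) : B.IsInvertible := by
  have hinj : Function.Injective (B : E →ₗ[ℝ] E →L[ℝ] ℝ) := by
    rw [← LinearMap.ker_eq_bot, LinearMap.ker_eq_bot']
    intro v hv
    by_contra h
    have := hB v h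
    have h2 : B v = 0 := hv
    simp [h2] at this
  have hdim : Module.finrank ℝ E = Module.finrank ℝ (E →L[ℝ] ℝ) := by
    rw [← Subspace.dual_finrank_eq]
    exact (LinearMap.toContinuousLinearMap (𝕜 := ℝ) (E := E) (F' := ℝ)).finrank_eq
  refine ⟨(LinearMap.linearEquivOfInjective _ hinj hdim).toContinuousLinearEquiv, ?_⟩
  ext v w
  rfl

theorem sharp_spec {B : E →L[ℝ] E →L[ℝ] ℝ} (hB : B.IsInvertible) (α : E →L[ℝ] ℝ) :
    B (sharp B α) = α :=
  DFunLike.congr_fun hB.self_comp_inverse α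

theorem sharp_eq {B : E →L[ℝ] E →L[ℝ] ℝ} (hB : B.IsInvertible) {α : E →L[ℝ] ℝ} {v : E}
    (h : ∀ w, B v w = α w) : sharp B α = v := by
  have : B v = α := by ext w; exact h w
  rw [← this]
  exact DFunLike.congr_fun hB.inverse_comp_self v

theorem eq_of_form_eq {B : E →L[ℝ] E →L[ℝ] ℝ} (hB : B.IsInvertible) {v w : E}
    (h : ∀ z, B v z = B w z) : v = w := by
  rw [← sharp_eq hB (α := B w) h, sharp_eq hB (fun _ => rfl)]

/-- The `i`-th coordinate form of the basis used in the metric trace. -/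
noncomputable def coordForm [FiniteDimensional ℝ E] (i : Fin (Module.finrank ℝ E)) : E →L[ℝ] ℝ :=
  LinearMap.toContinuousLinearMap ((Module.finBasis ℝ E).coord i)

theorem coordForm_sum [FiniteDimensional ℝ E] (v : E) :
    ∑ i, coordForm i v • Module.finBasis ℝ E i = v :=
  (Module.finBasis ℝ E).sum_repr v

theorem form_sum_coordForm [FiniteDimensional ℝ E] (α : E →L[ℝ] ℝ) :
    ∑ i, α (Module.finBasis ℝ E i) • coordForm i = α := by
  ext v
  conv_rhs => rw [← coordForm_sum v, map_sum]
  simp [mul_comm]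

theorem sharp_sum [FiniteDimensional ℝ E] (B : E →L[ℝ] E →L[ℝ] ℝ) (α : E →L[ℝ] ℝ) :
    ∑ i, α (Module.finBasis ℝ E i) • sharp B (coordForm i) = sharp B α := by
  conv_rhs => rw [← form_sum_coordForm α]
  simp [sharp, map_sum]

theorem metricTrace_eq {V : Type*} [AddCommGroup V] [FiniteDimensional ℝ E]
    (B : E →L[ℝ] E →L[ℝ] ℝ) (T : E → E → V) :
    metricTrace B T = ∑ i, T (Module.finBasis ℝ E i) (sharp B (coordForm i)) := rfl

theorem metricTrace_add {V : Type*} [AddCommGroup V] [FiniteDimensional ℝ E]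
    (B : E →L[ℝ] E →L[ℝ] ℝ) (T T' : E → E → V) :
    metricTrace B (fun v w => T v w + T' v w) = metricTrace B T + metricTrace B T' := by
  simp [metricTrace, Finset.sum_add_distrib]

theorem metricTrace_smul [FiniteDimensional ℝ E] (B : E →L[ℝ] E →L[ℝ] ℝ) (c : ℝ) (T : E → E → W) :
    metricTrace B (fun v w => c • T v w) = c • metricTrace B T := by
  simp [metricTrace, Finset.smul_sum]

theorem metricTrace_form_left [FiniteDimensional ℝ E] (B : E →L[ℝ] E →L[ℝ] ℝ) (α : E →L[ℝ] ℝ)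
    (S : E →ₗ[ℝ] W) : metricTrace B (fun v w => α v • S w) = S (sharp B α) := by
  rw [metricTrace_eq, ← sharp_sum]
  simp

/-- Unlike in the left version, symmetry of `B` is needed: `metricTrace` raises the index in the
second slot only. -/
theorem metricTrace_form_right [FiniteDimensional ℝ E] {B : E →L[ℝ] E →L[ℝ] ℝ}
    (hB : B.IsInvertible) (hs : ∀ v w, B v w = B w v) (α : E →L[ℝ] ℝ)
    (S : E →ₗ[ℝ] W) : metricTrace B (fun v w => α w • S v) = S (sharp B α) := by
  rw [metricTrace_eq, ← coordForm_sum (sharp B α), map_sum]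
  refine Finset.sum_congr rfl fun i _ => ?_
  have : α (sharp B (coordForm i)) = coordForm i (sharp B α) := by
    rw [← DFunLike.congr_fun (sharp_spec hB α), ← DFunLike.congr_fun (sharp_spec hB (coordForm i)),
      hs]
  rw [map_smul, this]

theorem metricTrace_self [FiniteDimensional ℝ E] {B : E →L[ℝ] E →L[ℝ] ℝ}
    (hB : B.IsInvertible) (hs : ∀ v w, B v w = B w v) (c : W) :
    metricTrace B (fun v w => B v w • c) = (Module.finrank ℝ E : ℝ) • c := by
  rw [metricTrace_eq]
  have : ∀ i, B (Module.finBasis ℝ E i) (sharp B (coordForm i)) = 1 := by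
    intro i
    rw [hs, sharp_spec hB]
    simp [coordForm]
  simp [this, ← Nat.cast_smul_eq_nsmul ℝ]

theorem metricTrace_smul_form [FiniteDimensional ℝ E] {B : E →L[ℝ] E →L[ℝ] ℝ}
    (hB : B.IsInvertible) {c : ℝ} (hc : c ≠ 0) (T : E →ₗ[ℝ] E →ₗ[ℝ] W) :
    metricTrace (c • B) (fun v w => T v w) = c⁻¹ • metricTrace B (fun v w => T v w) := by
  have hcB : (c • B).IsInvertible := by
    obtain ⟨e, he⟩ := hB
    refine ⟨(ContinuousLinearEquiv.smulLeft (Units.mk0 c hc)).trans e, ?_⟩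
    ext v w
    simp [← he]
  have : ∀ α, sharp (c • B) α = c⁻¹ • sharp B α := by
    intro α
    apply sharp_eq hcB
    intro w
    simp [sharp_spec hB, hc]
  simp [metricTrace_eq, this, Finset.smul_sum]

/-- The isometry `J` carries a basis and its `B`-dual basis to another such pair, so it leaves the
trace unchanged; anti-invariance then makes the trace equal to its own negative. No symmetry of `T`
is needed. -/
theorem metricTrace_eq_zero_of_anti_invariant [FiniteDimensional ℝ E] {B : E →L[ℝ] E →L[ℝ] ℝ}
    (hB : B.IsInvertible) {J : E →L[ℝ] E} (hJ : ∀ v, J (J v) = -v)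
    (hJB : ∀ v w, B (J v) (J w) = B v w) (T : E →ₗ[ℝ] E →ₗ[ℝ] W)
    (hT : ∀ v w, T (J v) (J w) = -T v w) : metricTrace B (fun v w => T v w) = 0 := by
  have hsharp : ∀ α : E →L[ℝ] ℝ, J (sharp B (α.comp J)) = sharp B α := by
    intro α
    refine (sharp_eq hB fun w => ?_).symm
    rw [← hJB, hJ, map_neg, neg_apply, sharp_spec hB]
    simp [hJ]
  have key : metricTrace B (fun v w => T (J v) (J w)) = metricTrace B (fun v w => T v w) := by
    simp only [metricTrace_eq]
    -- Expand `J b_i` in the basis and exchange the sums: the matrix of `J` moves to the second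
    -- slot, where `hsharp` absorbs it.
    calc ∑ i, T (J (Module.finBasis ℝ E i)) (J (sharp B (coordForm i)))
        = ∑ i, ∑ j, coordForm j (J (Module.finBasis ℝ E i)) •
            T (Module.finBasis ℝ E j) (J (sharp B (coordForm i))) := by
          refine Finset.sum_congr rfl fun i _ => ?_
          conv_lhs => rw [← coordForm_sum (J (Module.finBasis ℝ E i))]
          simp
      _ = ∑ j, T (Module.finBasis ℝ E j) (J (∑ i, coordForm j (J (Module.finBasis ℝ E i)) •
            sharp B (coordForm i))) := by
          rw [Finset.sum_comm]
          simp
      _ = _ := by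
          refine Finset.sum_congr rfl fun j _ => ?_
          rw [← hsharp (coordForm j), ← sharp_sum B ((coordForm j).comp J)]
          rfl
  have h2 : metricTrace B (fun v w => T (J v) (J w)) = -metricTrace B (fun v w => T v w) := by
    simp [metricTrace, hT]
  rw [key] at h2
  have h3 : (2 : ℝ) • metricTrace B (fun v w => T v w) = 0 := by
    rw [two_smul]
    nth_rewrite 1 [h2]
    simp
  exact (smul_eq_zero.mp h3).resolve_left two_ne_zero

end LinearAlgebra

/-! ### The Levi-Civita connection in a coordinate patch -/

section Christoffel

variable {E : Type*} [NormedAddCommGroup E] [NormedSpace ℝ E]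

theorem christoffel_spec {G : E → E →L[ℝ] E →L[ℝ] ℝ} {y : E} (hG : (G y).IsInvertible) (v w z : E) :
    G y (christoffel G y v w) z
      = (1 / 2) * (fderiv ℝ G y v w z + fderiv ℝ G y w v z - fderiv ℝ G y z v w) := by
  rw [christoffel, sharp_spec hG]
  simp

theorem christoffel_eq {G : E → E →L[ℝ] E →L[ℝ] ℝ} {y : E} (hG : (G y).IsInvertible) {v w u : E}
    (h : ∀ z, 2 * G y u z = fderiv ℝ G y v w z + fderiv ℝ G y w v z - fderiv ℝ G y z v w) :
    christoffel G y v w = u := by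
  refine eq_of_form_eq hG fun z => ?_
  rw [christoffel_spec hG, ← h z]
  ring

/-- The Christoffel symbol as a bilinear map. -/
noncomputable def christoffelCLM (G : E → E →L[ℝ] E →L[ℝ] ℝ) (y : E) : E →L[ℝ] E →L[ℝ] E :=
  (ContinuousLinearMap.compL ℝ E (E →L[ℝ] ℝ) E (G y).inverse).comp ((1 / 2 : ℝ) • (fderiv ℝ G y +
    (fderiv ℝ G y).flip - ((ContinuousLinearMap.flipₗᵢ ℝ E E ℝ :
      (E →L[ℝ] E →L[ℝ] ℝ) →L[ℝ] E →L[ℝ] E →L[ℝ] ℝ)).comp (fderiv ℝ G y).flip))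

theorem christoffelCLM_apply (G : E → E →L[ℝ] E →L[ℝ] ℝ) (y v w : E) :
    christoffelCLM G y v w = christoffel G y v w := by
  rw [christoffel, sharp, christoffelCLM]
  simp

theorem fderiv_form_symm {G : E → E →L[ℝ] E →L[ℝ] ℝ} {y : E} (hd : DifferentiableAt ℝ G y)
    (hs : ∀ᶠ z in nhds y, ∀ v w, G z v w = G z w v) (u v w : E) :
    fderiv ℝ G y u v w = fderiv ℝ G y u w v := by
  have h1 : (fun z => G z v w) =ᶠ[nhds y] fun z => G z w v := hs.mono fun z h => h v w
  have h2 : ∀ a b, fderiv ℝ (fun z => G z a b) y u = fderiv ℝ G y u a b := by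
    intro a b
    have := ((hd.hasFDerivAt.clm_apply (hasFDerivAt_const a y)).clm_apply
      (hasFDerivAt_const b y)).fderiv
    rw [this]
    simp
  rw [← h2, ← h2, h1.fderiv_eq]

theorem christoffel_symm {G : E → E →L[ℝ] E →L[ℝ] ℝ} {y : E} (hd : DifferentiableAt ℝ G y)
    (hG : (G y).IsInvertible) (hs : ∀ᶠ z in nhds y, ∀ v w, G z v w = G z w v) (v w : E) :
    christoffel G y v w = christoffel G y w v := by
  refine christoffel_eq hG fun z => ?_
  rw [christoffel_spec hG, fderiv_form_symm hd hs z v w]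
  ring

/-- Metric compatibility of the connection: add the Koszul formulas for the two terms on the right.
Symmetry of `G` is assumed near `y` so that it passes to the derivative of `G`. -/
theorem fderiv_metric {G : E → E →L[ℝ] E →L[ℝ] ℝ} {y : E} (hd : DifferentiableAt ℝ G y)
    (hG : (G y).IsInvertible) (hs : ∀ᶠ z in nhds y, ∀ v w, G z v w = G z w v) (u v w : E) :
    fderiv ℝ G y u v w = G y (christoffel G y u v) w + G y v (christoffel G y u w) := by
  rw [hs.self_of_nhds v, christoffel_spec hG, christoffel_spec hG, fderiv_form_symm hd hs u w v,
    fderiv_form_symm hd hs v u w, fderiv_form_symm hd hs w u v]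
  ring

theorem contDiffAt_christoffelCLM [CompleteSpace E] {G : E → E →L[ℝ] E →L[ℝ] ℝ} {y : E}
    (hd : ContDiffAt ℝ ∞ G y) (hG : (G y).IsInvertible) : ContDiffAt ℝ ∞ (christoffelCLM G) y := by
  have h1 : ContDiffAt ℝ ∞ (fderiv ℝ G) y := hd.fderiv_right (m := ∞) (by simp)
  have h2 : ContDiffAt ℝ ∞ (fun z => (G z).inverse) y := hG.contDiffAt_map_inverse.comp y hd
  have h3 : ContDiffAt ℝ ∞ (fun z => (fderiv ℝ G z).flip) y :=
    (ContinuousLinearMap.flipₗᵢ ℝ E E (E →L[ℝ] ℝ)).toContinuousLinearEquiv.contDiff.contDiffAt.comp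
      y h1
  have h4 : ContDiffAt ℝ ∞ (fun z => ContinuousLinearMap.compL ℝ E (E →L[ℝ] ℝ) E (G z).inverse) y :=
    (ContinuousLinearMap.compL ℝ E (E →L[ℝ] ℝ) E).contDiff.contDiffAt.comp y h2
  unfold christoffelCLM
  exact h4.clm_comp (((h1.add h3).sub (contDiffAt_const.clm_comp h3)).const_smul (1 / 2 : ℝ))

end Christoffel

/-! ### Almost Hermitian structures and the Kähler criterion -/

section AlmostHermitian

variable {E : Type*} [NormedAddCommGroup E] [NormedSpace ℝ E]

/-- The covariant derivative of a field of endomorphisms of a coordinate patch. -/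
noncomputable def localCovDeriv (G : E → E →L[ℝ] E →L[ℝ] ℝ) (A : E → E →L[ℝ] E) (y v w : E) : E :=
  fderiv ℝ A y v w + christoffel G y v (A y w) - A y (christoffel G y v w)

/-- A metric and a compatible almost complex structure near a point of a coordinate patch. -/
structure AlmostHermitianAt (G : E → E →L[ℝ] E →L[ℝ] ℝ) (A : E → E →L[ℝ] E) (y : E) : Prop where
  contDiff_metric : ContDiffAt ℝ ∞ G y
  contDiff_end : ContDiffAt ℝ ∞ A y
  invertible : (G y).IsInvertible
  symm : ∀ᶠ z in nhds y, ∀ v w, G z v w = G z w v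
  sq : ∀ᶠ z in nhds y, ∀ v, A z (A z v) = -v
  isometry : ∀ᶠ z in nhds y, ∀ v w, G z (A z v) (A z w) = G z v w

namespace AlmostHermitianAt

variable {G : E → E →L[ℝ] E →L[ℝ] ℝ} {A : E → E →L[ℝ] E} {y : E}

theorem differentiable_metric (h : AlmostHermitianAt G A y) : DifferentiableAt ℝ G y :=
  h.contDiff_metric.differentiableAt (by simp)

theorem differentiable_end (h : AlmostHermitianAt G A y) : DifferentiableAt ℝ A y :=
  h.contDiff_end.differentiableAt (by simp)

theorem christoffel_symm (h : AlmostHermitianAt G A y) (v w : E) :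
    christoffel G y v w = christoffel G y w v :=
  HoloBiharmonic.christoffel_symm h.differentiable_metric h.invertible h.symm v w

theorem skew (h : AlmostHermitianAt G A y) :
    ∀ᶠ z in nhds y, ∀ v w, G z (A z v) w + G z v (A z w) = 0 := by
  filter_upwards [h.sq, h.isometry] with z h1 h2 v w
  have := h2 v (A z w)
  rw [h1, map_neg] at this
  linarith

/-- Differentiate `A² = -1`. -/
theorem fderiv_end_anticomm (h : AlmostHermitianAt G A y) (v w : E) :
    fderiv ℝ A y v (A y w) = -A y (fderiv ℝ A y v w) := by
  have h1 : (fun z => A z (A z w)) =ᶠ[nhds y] fun _ => -w := h.sq.mono fun z h => h w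
  have hA := h.differentiable_end.hasFDerivAt
  have h2 := (hA.clm_apply (hA.clm_apply (hasFDerivAt_const w y))).fderiv
  rw [h1.fderiv_eq] at h2
  have h3 := DFunLike.congr_fun h2 v
  simp at h3
  exact eq_neg_of_add_eq_zero_right h3.symm

theorem localCovDeriv_anticomm (h : AlmostHermitianAt G A y) (v w : E) :
    localCovDeriv G A y v (A y w) = -A y (localCovDeriv G A y v w) := by
  simp only [localCovDeriv, map_add, map_sub, h.sq.self_of_nhds, h.fderiv_end_anticomm]
  simp only [← christoffelCLM_apply, map_neg]
  abel

/-- Differentiate the skewness of `A` and express the derivative of `G` through Christoffel symbols.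
-/
theorem localCovDeriv_skew (h : AlmostHermitianAt G A y) (v w z : E) :
    G y (localCovDeriv G A y v w) z = -G y w (localCovDeriv G A y v z) := by
  have h1 : (fun x => G x (A x w) z + G x w (A x z)) =ᶠ[nhds y] fun _ => 0 :=
    h.skew.mono fun x h => h w z
  have hA := h.differentiable_end.hasFDerivAt
  have hG := h.differentiable_metric.hasFDerivAt
  have h2 := (((hG.clm_apply (hA.clm_apply (hasFDerivAt_const w y))).clm_apply
    (hasFDerivAt_const z y)).add ((hG.clm_apply (hasFDerivAt_const w y)).clm_apply
      (hA.clm_apply (hasFDerivAt_const z y)))).fderiv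
  have h1' := h1.fderiv_eq (𝕜 := ℝ)
  simp only [Pi.add_def] at h2
  rw [h2] at h1'
  have h3 := DFunLike.congr_fun h1' v
  simp [fderiv_metric h.differentiable_metric h.invertible h.symm] at h3
  have h4 := h.skew.self_of_nhds w (christoffel G y v z)
  have h5 := h.skew.self_of_nhds (christoffel G y v w) z
  simp only [localCovDeriv, map_add, map_sub, add_apply, sub_apply]
  linarith

/-- An almost Hermitian structure with closed fundamental form and vanishing Nijenhuis tensor is
Kähler. -/
theorem localCovDeriv_eq_zero (h : AlmostHermitianAt G A y)
    (hω : ∀ u v w, fderiv ℝ G y u v (A y w) + G y v (fderiv ℝ A y u w)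
      + (fderiv ℝ G y v w (A y u) + G y w (fderiv ℝ A y v u))
      + (fderiv ℝ G y w u (A y v) + G y u (fderiv ℝ A y w v)) = 0)
    (hN : ∀ v w, fderiv ℝ A y (A y v) w - fderiv ℝ A y (A y w) v
      + A y (fderiv ℝ A y w v) - A y (fderiv ℝ A y v w) = 0) (v w : E) :
    localCovDeriv G A y v w = 0 := by
  have hs := h.symm.self_of_nhds
  have hJ := h.sq.self_of_nhds
  have hiso := h.isometry.self_of_nhds
  have hsk := h.skew.self_of_nhds
  set T := localCovDeriv G A y with hT
  have skewT : ∀ v w z, G y (T v w) z = -G y (T v z) w := fun v w z => by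
    rw [hT, h.localCovDeriv_skew v w z, hs, ← hT]
  have JT : ∀ v w z, G y (T v (A y w)) z = G y (T v w) (A y z) := fun v w z => by
    rw [hT, h.localCovDeriv_anticomm v w, map_neg, neg_apply, ← hT]
    linarith [hsk (T v w) z]
  -- The hypothesis `dω = 0` in terms of `T = ∇J`: the Christoffel terms cancel in the cyclic sum
  -- because the connection is torsion-free.
  have cyc : ∀ u v w, G y (T u v) w + G y (T v w) u + G y (T w u) v = 0 := by
    intro u v w
    have key : ∀ u v w, fderiv ℝ G y u v (A y w) + G y v (fderiv ℝ A y u w)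
        = G y (christoffel G y u v) (A y w) - G y (christoffel G y u w) (A y v)
          + G y (T u w) v := by
      intro u v w
      rw [fderiv_metric h.differentiable_metric h.invertible h.symm, hs (T u w) v, hT,
        localCovDeriv, map_sub, map_add]
      have := hsk v (christoffel G y u w)
      rw [hs (christoffel G y u w)]
      linarith
    have := hω u w v
    rw [key, key, key, h.christoffel_symm w v, h.christoffel_symm u v, h.christoffel_symm w u] at this
    linarith
  -- The Nijenhuis tensor in terms of `∇J`, paired with `A v`; torsion-freeness again removes the
  -- Christoffel terms.
  have nij : ∀ v w z, G y (T (A y w) z) (A y v) - G y (T (A y z) w) (A y v) + G y (T z w) v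
      - G y (T w z) v = 0 := by
    intro v w z
    have h1 : T (A y w) z - T (A y z) w + A y (T z w) - A y (T w z) = 0 := by
      rw [← hN w z]
      simp only [hT, localCovDeriv, map_add, map_sub]
      rw [hJ, hJ, h.christoffel_symm (A y w) (A y z), h.christoffel_symm (A y w) z,
        h.christoffel_symm (A y z) w, h.christoffel_symm z w]
      abel
    have h2 : G y (T (A y w) z - T (A y z) w + A y (T z w) - A y (T w z)) (A y v) = 0 := by
      rw [h1]; simp
    simp only [map_sub, map_add, sub_apply, add_apply, hiso] at h2
    linarith
  refine eq_of_form_eq h.invertible fun z => ?_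
  -- Subtract `cyc` at `(v, Aw, Az)` from `cyc` at `(v, w, z)`. By `e4` the leading terms add up to
  -- `2 G(T v w, z)`, and `e5` to `e8` turn the other four terms into minus the left side of `nij`.
  have e1 := nij v w z
  have e2 := cyc v w z
  have e3 := cyc v (A y w) (A y z)
  have e4 : G y (T v (A y w)) (A y z) = -G y (T v w) z := by rw [JT, hJ, map_neg]
  have e5 := JT (A y w) z v
  have e6 := skewT (A y z) v (A y w)
  have e7 := JT (A y z) w v
  have e8 := skewT z w v
  simp only [map_zero, zero_apply]
  linarith

end AlmostHermitianAt

end AlmostHermitian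

/-! ### Transformation laws under a change of coordinates -/

section Transition

variable {E : Type*} [NormedAddCommGroup E] [NormedSpace ℝ E]
  {G G' : E → E →L[ℝ] E →L[ℝ] ℝ} {A A' : E → E →L[ℝ] E} {τ : E → E} {y : E}

theorem fderiv_pullback_metric (hτ : ContDiffAt ℝ 2 τ y) (hG' : DifferentiableAt ℝ G' (τ y))
    (hG : DifferentiableAt ℝ G y)
    (h : ∀ᶠ z in nhds y, ∀ v w, G z v w = G' (τ z) (fderiv ℝ τ z v) (fderiv ℝ τ z w)) (u v w : E) :
    fderiv ℝ G y u v w = fderiv ℝ G' (τ y) (fderiv ℝ τ y u) (fderiv ℝ τ y v) (fderiv ℝ τ y w)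
      + G' (τ y) (fderiv ℝ (fderiv ℝ τ) y u v) (fderiv ℝ τ y w)
      + G' (τ y) (fderiv ℝ τ y v) (fderiv ℝ (fderiv ℝ τ) y u w) := by
  have h1 : (fun z => G z v w) =ᶠ[nhds y] fun z => G' (τ z) (fderiv ℝ τ z v) (fderiv ℝ τ z w) :=
    h.mono fun z h => h v w
  have hτ1 := (hτ.differentiableAt (by simp)).hasFDerivAt
  have hτ2 := ((hτ.fderiv_right (m := 1) (by norm_num)).differentiableAt (by simp)).hasFDerivAt
  have h2 := ((((hG'.hasFDerivAt.comp y hτ1).clm_apply (hτ2.clm_apply (hasFDerivAt_const v y)))).clm_apply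
    (hτ2.clm_apply (hasFDerivAt_const w y))).fderiv
  have h3 := ((hG.hasFDerivAt.clm_apply (hasFDerivAt_const v y)).clm_apply
    (hasFDerivAt_const w y)).fderiv
  have h4 := h1.fderiv_eq (𝕜 := ℝ)
  simp only [Function.comp_def] at h2
  rw [h3, h2] at h4
  have h5 := DFunLike.congr_fun h4 u
  simp at h5
  rw [h5]
  ring

/-- Compare the Koszul formulas of `G` and `G'`. Surjectivity of `dτ` makes vectors `dτ z`
sufficient for testing the identity. -/
theorem christoffel_transition (hτ : ContDiffAt ℝ 2 τ y) (hG' : DifferentiableAt ℝ G' (τ y))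
    (hG : DifferentiableAt ℝ G y) (hi : (G y).IsInvertible) (hi' : (G' (τ y)).IsInvertible)
    (hs : ∀ᶠ z in nhds (τ y), ∀ v w, G' z v w = G' z w v)
    (hsurj : Function.Surjective (fderiv ℝ τ y))
    (h : ∀ᶠ z in nhds y, ∀ v w, G z v w = G' (τ z) (fderiv ℝ τ z v) (fderiv ℝ τ z w)) (v w : E) :
    christoffel G' (τ y) (fderiv ℝ τ y v) (fderiv ℝ τ y w)
      = fderiv ℝ τ y (christoffel G y v w) - fderiv ℝ (fderiv ℝ τ) y v w := by
  have hsym : ∀ v w, fderiv ℝ (fderiv ℝ τ) y v w = fderiv ℝ (fderiv ℝ τ) y w v :=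
    fun v w => hτ.isSymmSndFDerivAt (by simp) v w
  refine eq_of_form_eq hi' fun z' => ?_
  obtain ⟨z, rfl⟩ := hsurj z'
  rw [map_sub, sub_apply, ← h.self_of_nhds, christoffel_spec hi, christoffel_spec hi',
    fderiv_pullback_metric hτ hG' hG h, fderiv_pullback_metric hτ hG' hG h,
    fderiv_pullback_metric hτ hG' hG h, hsym w v, hsym z v, hsym z w,
    hs.self_of_nhds (fderiv ℝ τ y w) (fderiv ℝ (fderiv ℝ τ) y v z)]
  ring

/-- The second derivatives of `τ` produced by differentiating `hAA` cancel those in the Christoffel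
law. This tensoriality carries conditions on `∇J` from chart centres to all points of a chart. -/
theorem localCovDeriv_transition (hτ : ContDiffAt ℝ 2 τ y) (hG' : DifferentiableAt ℝ G' (τ y))
    (hG : DifferentiableAt ℝ G y) (hA : DifferentiableAt ℝ A y) (hA' : DifferentiableAt ℝ A' (τ y))
    (hi : (G y).IsInvertible) (hi' : (G' (τ y)).IsInvertible)
    (hs : ∀ᶠ z in nhds (τ y), ∀ v w, G' z v w = G' z w v)
    (hsurj : Function.Surjective (fderiv ℝ τ y))
    (h : ∀ᶠ z in nhds y, ∀ v w, G z v w = G' (τ z) (fderiv ℝ τ z v) (fderiv ℝ τ z w))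
    (hAA : ∀ᶠ z in nhds y, ∀ v, A' (τ z) (fderiv ℝ τ z v) = fderiv ℝ τ z (A z v)) (v w : E) :
    localCovDeriv G' A' (τ y) (fderiv ℝ τ y v) (fderiv ℝ τ y w)
      = fderiv ℝ τ y (localCovDeriv G A y v w) := by
  have hΓ := christoffel_transition hτ hG' hG hi hi' hs hsurj h
  have h1 : (fun z => A' (τ z) (fderiv ℝ τ z w)) =ᶠ[nhds y] fun z => fderiv ℝ τ z (A z w) :=
    hAA.mono fun z h => h w
  have hτ1 := (hτ.differentiableAt (by simp)).hasFDerivAt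
  have hτ2 := ((hτ.fderiv_right (m := 1) (by norm_num)).differentiableAt (by simp)).hasFDerivAt
  have h2 := (((hA'.hasFDerivAt.comp y hτ1).clm_apply
    (hτ2.clm_apply (hasFDerivAt_const w y)))).fderiv
  have h3 := (hτ2.clm_apply (hA.hasFDerivAt.clm_apply (hasFDerivAt_const w y))).fderiv
  have h4 := h1.fderiv_eq (𝕜 := ℝ)
  simp only [Function.comp_def] at h2
  rw [h3, h2] at h4
  have h5 := DFunLike.congr_fun h4 v
  simp at h5
  rw [localCovDeriv, localCovDeriv, hAA.self_of_nhds, hΓ, hΓ, map_sub, hAA.self_of_nhds, map_sub,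
    map_add, ← sub_eq_zero]
  rw [← sub_eq_zero] at h5
  rw [← h5]
  abel

/-- The second derivative of `τ` is symmetric and drops out of the antisymmetrisation. -/
theorem extDeriv_transition {η η' : E → E →L[ℝ] ℝ} (hτ : ContDiffAt ℝ 2 τ y)
    (hη' : DifferentiableAt ℝ η' (τ y)) (hη : DifferentiableAt ℝ η y)
    (h : ∀ᶠ z in nhds y, ∀ v, η z v = η' (τ z) (fderiv ℝ τ z v)) (v w : E) :
    fderiv ℝ η y v w - fderiv ℝ η y w v
      = fderiv ℝ η' (τ y) (fderiv ℝ τ y v) (fderiv ℝ τ y w)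
        - fderiv ℝ η' (τ y) (fderiv ℝ τ y w) (fderiv ℝ τ y v) := by
  have hτ1 := (hτ.differentiableAt (by simp)).hasFDerivAt
  have hτ2 := ((hτ.fderiv_right (m := 1) (by norm_num)).differentiableAt (by simp)).hasFDerivAt
  have key : ∀ v w, fderiv ℝ η y v w = fderiv ℝ η' (τ y) (fderiv ℝ τ y v) (fderiv ℝ τ y w)
      + η' (τ y) (fderiv ℝ (fderiv ℝ τ) y v w) := by
    intro v w
    have h1 : (fun z => η z w) =ᶠ[nhds y] fun z => η' (τ z) (fderiv ℝ τ z w) :=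
      h.mono fun z h => h w
    have h2 := ((hη'.hasFDerivAt.comp y hτ1).clm_apply
      (hτ2.clm_apply (hasFDerivAt_const w y))).fderiv
    have h3 := (hη.hasFDerivAt.clm_apply (hasFDerivAt_const w y)).fderiv
    have h4 := h1.fderiv_eq (𝕜 := ℝ)
    simp only [Function.comp_def] at h2
    rw [h3, h2] at h4
    have h5 := DFunLike.congr_fun h4 v
    simp at h5
    rw [h5]
    ring
  rw [key, key, hτ.isSymmSndFDerivAt (by simp) v w]
  ring

end Transition

/-! ### Second fundamental form of a holomorphic map -/

section HolomorphicMaps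

variable {E F : Type*} [NormedAddCommGroup E] [NormedSpace ℝ E]
  [NormedAddCommGroup F] [NormedSpace ℝ F]
  {G : E → E →L[ℝ] E →L[ℝ] ℝ} {A : E → E →L[ℝ] E} {H : F → F →L[ℝ] F →L[ℝ] ℝ}
  {B : F → F →L[ℝ] F} {u : E → F} {y : E}

theorem fderiv_fderiv_apply (hu : ContDiffAt ℝ ∞ u y) (v w : E) :
    fderiv ℝ (fun z => fderiv ℝ u z w) y v = fderiv ℝ (fderiv ℝ u) y v w := by
  have hτ2 := ((hu.fderiv_right (m := 1) (by norm_cast)).differentiableAt (by simp)).hasFDerivAt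
  rw [(hτ2.clm_apply (hasFDerivAt_const w y)).fderiv]
  simp

theorem secondFundamentalForm_eq (hu : ContDiffAt ℝ ∞ u y) (v w : E) :
    secondFundamentalForm G H u y v w = fderiv ℝ (fderiv ℝ u) y v w
      + christoffelCLM H (u y) (fderiv ℝ u y v) (fderiv ℝ u y w)
      - fderiv ℝ u y (christoffelCLM G y v w) := by
  rw [secondFundamentalForm, pullbackDeriv, fderiv_fderiv_apply hu]
  simp only [christoffelCLM_apply]

/-- The second fundamental form as a bilinear map. -/
noncomputable def secondFundamentalFormCLM (G : E → E →L[ℝ] E →L[ℝ] ℝ)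
    (H : F → F →L[ℝ] F →L[ℝ] ℝ) (u : E → F) (y : E) : E →L[ℝ] E →L[ℝ] F :=
  fderiv ℝ (fderiv ℝ u) y
    + (christoffelCLM H (u y)).bilinearComp (fderiv ℝ u y) (fderiv ℝ u y)
    - (ContinuousLinearMap.compL ℝ E E F (fderiv ℝ u y)).comp (christoffelCLM G y)

theorem secondFundamentalFormCLM_apply (hu : ContDiffAt ℝ ∞ u y) (v w : E) :
    secondFundamentalForm G H u y v w = secondFundamentalFormCLM G H u y v w := by
  rw [secondFundamentalForm_eq hu, secondFundamentalFormCLM]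
  simp

theorem secondFundamentalForm_symm (hu : ContDiffAt ℝ ∞ u y) (hG : AlmostHermitianAt G A y)
    (hH : AlmostHermitianAt H B (u y)) (v w : E) :
    secondFundamentalForm G H u y v w = secondFundamentalForm G H u y w v := by
  rw [secondFundamentalForm_eq hu, secondFundamentalForm_eq hu]
  simp only [christoffelCLM_apply]
  rw [hG.christoffel_symm v w, hH.christoffel_symm, hu.isSymmSndFDerivAt (by simp; norm_cast)]

/-- The derivative of the condition that `u` is holomorphic. -/
theorem secondFundamentalForm_end (hu : ContDiffAt ℝ ∞ u y) (hG : AlmostHermitianAt G A y)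
    (hH : AlmostHermitianAt H B (u y))
    (hhol : ∀ᶠ z in nhds y, ∀ v, fderiv ℝ u z (A z v) = B (u z) (fderiv ℝ u z v)) (v w : E) :
    secondFundamentalForm G H u y v (A y w) + fderiv ℝ u y (localCovDeriv G A y v w)
      = localCovDeriv H B (u y) (fderiv ℝ u y v) (fderiv ℝ u y w)
        + B (u y) (secondFundamentalForm G H u y v w) := by
  have h1 : (fun z => fderiv ℝ u z (A z w)) =ᶠ[nhds y] fun z => B (u z) (fderiv ℝ u z w) :=
    hhol.mono fun z h => h w
  have hu1 := (hu.differentiableAt (by simp)).hasFDerivAt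
  have hu2 := ((hu.fderiv_right (m := 1) (by norm_cast)).differentiableAt (by simp)).hasFDerivAt
  have h2 := (((hH.differentiable_end.hasFDerivAt.comp y hu1).clm_apply
    (hu2.clm_apply (hasFDerivAt_const w y)))).fderiv
  have h3 := (hu2.clm_apply
    (hG.differentiable_end.hasFDerivAt.clm_apply (hasFDerivAt_const w y))).fderiv
  have h4 := h1.fderiv_eq (𝕜 := ℝ)
  simp only [Function.comp_def] at h2
  rw [h3, h2] at h4
  have h5 := DFunLike.congr_fun h4 v
  simp at h5
  rw [secondFundamentalForm_eq hu, secondFundamentalForm_eq hu, localCovDeriv, localCovDeriv]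
  simp only [christoffelCLM_apply, map_add, map_sub]
  rw [← hhol.self_of_nhds, ← hhol.self_of_nhds, ← sub_eq_zero]
  rw [← sub_eq_zero] at h5
  rw [← h5]
  abel

/-- The second fundamental form of a holomorphic map from a Kähler to a (1,2)-symplectic manifold
has no `J`-invariant part. -/
theorem secondFundamentalForm_anti_invariant (hu : ContDiffAt ℝ ∞ u y)
    (hG : AlmostHermitianAt G A y) (hK : ∀ v w, localCovDeriv G A y v w = 0)
    (hH : AlmostHermitianAt H B (u y))
    (hS : ∀ v w, localCovDeriv H B (u y) v w
      + localCovDeriv H B (u y) (B (u y) v) (B (u y) w) = 0)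
    (hhol : ∀ᶠ z in nhds y, ∀ v, fderiv ℝ u z (A z v) = B (u z) (fderiv ℝ u z v)) (v w : E) :
    secondFundamentalForm G H u y (A y v) (A y w) = -secondFundamentalForm G H u y v w := by
  have hend : ∀ v w, secondFundamentalForm G H u y v (A y w)
      = localCovDeriv H B (u y) (fderiv ℝ u y v) (fderiv ℝ u y w)
        + B (u y) (secondFundamentalForm G H u y v w) := fun v w => by
    have := secondFundamentalForm_end hu hG hH hhol v w
    rwa [hK, map_zero, add_zero] at this
  -- With `T = ∇J` on the target and `T` anticommuting with `J` in its last slot, the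
  -- (1,2)-symplectic condition becomes `J T(b, a) = -T(Jb, a)`.
  have hT : ∀ a b, B (u y) (localCovDeriv H B (u y) b a)
      = localCovDeriv H B (u y) (B (u y) b) (-a) := fun a b => by
    have h1 := hS b a
    have h2 := hH.localCovDeriv_anticomm (B (u y) b) a
    rw [h2] at h1
    have h3 := congrArg (B (u y)) h1
    rw [map_add, map_neg, hH.sq.self_of_nhds, neg_neg, map_zero] at h3
    have h4 : localCovDeriv H B (u y) (B (u y) b) (-a)
        = -localCovDeriv H B (u y) (B (u y) b) a := by
      simp only [localCovDeriv, ← christoffelCLM_apply, map_neg]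
      abel
    rw [h4]
    exact eq_neg_of_add_eq_zero_left h3
  have hneg : ∀ a b, localCovDeriv H B (u y) b (-a) = -localCovDeriv H B (u y) b a := fun a b => by
    simp only [localCovDeriv, ← christoffelCLM_apply, map_neg]
    abel
  -- Apply `hend`, symmetry and `hend` again; the two terms in `∇J` of the target cancel by `hT`.
  have hdiag : ∀ v, secondFundamentalForm G H u y (A y v) (A y v)
      = -secondFundamentalForm G H u y v v := fun v => by
    rw [hend, secondFundamentalForm_symm hu hG hH (A y v) v, hend, map_add, hH.sq.self_of_nhds, hT,
      hhol.self_of_nhds, hneg]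
    abel
  -- Polarisation, legitimate because the second fundamental form is symmetric.
  have hpol := hdiag (v + w)
  simp only [secondFundamentalFormCLM_apply hu, map_add, add_apply] at hpol
  simp only [← secondFundamentalFormCLM_apply hu] at hpol
  rw [hdiag v, hdiag w, secondFundamentalForm_symm hu hG hH (A y w) (A y v),
    secondFundamentalForm_symm hu hG hH w v] at hpol
  have h2 : (2 : ℝ) • (secondFundamentalForm G H u y (A y v) (A y w)
      + secondFundamentalForm G H u y v w) = 0 := by
    rw [two_smul, ← sub_eq_zero.mpr hpol]
    abel
  exact eq_neg_of_add_eq_zero_left ((smul_eq_zero.mp h2).resolve_left two_ne_zero)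

/-- Lichnerowicz's theorem: an anti-invariant form has no trace, so such a map is harmonic. -/
theorem metricTrace_secondFundamentalForm_eq_zero [FiniteDimensional ℝ E]
    (hu : ContDiffAt ℝ ∞ u y)
    (hG : AlmostHermitianAt G A y) (hK : ∀ v w, localCovDeriv G A y v w = 0)
    (hH : AlmostHermitianAt H B (u y))
    (hS : ∀ v w, localCovDeriv H B (u y) v w
      + localCovDeriv H B (u y) (B (u y) v) (B (u y) w) = 0)
    (hhol : ∀ᶠ z in nhds y, ∀ v, fderiv ℝ u z (A z v) = B (u z) (fderiv ℝ u z v)) :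
    metricTrace (G y) (secondFundamentalForm G H u y) = 0 := by
  have h := metricTrace_eq_zero_of_anti_invariant hG.invertible hG.sq.self_of_nhds
    hG.isometry.self_of_nhds (secondFundamentalFormCLM G H u y).toLinearMap₁₂ (fun v w => by
      have := secondFundamentalForm_anti_invariant hu hG hK hH hS hhol v w
      rwa [secondFundamentalFormCLM_apply hu, secondFundamentalFormCLM_apply hu] at this)
  rw [← h]
  congr 1
  ext v w
  exact secondFundamentalFormCLM_apply hu v w

end HolomorphicMaps

/-! ### The Jacobi operator and variations by linear flows -/

section Jacobi

variable {E F : Type*} [NormedAddCommGroup E] [NormedSpace ℝ E]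
  [NormedAddCommGroup F] [NormedSpace ℝ F]
  {G : E → E →L[ℝ] E →L[ℝ] ℝ} {A : E → E →L[ℝ] E} {H : F → F →L[ℝ] F →L[ℝ] ℝ}
  {B : F → F →L[ℝ] F} {u V : E → F} {y : E}

theorem pullbackDeriv_eq (v z : _) :
    pullbackDeriv H u V v z
      = fderiv ℝ V z v + christoffelCLM H (u z) (fderiv ℝ u z v) (V z) := by
  rw [pullbackDeriv, christoffelCLM_apply]

theorem pullbackDeriv_pullbackDeriv (hu : ContDiffAt ℝ ∞ u y) (hV : ContDiffAt ℝ ∞ V y)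
    (hH : DifferentiableAt ℝ (christoffelCLM H) (u y)) (v w : E) :
    pullbackDeriv H u (pullbackDeriv H u V w) v y
      = fderiv ℝ (fderiv ℝ V) y v w
        + fderiv ℝ (christoffelCLM H) (u y) (fderiv ℝ u y v) (fderiv ℝ u y w) (V y)
        + christoffelCLM H (u y) (fderiv ℝ (fderiv ℝ u) y v w) (V y)
        + christoffelCLM H (u y) (fderiv ℝ u y w) (fderiv ℝ V y v)
        + christoffelCLM H (u y) (fderiv ℝ u y v)
          (fderiv ℝ V y w + christoffelCLM H (u y) (fderiv ℝ u y w) (V y)) := by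
  have hu1 := (hu.differentiableAt (by simp)).hasFDerivAt
  have hu2 := ((hu.fderiv_right (m := 1) (by norm_cast)).differentiableAt (by simp)).hasFDerivAt
  have hV1 := (hV.differentiableAt (by simp)).hasFDerivAt
  have hV2 := ((hV.fderiv_right (m := 1) (by norm_cast)).differentiableAt (by simp)).hasFDerivAt
  rw [pullbackDeriv_eq, pullbackDeriv_eq]
  have h1 : pullbackDeriv H u V w = fun z =>
      fderiv ℝ V z w + christoffelCLM H (u z) (fderiv ℝ u z w) (V z) :=
    funext fun z => pullbackDeriv_eq w z
  have h2 := ((hV2.clm_apply (hasFDerivAt_const w y)).add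
    (((hH.hasFDerivAt.comp y hu1).clm_apply (hu2.clm_apply (hasFDerivAt_const w y))).clm_apply
      hV1)).fderiv
  simp only [Function.comp_def, Pi.add_def] at h2
  rw [h1, h2]
  simp
  abel

theorem curvature_eq {q : F} (hH : DifferentiableAt ℝ (christoffelCLM H) q) (v w z : F) :
    curvature H q v w z = fderiv ℝ (christoffelCLM H) q v w z - fderiv ℝ (christoffelCLM H) q w v z
      + christoffelCLM H q v (christoffelCLM H q w z)
      - christoffelCLM H q w (christoffelCLM H q v z) := by
  have key : ∀ v w, fderiv ℝ (fun q' => christoffel H q' w z) q v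
      = fderiv ℝ (christoffelCLM H) q v w z := by
    intro v w
    have h := ((hH.hasFDerivAt.clm_apply (hasFDerivAt_const w q)).clm_apply
      (hasFDerivAt_const z q)).fderiv
    simp only [christoffelCLM_apply] at h
    rw [h]
    simp
  rw [curvature, key, key]
  simp only [christoffelCLM_apply]

/-- The summand of the Jacobi operator of `u`, applied to the section `V`. -/
noncomputable def jacobiForm (G : E → E →L[ℝ] E →L[ℝ] ℝ)
    (H : F → F →L[ℝ] F →L[ℝ] ℝ) (u V : E → F) (y v w : E) : F :=
  pullbackDeriv H u (pullbackDeriv H u V w) v y - pullbackDeriv H u V (christoffel G y v w) y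
    + curvature H (u y) (V y) (fderiv ℝ u y v) (fderiv ℝ u y w)

/-- All terms but the last are the linearisation, in the direction `V`, of the coordinate formula
`D²u + Γ(du, du) - du Γ` for the second fundamental form; the last makes that derivative covariant.
In this form the expression can be compared with `hasDerivAt_secondFundamentalForm`. -/
theorem jacobiForm_eq (hu : ContDiffAt ℝ ∞ u y) (hV : ContDiffAt ℝ ∞ V y)
    (hH : DifferentiableAt ℝ (christoffelCLM H) (u y))
    (hs : ∀ᶠ q in nhds (u y), ∀ v w, christoffelCLM H q v w = christoffelCLM H q w v) (v w : E) :
    jacobiForm G H u V y v w = fderiv ℝ (fderiv ℝ V) y v w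
        + fderiv ℝ (christoffelCLM H) (u y) (V y) (fderiv ℝ u y v) (fderiv ℝ u y w)
        + christoffelCLM H (u y) (fderiv ℝ V y v) (fderiv ℝ u y w)
        + christoffelCLM H (u y) (fderiv ℝ u y v) (fderiv ℝ V y w)
        - fderiv ℝ V y (christoffelCLM G y v w)
        + christoffelCLM H (u y) (V y) (secondFundamentalFormCLM G H u y v w) := by
  have hsd : ∀ a b c, fderiv ℝ (christoffelCLM H) (u y) a b c
      = fderiv ℝ (christoffelCLM H) (u y) a c b := by
    have key : ∀ a b c, fderiv ℝ (fun q => christoffelCLM H q b c) (u y) a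
        = fderiv ℝ (christoffelCLM H) (u y) a b c := by
      intro a b c
      rw [((hH.hasFDerivAt.clm_apply (hasFDerivAt_const b _)).clm_apply
        (hasFDerivAt_const c _)).fderiv]
      simp
    intro a b c
    rw [← key, ← key]
    have : (fun q => christoffelCLM H q b c) =ᶠ[nhds (u y)] fun q => christoffelCLM H q c b :=
      hs.mono fun q h => h b c
    rw [this.fderiv_eq]
  have hs0 := hs.self_of_nhds
  rw [jacobiForm, pullbackDeriv_pullbackDeriv hu hV hH, curvature_eq hH, pullbackDeriv_eq,
    ← christoffelCLM_apply G, secondFundamentalFormCLM]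
  simp only [add_apply, sub_apply, ContinuousLinearMap.bilinearComp_apply, map_add, map_sub,
    ContinuousLinearMap.comp_apply, ContinuousLinearMap.compL_apply]
  rw [hsd _ (fderiv ℝ u y w) (V y), hs0 (fderiv ℝ (fderiv ℝ u) y v w) (V y),
    hs0 (fderiv ℝ V y v) (fderiv ℝ u y w), hs0 (fderiv ℝ u y w) (V y),
    hs0 (fderiv ℝ u y (christoffelCLM G y v w)) (V y)]
  abel

/-- The Jacobi summand as a bilinear map. -/
theorem exists_jacobiForm_linear (hu : ContDiffAt ℝ ∞ u y) (hV : ContDiffAt ℝ ∞ V y)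
    (hH : DifferentiableAt ℝ (christoffelCLM H) (u y))
    (hs : ∀ᶠ q in nhds (u y), ∀ v w, christoffelCLM H q v w = christoffelCLM H q w v) :
    ∃ T : E →ₗ[ℝ] E →ₗ[ℝ] F, ∀ v w, jacobiForm G H u V y v w = T v w := by
  refine ⟨LinearMap.mk₂ ℝ (jacobiForm G H u V y) ?_ ?_ ?_ ?_, fun v w => rfl⟩
  all_goals
    intros
    simp only [jacobiForm_eq hu hV hH hs, map_add, add_apply, map_smul, smul_apply, smul_add,
      smul_sub]
    try abel

theorem pullbackDeriv_smul {f : E → ℝ} (hf : DifferentiableAt ℝ f y)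
    (hV : DifferentiableAt ℝ V y) (v : E) :
    pullbackDeriv H u (fun x => f x • V x) v y
      = fderiv ℝ f y v • V y + f y • pullbackDeriv H u V v y := by
  rw [pullbackDeriv_eq, pullbackDeriv_eq, fderiv_fun_smul hf hV]
  simp only [add_apply, smul_apply, ContinuousLinearMap.smulRight_apply, map_smul]
  module

theorem pullbackDeriv_add {V' : E → F} (hV : DifferentiableAt ℝ V y)
    (hV' : DifferentiableAt ℝ V' y) (v : E) :
    pullbackDeriv H u (fun x => V x + V' x) v y
      = pullbackDeriv H u V v y + pullbackDeriv H u V' v y := by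
  rw [pullbackDeriv_eq, pullbackDeriv_eq, pullbackDeriv_eq, fderiv_fun_add hV hV']
  simp only [add_apply, map_add]
  abel

theorem pullbackDeriv_congr {V' : E → F} (h : V =ᶠ[nhds y] V') (v : E) :
    pullbackDeriv H u V v =ᶠ[nhds y] pullbackDeriv H u V' v := by
  filter_upwards [h.eventuallyEq_nhds] with x hx
  rw [pullbackDeriv_eq, pullbackDeriv_eq, hx.fderiv_eq, hx.self_of_nhds]

theorem curvature_smul_left {q : F} (c : ℝ) (hH : DifferentiableAt ℝ (christoffelCLM H) q)
    (v w x : F) : curvature H q (c • v) w x = c • curvature H q v w x := by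
  simp only [curvature_eq hH, map_smul, smul_apply]
  module

variable (P : E →L[ℝ] E)

theorem contDiffAt_fderiv_linear (hu : ContDiffAt ℝ ∞ u y) :
    ContDiffAt ℝ ∞ (fun z => fderiv ℝ u z (P z)) y :=
  (hu.fderiv_right (m := ∞) (by simp)).clm_apply P.contDiff.contDiffAt

theorem fderiv_fderiv_linear (hu : ContDiffAt ℝ ∞ u y) (w : E) :
    fderiv ℝ (fun z => fderiv ℝ u z (P z)) y w
      = fderiv ℝ (fderiv ℝ u) y w (P y) + fderiv ℝ u y (P w) := by
  have hu2 := ((hu.fderiv_right (m := 1) (by norm_cast)).differentiableAt (by simp)).hasFDerivAt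
  rw [(hu2.clm_apply P.hasFDerivAt).fderiv]
  simp
  abel

theorem fderiv_fderiv_symm (hu : ContDiffAt ℝ ∞ u y) (v w : E) :
    fderiv ℝ (fderiv ℝ u) y v w = fderiv ℝ (fderiv ℝ u) y w v :=
  hu.isSymmSndFDerivAt (by simp; norm_cast) v w

theorem fderiv3_perm (hu : ∀ᶠ z in nhds y, ContDiffAt ℝ ∞ u z) (a b c : E) :
    fderiv ℝ (fderiv ℝ (fderiv ℝ u)) y a b c = fderiv ℝ (fderiv ℝ (fderiv ℝ u)) y b c a := by
  have hu0 := hu.self_of_nhds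
  have h1 : ContDiffAt ℝ ∞ (fderiv ℝ u) y := hu0.fderiv_right (m := ∞) (by simp)
  have hu3 := ((h1.fderiv_right (m := 1) (by norm_cast)).differentiableAt (by simp)).hasFDerivAt
  have key : ∀ a b c, fderiv ℝ (fun z => fderiv ℝ (fderiv ℝ u) z b c) y a
      = fderiv ℝ (fderiv ℝ (fderiv ℝ u)) y a b c := by
    intro a b c
    rw [((hu3.clm_apply (hasFDerivAt_const b y)).clm_apply (hasFDerivAt_const c y)).fderiv]
    simp
  rw [fderiv_fderiv_symm h1 a b, ← key, ← key]
  have : (fun z => fderiv ℝ (fderiv ℝ u) z a c) =ᶠ[nhds y] fun z => fderiv ℝ (fderiv ℝ u) z c a :=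
    hu.mono fun z h => fderiv_fderiv_symm h a c
  rw [this.fderiv_eq]

theorem fderiv2_fderiv_linear (hu : ∀ᶠ z in nhds y, ContDiffAt ℝ ∞ u z) (v w : E) :
    fderiv ℝ (fderiv ℝ (fun z => fderiv ℝ u z (P z))) y v w
      = fderiv ℝ (fderiv ℝ (fderiv ℝ u)) y (P y) v w + fderiv ℝ (fderiv ℝ u) y (P v) w
        + fderiv ℝ (fderiv ℝ u) y v (P w) := by
  have hu0 := hu.self_of_nhds
  have h1 : ContDiffAt ℝ ∞ (fderiv ℝ u) y := hu0.fderiv_right (m := ∞) (by simp)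
  have hu2 := (h1.differentiableAt (by simp)).hasFDerivAt
  have hu3 := ((h1.fderiv_right (m := 1) (by norm_cast)).differentiableAt (by simp)).hasFDerivAt
  rw [← fderiv_fderiv_apply (contDiffAt_fderiv_linear P hu0)]
  have h2 : (fun z => fderiv ℝ (fun z => fderiv ℝ u z (P z)) z w) =ᶠ[nhds y] fun z =>
      fderiv ℝ (fderiv ℝ u) z w (P z) + fderiv ℝ u z (P w) :=
    hu.mono fun z h => fderiv_fderiv_linear P h w
  have h3 := (((hu3.clm_apply (hasFDerivAt_const w y)).clm_apply P.hasFDerivAt).add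
    (hu2.clm_apply (hasFDerivAt_const (P w) y))).fderiv
  simp only [Pi.add_def] at h3
  rw [h2.fderiv_eq, h3]
  simp
  rw [fderiv3_perm hu (P y) v w, fderiv_fderiv_symm hu0 w (P v)]
  abel

/-- By `hΓ` the map `id + tP` respects the connection at `y`, so the curve is the second fundamental
form at `y` of `u ∘ (id + tP)`. Its derivative is therefore the linearisation in the direction `V =
du(P)`. -/
theorem hasDerivAt_secondFundamentalForm (hu : ∀ᶠ z in nhds y, ContDiffAt ℝ ∞ u z)
    (hH : DifferentiableAt ℝ (christoffelCLM H) (u y))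
    (hΓ : ∀ᶠ t in nhds (0 : ℝ), ∀ v w, christoffelCLM G (y + t • P y) (v + t • P v) (w + t • P w)
      = christoffelCLM G y v w + t • P (christoffelCLM G y v w)) (v w : E) :
    HasDerivAt (fun t : ℝ => secondFundamentalForm G H u (y + t • P y) (v + t • P v) (w + t • P w))
      (fderiv ℝ (fderiv ℝ (fun z => fderiv ℝ u z (P z))) y v w
        + fderiv ℝ (christoffelCLM H) (u y) (fderiv ℝ u y (P y)) (fderiv ℝ u y v) (fderiv ℝ u y w)
        + christoffelCLM H (u y) (fderiv ℝ (fun z => fderiv ℝ u z (P z)) y v) (fderiv ℝ u y w)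
        + christoffelCLM H (u y) (fderiv ℝ u y v) (fderiv ℝ (fun z => fderiv ℝ u z (P z)) y w)
        - fderiv ℝ (fun z => fderiv ℝ u z (P z)) y (christoffelCLM G y v w)) 0 := by
  have hu0 := hu.self_of_nhds
  have h1 : ContDiffAt ℝ ∞ (fderiv ℝ u) y := hu0.fderiv_right (m := ∞) (by simp)
  have hline : ∀ a b : E, HasDerivAt (fun t : ℝ => a + t • b) b 0 := fun a b => by
    simpa using ((hasDerivAt_id (0 : ℝ)).smul_const b).const_add a
  have hy : y + (0 : ℝ) • P y = y := by simp
  have hu1 : HasFDerivAt u (fderiv ℝ u y) (y + (0 : ℝ) • P y) := by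
    rw [hy]; exact (hu0.differentiableAt (by simp)).hasFDerivAt
  have hu2 : HasFDerivAt (fderiv ℝ u) (fderiv ℝ (fderiv ℝ u) y) (y + (0 : ℝ) • P y) := by
    rw [hy]; exact (h1.differentiableAt (by simp)).hasFDerivAt
  have hu3 : HasFDerivAt (fderiv ℝ (fderiv ℝ u)) (fderiv ℝ (fderiv ℝ (fderiv ℝ u)) y)
      (y + (0 : ℝ) • P y) := by
    rw [hy]
    exact ((h1.fderiv_right (m := 1) (by norm_cast)).differentiableAt (by simp)).hasFDerivAt
  have hg : HasFDerivAt (christoffelCLM H) (fderiv ℝ (christoffelCLM H) (u y))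
      (u (y + (0 : ℝ) • P y)) := by
    rw [hy]; exact hH.hasFDerivAt
  have d1 := hu1.comp_hasDerivAt (0 : ℝ) (hline y (P y))
  have d2 := hu2.comp_hasDerivAt (0 : ℝ) (hline y (P y))
  have d3 := hu3.comp_hasDerivAt (0 : ℝ) (hline y (P y))
  have dg := hg.comp_hasDerivAt (0 : ℝ) d1
  have hcont : Filter.Tendsto (fun t : ℝ => y + t • P y) (nhds 0) (nhds y) := by
    have := (hline y (P y)).continuousAt.tendsto
    rwa [hy] at this
  have key := ((d3.clm_apply (hline v (P v))).clm_apply (hline w (P w))).add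
    ((dg.clm_apply (d2.clm_apply (hline v (P v)))).clm_apply (d2.clm_apply (hline w (P w))))
  have key2 := key.sub (d2.clm_apply
    (hline (christoffelCLM G y v w) (P (christoffelCLM G y v w))))
  refine (key2.congr_of_eventuallyEq ?_).congr_deriv ?_
  · filter_upwards [hΓ, hcont.eventually hu] with t ht hut
    rw [secondFundamentalForm_eq hut, ht]
    rfl
  · simp only [Function.comp_apply, zero_smul, add_zero]
    rw [fderiv2_fderiv_linear P hu, fderiv_fderiv_linear P hu0, fderiv_fderiv_linear P hu0,
      fderiv_fderiv_linear P hu0, fderiv_fderiv_symm hu0 v (P y), fderiv_fderiv_symm hu0 w (P y),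
      fderiv_fderiv_symm hu0 _ (P y)]
    simp only [add_apply, map_add]
    abel

/-- A linear vector field `z ↦ P z` whose flow is affine and holomorphic yields a Jacobi
field along a holomorphic map. -/
theorem metricTrace_jacobiForm_eq_zero [FiniteDimensional ℝ E] [CompleteSpace F]
    (hu : ∀ᶠ z in nhds y, ContDiffAt ℝ ∞ u z)
    (hG : ∀ᶠ z in nhds y, AlmostHermitianAt G A z ∧ ∀ v w, localCovDeriv G A z v w = 0)
    (hH : ∀ᶠ q in nhds (u y), AlmostHermitianAt H B q ∧ ∀ v w, localCovDeriv H B q v w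
      + localCovDeriv H B q (B q v) (B q w) = 0)
    (hhol : ∀ᶠ z in nhds y, ∀ v, fderiv ℝ u z (A z v) = B (u z) (fderiv ℝ u z v))
    (hΓ : ∀ᶠ t in nhds (0 : ℝ), ∀ v w, christoffelCLM G (y + t • P y) (v + t • P v) (w + t • P w)
      = christoffelCLM G y v w + t • P (christoffelCLM G y v w))
    (hP : ∀ᶠ t in nhds (0 : ℝ), ∀ v, A (y + t • P y) (v + t • P v) = A y v + t • P (A y v)) :
    metricTrace (G y) (jacobiForm G H u (fun z => fderiv ℝ u z (P z)) y) = 0 := by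
  have hu0 := hu.self_of_nhds
  have hG0 := hG.self_of_nhds
  have hHd : DifferentiableAt ℝ (christoffelCLM H) (u y) :=
    (contDiffAt_christoffelCLM hH.self_of_nhds.1.contDiff_metric
      hH.self_of_nhds.1.invertible).differentiableAt (by simp)
  have hs : ∀ᶠ q in nhds (u y), ∀ v w, christoffelCLM H q v w = christoffelCLM H q w v := by
    filter_upwards [hH] with q hq v w
    rw [christoffelCLM_apply, christoffelCLM_apply, hq.1.christoffel_symm]
  have hV := contDiffAt_fderiv_linear P hu0
  obtain ⟨T, hT⟩ := exists_jacobiForm_linear (G := G) hu0 hV hHd hs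
  -- Anti-invariance is needed on a neighbourhood, since it is differentiated along `y + tPy`.
  have hanti : ∀ᶠ z in nhds y, ∀ v w, secondFundamentalForm G H u z (A z v) (A z w)
      = -secondFundamentalForm G H u z v w := by
    filter_upwards [hu, hG, hu0.continuousAt.eventually hH, hhol.eventually_nhds]
      with z h1 h2 h3 h4 v w
    exact secondFundamentalForm_anti_invariant h1 h2.1 h2.2 h3.1 h3.2 h4 v w
  have hcont : Filter.Tendsto (fun t : ℝ => y + t • P y) (nhds 0) (nhds y) := by
    have : Continuous fun t : ℝ => y + t • P y := by fun_prop
    simpa using this.tendsto 0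
  have hfun : jacobiForm G H u (fun z => fderiv ℝ u z (P z)) y = fun v w => T v w := by
    ext v w; exact hT v w
  rw [hfun]
  refine metricTrace_eq_zero_of_anti_invariant hG0.1.invertible hG0.1.sq.self_of_nhds
    hG0.1.isometry.self_of_nhds T fun v w => ?_
  have hd1 := hasDerivAt_secondFundamentalForm (G := G) P hu hHd hΓ (A y v) (A y w)
  have hd2 := (hasDerivAt_secondFundamentalForm (G := G) P hu hHd hΓ v w).neg
  -- By `hP` the vectors on the left are `A` at `y + tPy` applied to `v + tPv` and `w + tPw`, so
  -- this is anti-invariance at that point.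
  have heq : (fun t : ℝ => secondFundamentalForm G H u (y + t • P y) (A y v + t • P (A y v))
      (A y w + t • P (A y w))) =ᶠ[nhds 0] -fun t : ℝ =>
        secondFundamentalForm G H u (y + t • P y) (v + t • P v) (w + t • P w) := by
    filter_upwards [hP, hcont.eventually hanti] with t ht hat
    rw [← ht, ← ht, hat]
    rfl
  have hder := hd1.unique (hd2.congr_of_eventuallyEq heq)
  -- The linearised part is anti-invariant by `hder`; the remaining term is linear in the second
  -- fundamental form, hence anti-invariant as well.
  rw [← hT, ← hT, jacobiForm_eq hu0 hV hHd hs, jacobiForm_eq hu0 hV hHd hs, hder,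
    ← secondFundamentalFormCLM_apply hu0, ← secondFundamentalFormCLM_apply hu0,
    hanti.self_of_nhds, map_neg]
  abel

end Jacobi

/-! ### Contact metric structures and their cones in coordinates -/

section LocalCone

variable {E : Type*} [NormedAddCommGroup E] [NormedSpace ℝ E]

/-- The coordinate expression of a contact metric structure near a point of a coordinate patch. -/
structure ContactMetricAt (G : E → E →L[ℝ] E →L[ℝ] ℝ) (φ : E → E →L[ℝ] E) (ξ : E → E)
    (η : E → E →L[ℝ] ℝ) (s : E) : Prop where
  smooth_metric : ContDiffAt ℝ ∞ G s
  smooth_φ : ContDiffAt ℝ ∞ φ s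
  smooth_ξ : ContDiffAt ℝ ∞ ξ s
  smooth_η : ContDiffAt ℝ ∞ η s
  symm : ∀ᶠ t in nhds s, ∀ v w, G t v w = G t w v
  pos : ∀ᶠ t in nhds s, ∀ v, v ≠ 0 → 0 < G t v v
  η_ξ : ∀ᶠ t in nhds s, η t (ξ t) = 1
  φ_φ : ∀ᶠ t in nhds s, ∀ v, φ t (φ t v) = -v + η t v • ξ t
  compatible : ∀ᶠ t in nhds s, ∀ v w, G t (φ t v) (φ t w) = G t v w - η t v * η t w
  contact : ∀ᶠ t in nhds s, ∀ v w, fderiv ℝ η t v w - fderiv ℝ η t w v = 2 * G t v (φ t w)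

/-- The coordinate expression of a normal contact metric structure near a point of a coordinate
patch. -/
structure SasakianAt (G : E → E →L[ℝ] E →L[ℝ] ℝ) (φ : E → E →L[ℝ] E) (ξ : E → E)
    (η : E → E →L[ℝ] ℝ) (s : E) : Prop extends ContactMetricAt G φ ξ η s where
  normal : ∀ v w, fderiv ℝ φ s (φ s v) w - fderiv ℝ φ s (φ s w) v
    + φ s (fderiv ℝ φ s w v) - φ s (fderiv ℝ φ s v w)
    + (fderiv ℝ η s v w - fderiv ℝ η s w v) • ξ s = 0

/-- From `φ²ξ = 0`, the formula for `φ²(φξ)` gives `φξ = η(φξ) ξ`; applying `φ` once more gives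
`η(φξ)² = 0`. -/
theorem phi_xi {φ : E →L[ℝ] E} {ξ : E} {η : E →L[ℝ] ℝ} (h1 : η ξ = 1)
    (h2 : ∀ v, φ (φ v) = -v + η v • ξ) : φ ξ = 0 := by
  have h3 : φ (φ ξ) = 0 := by rw [h2, h1]; simp
  have h4 := h2 (φ ξ)
  rw [h3, map_zero] at h4
  have h5 : φ ξ = η (φ ξ) • ξ := by
    rw [← sub_eq_zero, ← neg_sub, ← sub_eq_zero.mpr h4]; abel
  have h6 := h3
  rw [h5, map_smul, h5, smul_smul] at h6
  have h7 := congrArg η h6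
  simp only [map_smul, h1, map_zero, smul_eq_mul, mul_one, mul_self_eq_zero] at h7
  rw [h5, h7, zero_smul]

/-- Compute `φ³v` in two ways. -/
theorem eta_phi {φ : E →L[ℝ] E} {ξ : E} {η : E →L[ℝ] ℝ} (h1 : η ξ = 1)
    (h2 : ∀ v, φ (φ v) = -v + η v • ξ) (v : E) : η (φ v) = 0 := by
  have h3 := h2 (φ v)
  rw [h2 v] at h3
  simp only [map_add, map_neg, map_smul, phi_xi h1 h2, smul_zero, add_zero] at h3
  have h4 := congrArg η (left_eq_add.mp h3)
  simpa [h1] using h4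

/-- The cone metric in coordinates. -/
noncomputable def coneForm (G : E → E →L[ℝ] E →L[ℝ] ℝ) (z : ℝ × E) :
    (ℝ × E) →L[ℝ] (ℝ × E) →L[ℝ] ℝ :=
  (ContinuousLinearMap.fst ℝ ℝ E).smulRight (ContinuousLinearMap.fst ℝ ℝ E)
    + z.1 ^ 2 • (G z.2).bilinearComp (ContinuousLinearMap.snd ℝ ℝ E) (ContinuousLinearMap.snd ℝ ℝ E)

theorem coneForm_apply (G : E → E →L[ℝ] E →L[ℝ] ℝ) (z v w : ℝ × E) :
    coneForm G z v w = v.1 * w.1 + z.1 ^ 2 * G z.2 v.2 w.2 := by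
  simp [coneForm]

/-- The complex structure of the cone in coordinates. -/
noncomputable def coneEnd (φ : E → E →L[ℝ] E) (ξ : E → E) (η : E → E →L[ℝ] ℝ) (z : ℝ × E) :
    (ℝ × E) →L[ℝ] (ℝ × E) :=
  (ContinuousLinearMap.inl ℝ ℝ E).comp (z.1 • (η z.2).comp (ContinuousLinearMap.snd ℝ ℝ E))
    + (ContinuousLinearMap.inr ℝ ℝ E).comp ((φ z.2).comp (ContinuousLinearMap.snd ℝ ℝ E)
      - z.1⁻¹ • (ContinuousLinearMap.fst ℝ ℝ E).smulRight (ξ z.2))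

theorem coneEnd_apply (φ : E → E →L[ℝ] E) (ξ : E → E) (η : E → E →L[ℝ] ℝ) (z v : ℝ × E) :
    coneEnd φ ξ η z v = (z.1 * η z.2 v.2, φ z.2 v.2 - (z.1⁻¹ * v.1) • ξ z.2) := by
  simp [coneEnd, smul_smul]

variable {G : E → E →L[ℝ] E →L[ℝ] ℝ} {φ : E → E →L[ℝ] E} {ξ : E → E} {η : E → E →L[ℝ] ℝ}
  {z : ℝ × E}

theorem contDiffAt_coneForm (hG : ContDiffAt ℝ ∞ G z.2) : ContDiffAt ℝ ∞ (coneForm G) z := by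
  have h1 : ContDiffAt ℝ ∞ (fun x : ℝ × E => G x.2) z := hG.comp z contDiffAt_snd
  have h2 : ∀ B : E →L[ℝ] E →L[ℝ] ℝ, B.bilinearComp (ContinuousLinearMap.snd ℝ ℝ E)
      (ContinuousLinearMap.snd ℝ ℝ E) = ((ContinuousLinearMap.compL ℝ (ℝ × E) E ℝ).flip
        (ContinuousLinearMap.snd ℝ ℝ E)).comp (B.comp (ContinuousLinearMap.snd ℝ ℝ E)) := by
    intro B; ext <;> simp
  unfold coneForm
  simp only [h2]
  exact contDiffAt_const.add ((contDiffAt_fst.pow 2).smul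
    (contDiffAt_const.clm_comp (h1.clm_comp contDiffAt_const)))

theorem contDiffAt_coneEnd (hφ : ContDiffAt ℝ ∞ φ z.2) (hξ : ContDiffAt ℝ ∞ ξ z.2)
    (hη : ContDiffAt ℝ ∞ η z.2) (hz : z.1 ≠ 0) : ContDiffAt ℝ ∞ (coneEnd φ ξ η) z := by
  have h1 : ContDiffAt ℝ ∞ (fun x : ℝ × E => φ x.2) z := hφ.comp z contDiffAt_snd
  have h2 : ContDiffAt ℝ ∞ (fun x : ℝ × E => ξ x.2) z := hξ.comp z contDiffAt_snd
  have h3 : ContDiffAt ℝ ∞ (fun x : ℝ × E => η x.2) z := hη.comp z contDiffAt_snd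
  have h4 : ∀ v : E, (ContinuousLinearMap.fst ℝ ℝ E).smulRight v
      = ContinuousLinearMap.smulRightL ℝ (ℝ × E) E (ContinuousLinearMap.fst ℝ ℝ E) v := fun v => rfl
  unfold coneEnd
  simp only [h4]
  exact (contDiffAt_const.clm_comp (contDiffAt_fst.smul (h3.clm_comp contDiffAt_const))).add
    (contDiffAt_const.clm_comp ((h1.clm_comp contDiffAt_const).sub ((contDiffAt_fst.inv hz).smul
      (contDiffAt_const.clm_apply h2))))

theorem hasFDerivAt_comp_snd {W : Type*} [NormedAddCommGroup W] [NormedSpace ℝ W] {f : E → W}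
    (hf : DifferentiableAt ℝ f z.2) :
    HasFDerivAt (fun x : ℝ × E => f x.2) ((fderiv ℝ f z.2).comp (ContinuousLinearMap.snd ℝ ℝ E)) z :=
  hf.hasFDerivAt.comp z hasFDerivAt_snd

theorem fderiv_coneForm (hG : ContDiffAt ℝ ∞ G z.2) (u v w : ℝ × E) :
    fderiv ℝ (coneForm G) z u v w
      = 2 * z.1 * u.1 * G z.2 v.2 w.2 + z.1 ^ 2 * fderiv ℝ G z.2 u.2 v.2 w.2 := by
  have h0 := ((contDiffAt_coneForm hG).differentiableAt (by simp)).hasFDerivAt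
  have h1 := ((h0.clm_apply (hasFDerivAt_const v z)).clm_apply (hasFDerivAt_const w z)).fderiv
  have h2 := ((hasFDerivAt_const (v.1 * w.1) z).add ((hasFDerivAt_fst.pow 2).mul
    (((hasFDerivAt_comp_snd (hG.differentiableAt (by simp))).clm_apply
      (hasFDerivAt_const v.2 z)).clm_apply (hasFDerivAt_const w.2 z)))).fderiv
  have h3 : (fun x => coneForm G x v w) = fun x : ℝ × E => v.1 * w.1 + x.1 ^ 2 * G x.2 v.2 w.2 :=
    funext fun x => coneForm_apply G x v w
  rw [h3] at h1
  simp only [Pi.add_def, Pi.mul_def] at h2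
  rw [h2] at h1
  have h4 := DFunLike.congr_fun h1 u
  simp at h4
  rw [← h4]
  ring

theorem fderiv_coneEnd (hφ : ContDiffAt ℝ ∞ φ z.2) (hξ : ContDiffAt ℝ ∞ ξ z.2)
    (hη : ContDiffAt ℝ ∞ η z.2) (hz : z.1 ≠ 0) (u v : ℝ × E) :
    fderiv ℝ (coneEnd φ ξ η) z u v = (u.1 * η z.2 v.2 + z.1 * fderiv ℝ η z.2 u.2 v.2,
      fderiv ℝ φ z.2 u.2 v.2 + (u.1 * v.1 * (z.1 ^ 2)⁻¹) • ξ z.2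
        - (z.1⁻¹ * v.1) • fderiv ℝ ξ z.2 u.2) := by
  have h0 := ((contDiffAt_coneEnd hφ hξ hη hz).differentiableAt (by simp)).hasFDerivAt
  have h1 := (h0.clm_apply (hasFDerivAt_const v z)).fderiv
  have hinv := (hasDerivAt_inv hz).comp_hasFDerivAt z (hasFDerivAt_fst (𝕜 := ℝ) (E := ℝ) (F := E))
  have h2 := ((hasFDerivAt_fst.mul ((hasFDerivAt_comp_snd
    (hη.differentiableAt (by simp))).clm_apply (hasFDerivAt_const v.2 z))).prodMk
    (((hasFDerivAt_comp_snd (hφ.differentiableAt (by simp))).clm_apply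
      (hasFDerivAt_const v.2 z)).sub ((hinv.mul (hasFDerivAt_const v.1 z)).smul
        (hasFDerivAt_comp_snd (hξ.differentiableAt (by simp)))))).fderiv
  have h3 : (fun x => coneEnd φ ξ η x v)
      = fun x : ℝ × E => (x.1 * η x.2 v.2, φ x.2 v.2 - (x.1⁻¹ * v.1) • ξ x.2) :=
    funext fun x => coneEnd_apply φ ξ η x v
  rw [h3] at h1
  simp only [Pi.sub_def, Pi.mul_def, Pi.smul_def', Function.comp_def] at h2
  rw [h2] at h1
  have h4 := DFunLike.congr_fun h1 u
  simp at h4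
  rw [← h4]
  refine Prod.ext ?_ ?_
  · simp only []
    ring
  · simp only []
    have : -(v.1 * (-u.1 / z.1 ^ 2)) = u.1 * v.1 * (z.1 ^ 2)⁻¹ := by ring
    module

theorem coneForm_posDef (hz : z.1 ≠ 0) (hp : ∀ v, v ≠ 0 → 0 < G z.2 v v) (v : ℝ × E)
    (hv : v ≠ 0) : 0 < coneForm G z v v := by
  rw [coneForm_apply]
  by_cases h : v.2 = 0
  · have h1 : v.1 ≠ 0 := fun h1 => hv (Prod.ext h1 h)
    rw [h]
    simpa using mul_self_pos.mpr h1
  · have := mul_pos (pow_pos (abs_pos.mpr hz) 2) (hp _ h)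
    rw [sq_abs] at this
    nlinarith [mul_self_nonneg v.1]

theorem christoffel_coneForm [FiniteDimensional ℝ E] (hG : ContDiffAt ℝ ∞ G z.2) (hz : z.1 ≠ 0)
    (hp : ∀ v, v ≠ 0 → 0 < G z.2 v v) (v w : ℝ × E) :
    christoffel (coneForm G) z v w = (-z.1 * G z.2 v.2 w.2,
      z.1⁻¹ • (v.1 • w.2 + w.1 • v.2) + christoffel G z.2 v.2 w.2) := by
  refine christoffel_eq (isInvertible_of_posDef (coneForm_posDef hz hp)) fun x => ?_
  rw [coneForm_apply, fderiv_coneForm hG, fderiv_coneForm hG, fderiv_coneForm hG]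
  simp only [map_add, map_smul, add_apply, smul_apply, smul_eq_mul,
    christoffel_spec (isInvertible_of_posDef hp)]
  field_simp
  ring

theorem coneForm_symm (hs : ∀ v w, G z.2 v w = G z.2 w v) (v w : ℝ × E) :
    coneForm G z v w = coneForm G z w v := by
  rw [coneForm_apply, coneForm_apply, hs, mul_comm v.1]

theorem fderiv_radial {c : ℝ → ℝ} (hc : DifferentiableAt ℝ c z.1) :
    fderiv ℝ (fun x : ℝ × E => c x.1) z = deriv c z.1 • ContinuousLinearMap.fst ℝ ℝ E := by
  exact (hc.hasDerivAt.comp_hasFDerivAt z hasFDerivAt_fst).fderiv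

theorem fderiv_fderiv_radial {c : ℝ → ℝ} (hc : ContDiffAt ℝ 2 c z.1) (v w : ℝ × E) :
    fderiv ℝ (fderiv ℝ (fun x : ℝ × E => c x.1)) z v w = deriv (deriv c) z.1 * v.1 * w.1 := by
  have h1 : ∀ᶠ x : ℝ × E in nhds z, DifferentiableAt ℝ c x.1 :=
    (continuous_fst.tendsto z).eventually
      (((hc.of_le (m := 1) (by norm_num)).eventually (by simp)).mono
        fun t ht => ht.differentiableAt (by simp))
  have h2 : fderiv ℝ (fun x : ℝ × E => c x.1) =ᶠ[nhds z]
      fun x => deriv c x.1 • ContinuousLinearMap.fst ℝ ℝ E := h1.mono fun x hx => fderiv_radial hx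
  have h3 : DifferentiableAt ℝ (deriv c) z.1 := by
    have : ContDiffAt ℝ 1 (fderiv ℝ c) z.1 := hc.fderiv_right (by norm_num)
    have h4 : deriv c = fun t => fderiv ℝ c t 1 := by ext t; simp
    rw [h4]
    exact (this.clm_apply contDiffAt_const).differentiableAt (by simp)
  have h5 := ((h3.hasDerivAt.comp_hasFDerivAt z
    (hasFDerivAt_fst (𝕜 := ℝ) (E := ℝ) (F := E))).smul_const
      (ContinuousLinearMap.fst ℝ ℝ E)).fderiv
  simp only [Function.comp_def] at h5
  rw [h2.fderiv_eq, h5]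
  simp

namespace ContactMetricAt

theorem coneForm_invertible [FiniteDimensional ℝ E] (h : ContactMetricAt G φ ξ η z.2) (hz : z.1 ≠ 0) :
    (coneForm G z).IsInvertible :=
  isInvertible_of_posDef (coneForm_posDef hz h.pos.self_of_nhds)

theorem metric_xi {s : E} (h : ContactMetricAt G φ ξ η s) :
    ∀ᶠ t in nhds s, ∀ v, G t v (ξ t) = η t v := by
  filter_upwards [h.η_ξ, h.φ_φ, h.compatible] with t h1 h2 h3 v
  have := h3 v (ξ t)
  rw [phi_xi h1 h2, h1, map_zero] at this
  linarith

theorem almostHermitianAt_cone [FiniteDimensional ℝ E] (h : ContactMetricAt G φ ξ η z.2)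
    (hz : z.1 ≠ 0) : AlmostHermitianAt (coneForm G) (coneEnd φ ξ η) z := by
  have hsnd : Filter.Tendsto (fun x : ℝ × E => x.2) (nhds z) (nhds z.2) :=
    continuous_snd.tendsto z
  have hfst : ∀ᶠ x : ℝ × E in nhds z, x.1 ≠ 0 :=
    continuous_fst.continuousAt.eventually_ne hz
  refine ⟨contDiffAt_coneForm h.smooth_metric,
    contDiffAt_coneEnd h.smooth_φ h.smooth_ξ h.smooth_η hz, h.coneForm_invertible hz, ?_, ?_, ?_⟩
  · filter_upwards [hsnd.eventually h.symm] with x hx v w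
    rw [coneForm_apply, coneForm_apply, hx, mul_comm v.1]
  · filter_upwards [hfst, hsnd.eventually h.η_ξ, hsnd.eventually h.φ_φ] with x hx h1 h2 v
    rw [coneEnd_apply, coneEnd_apply]
    simp only [map_sub, map_smul, h1, h2, eta_phi h1 h2, phi_xi h1 h2, smul_eq_mul]
    refine Prod.ext ?_ ?_
    · simp only [Prod.fst_neg]
      field_simp
      ring
    · simp only [Prod.snd_neg]
      rw [inv_mul_cancel_left₀ hx]
      module
  · filter_upwards [hfst, hsnd.eventually h.η_ξ, hsnd.eventually h.φ_φ,
      hsnd.eventually h.compatible, hsnd.eventually h.metric_xi, hsnd.eventually h.symm]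
      with x hx h1 h2 h3 h4 h5 v w
    rw [coneForm_apply, coneForm_apply, coneEnd_apply, coneEnd_apply]
    simp only [map_sub, map_smul, sub_apply, smul_apply, h3, h4, h5 (ξ x.2), eta_phi h1 h2, h1,
      smul_eq_mul]
    field_simp
    ring

/-- The fundamental form is exact, with primitive `θ = r²η/2`. The contact condition enters through
its validity near the point, since `ω = dθ` is differentiated. -/
theorem fundamentalForm_closed [FiniteDimensional ℝ E] (h : ContactMetricAt G φ ξ η z.2)
    (hz : z.1 ≠ 0) (u v w : ℝ × E) :
    fderiv ℝ (coneForm G) z u v (coneEnd φ ξ η z w)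
        + coneForm G z v (fderiv ℝ (coneEnd φ ξ η) z u w)
      + (fderiv ℝ (coneForm G) z v w (coneEnd φ ξ η z u)
        + coneForm G z w (fderiv ℝ (coneEnd φ ξ η) z v u))
      + (fderiv ℝ (coneForm G) z w u (coneEnd φ ξ η z v)
        + coneForm G z u (fderiv ℝ (coneEnd φ ξ η) z w v)) = 0 := by
  set θ : ℝ × E → (ℝ × E) →L[ℝ] ℝ := fun x =>
    (x.1 ^ 2 * (1 / 2)) • (η x.2).comp (ContinuousLinearMap.snd ℝ ℝ E) with hθ
  have hsnd : Filter.Tendsto (fun x : ℝ × E => x.2) (nhds z) (nhds z.2) :=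
    continuous_snd.tendsto z
  have hfst : ∀ᶠ x : ℝ × E in nhds z, x.1 ≠ 0 :=
    continuous_fst.continuousAt.eventually_ne hz
  have hs : ContDiffAt ℝ ∞ θ z := by
    have h3 : ContDiffAt ℝ ∞ (fun x : ℝ × E => η x.2) z := h.smooth_η.comp z contDiffAt_snd
    exact ((contDiffAt_fst.pow 2).mul contDiffAt_const).smul (h3.clm_comp contDiffAt_const)
  have hH := h.almostHermitianAt_cone hz
  have hηd : ∀ᶠ t in nhds z.2, DifferentiableAt ℝ η t :=
    ((h.smooth_η.of_le (m := 1) (by norm_cast)).eventually (by simp)).mono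
      fun t ht => ht.differentiableAt (by simp)
  have hθ1 : ∀ᶠ x in nhds z, ∀ v w, fderiv ℝ θ x v w
      = x.1 * v.1 * η x.2 w.2 + x.1 ^ 2 / 2 * fderiv ℝ η x.2 v.2 w.2 := by
    filter_upwards [hsnd.eventually hηd] with x hx v w
    have h2 := ((((hasFDerivAt_fst (𝕜 := ℝ) (E := ℝ) (F := E) (p := x)).pow 2).mul
      (hasFDerivAt_const (1 / 2 : ℝ) x)).smul
      ((hasFDerivAt_comp_snd hx).clm_comp (hasFDerivAt_const (ContinuousLinearMap.snd ℝ ℝ E) x))).fderiv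
    simp only [Pi.mul_def, Pi.smul_def'] at h2
    rw [hθ, h2]
    simp
    ring
  have hω : ∀ᶠ x in nhds z, ∀ v w, coneForm G x v (coneEnd φ ξ η x w)
      = fderiv ℝ θ x v w - fderiv ℝ θ x w v := by
    filter_upwards [hθ1, hfst, hsnd.eventually h.contact, hsnd.eventually h.metric_xi]
      with x h1 h2 h3 h4 v w
    have h5 := h3 v.2 w.2
    rw [h1, h1, coneForm_apply, coneEnd_apply]
    simp only [map_sub, map_smul, smul_eq_mul, h4]
    field_simp
    linear_combination (- x.1) * h5
  have hθ2 : HasFDerivAt (fderiv ℝ θ) (fderiv ℝ (fderiv ℝ θ) z) z :=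
    ((hs.fderiv_right (m := 1) (by norm_cast)).differentiableAt (by simp)).hasFDerivAt
  have key : ∀ u v w, fderiv ℝ (coneForm G) z u v (coneEnd φ ξ η z w)
        + coneForm G z v (fderiv ℝ (coneEnd φ ξ η) z u w)
      = fderiv ℝ (fderiv ℝ θ) z u v w - fderiv ℝ (fderiv ℝ θ) z u w v := by
    intro u v w
    have e1 : (fun x => coneForm G x v (coneEnd φ ξ η x w)) =ᶠ[nhds z]
      fun x => fderiv ℝ θ x v w - fderiv ℝ θ x w v := hω.mono fun x hx => hx v w
    have e2 := e1.fderiv_eq (𝕜 := ℝ)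
    have e3 := ((hH.differentiable_metric.hasFDerivAt.clm_apply (hasFDerivAt_const v z)).clm_apply
      (hH.differentiable_end.hasFDerivAt.clm_apply (hasFDerivAt_const w z))).fderiv
    have e4 := (((hθ2.clm_apply (hasFDerivAt_const v z)).clm_apply (hasFDerivAt_const w z)).sub
      ((hθ2.clm_apply (hasFDerivAt_const w z)).clm_apply (hasFDerivAt_const v z))).fderiv
    simp only [Pi.sub_def] at e4
    rw [e3, e4] at e2
    have e5 := DFunLike.congr_fun e2 u
    simp at e5
    rw [← e5]
    ring
  -- This is `d²θ = 0`: the six second derivatives cancel in pairs.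
  rw [key, key, key, fderiv_fderiv_symm hs u v, fderiv_fderiv_symm hs v w,
    fderiv_fderiv_symm hs u w]
  ring

end ContactMetricAt

end LocalCone

/-! ### Normality: integrability on the cone and the Reeb field -/

section LocalSasakian

variable {E : Type*} [NormedAddCommGroup E] [NormedSpace ℝ E]
  {G : E → E →L[ℝ] E →L[ℝ] ℝ} {φ : E → E →L[ℝ] E} {ξ : E → E} {η : E → E →L[ℝ] ℝ}

namespace SasakianAt

variable {s : E}

/-- This and the next two lemmas differentiate the identities `η ∘ φ = 0`, `φξ = 0` and `η(ξ) = 1`.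
-/
theorem fderiv_eta_phi (h : SasakianAt G φ ξ η s) (v w : E) :
    fderiv ℝ η s v (φ s w) + η s (fderiv ℝ φ s v w) = 0 := by
  have h1 : (fun t => η t (φ t w)) =ᶠ[nhds s] fun _ => 0 := by
    filter_upwards [h.η_ξ, h.φ_φ] with t h1 h2
    exact eta_phi h1 h2 w
  have hφ := (h.smooth_φ.differentiableAt (by simp)).hasFDerivAt
  have hη := (h.smooth_η.differentiableAt (by simp)).hasFDerivAt
  have h2 := h1.fderiv_eq (𝕜 := ℝ)
  rw [(hη.clm_apply (hφ.clm_apply (hasFDerivAt_const w s))).fderiv] at h2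
  have h3 := DFunLike.congr_fun h2 v
  simp at h3
  linarith

theorem fderiv_phi_xi (h : SasakianAt G φ ξ η s) (v : E) :
    fderiv ℝ φ s v (ξ s) = -φ s (fderiv ℝ ξ s v) := by
  have h1 : (fun t => φ t (ξ t)) =ᶠ[nhds s] fun _ => 0 := by
    filter_upwards [h.η_ξ, h.φ_φ] with t h1 h2
    exact phi_xi h1 h2
  have hφ := (h.smooth_φ.differentiableAt (by simp)).hasFDerivAt
  have hξ := (h.smooth_ξ.differentiableAt (by simp)).hasFDerivAt
  have h2 := h1.fderiv_eq (𝕜 := ℝ)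
  rw [(hφ.clm_apply hξ).fderiv] at h2
  have h3 := DFunLike.congr_fun h2 v
  simp at h3
  exact eq_neg_of_add_eq_zero_right h3

theorem fderiv_eta_xi (h : SasakianAt G φ ξ η s) (v : E) :
    fderiv ℝ η s v (ξ s) + η s (fderiv ℝ ξ s v) = 0 := by
  have hη := (h.smooth_η.differentiableAt (by simp)).hasFDerivAt
  have hξ := (h.smooth_ξ.differentiableAt (by simp)).hasFDerivAt
  have h1 : (fun t => η t (ξ t)) =ᶠ[nhds s] fun _ => 1 := h.η_ξ
  have h2 := h1.fderiv_eq (𝕜 := ℝ)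
  rw [(hη.clm_apply hξ).fderiv] at h2
  have h3 := DFunLike.congr_fun h2 v
  simp at h3
  linarith

theorem deta_xi (h : SasakianAt G φ ξ η s) (v : E) :
    fderiv ℝ η s v (ξ s) = fderiv ℝ η s (ξ s) v := by
  have := h.contact.self_of_nhds v (ξ s)
  rw [phi_xi h.η_ξ.self_of_nhds h.φ_φ.self_of_nhds, map_zero] at this
  linarith

/-- By the contact condition the sum is `2g(φv, φw) + 2g(v, φ²w)`, and both `φ²` and compatibility
are known. -/
theorem deta_phi (h : SasakianAt G φ ξ η s) (v w : E) :
    fderiv ℝ η s (φ s v) w - fderiv ℝ η s w (φ s v)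
      + (fderiv ℝ η s v (φ s w) - fderiv ℝ η s (φ s w) v) = 0 := by
  rw [h.contact.self_of_nhds, h.contact.self_of_nhds, h.compatible.self_of_nhds,
    h.φ_φ.self_of_nhds]
  simp only [map_add, map_neg, map_smul, h.metric_xi.self_of_nhds, smul_eq_mul]
  ring

theorem phi_skew (h : SasakianAt G φ ξ η s) (v w : E) : G s (φ s v) w + G s v (φ s w) = 0 := by
  have h1 := h.contact.self_of_nhds v w
  have h2 := h.contact.self_of_nhds w v
  rw [h.symm.self_of_nhds w] at h2
  linarith

/-- The Reeb field preserves the structure endomorphism. -/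
theorem lie_xi_phi (h : SasakianAt G φ ξ η s) (v : E) :
    fderiv ℝ φ s (ξ s) v - fderiv ℝ ξ s (φ s v) + φ s (fderiv ℝ ξ s v) = 0 := by
  set X := fderiv ℝ φ s (ξ s) v - fderiv ℝ ξ s (φ s v) + φ s (fderiv ℝ ξ s v) with hX
  have hφξ := phi_xi h.η_ξ.self_of_nhds h.φ_φ.self_of_nhds
  -- Normality at `(v, ξ)`: the `dη` term vanishes and what is left is `φX`.
  have h1 : φ s X = 0 := by
    have := h.normal v (ξ s)
    rw [h.deta_xi, sub_self, zero_smul, hφξ, map_zero, h.fderiv_phi_xi, h.fderiv_phi_xi, map_neg,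
      zero_apply] at this
    rw [← this, hX]
    simp only [map_add, map_sub]
    abel
  have h2 : η s X = 0 := by
    have e1 := h.fderiv_eta_phi (ξ s) v
    have e2 := h.fderiv_eta_xi (φ s v)
    have e3 := h.deta_xi (φ s v)
    rw [hX]
    simp only [map_add, map_sub, eta_phi h.η_ξ.self_of_nhds h.φ_φ.self_of_nhds]
    linarith
  -- Since `φX = 0` and `η(X) = 0`, the formula for `φ²X` gives `X = 0`.
  have h3 := h.φ_φ.self_of_nhds X
  rw [h1, h2, map_zero, zero_smul, add_zero] at h3
  exact neg_eq_zero.mp h3.symm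

end SasakianAt

variable {z : ℝ × E}

namespace SasakianAt

/-- The `∂_r` component vanishes by `deta_phi`, `dη(·, ξ) = 0` and the differentiated identities;
the component along the base is normality plus multiples of `L_ξ φ`. -/
theorem nijenhuis_cone (h : SasakianAt G φ ξ η z.2) (hz : z.1 ≠ 0) (v w : ℝ × E) :
    fderiv ℝ (coneEnd φ ξ η) z (coneEnd φ ξ η z v) w
      - fderiv ℝ (coneEnd φ ξ η) z (coneEnd φ ξ η z w) v
      + coneEnd φ ξ η z (fderiv ℝ (coneEnd φ ξ η) z w v)
      - coneEnd φ ξ η z (fderiv ℝ (coneEnd φ ξ η) z v w) = 0 := by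
  have hφξ := phi_xi h.η_ξ.self_of_nhds h.φ_φ.self_of_nhds
  have hηφ := eta_phi h.η_ξ.self_of_nhds h.φ_φ.self_of_nhds
  have hηξ := h.η_ξ.self_of_nhds
  simp only [fderiv_coneEnd h.smooth_φ h.smooth_ξ h.smooth_η hz, coneEnd_apply]
  refine Prod.ext ?_ ?_
  · simp only [Prod.fst_add, Prod.fst_sub, Prod.fst_zero, map_add, map_sub, map_smul,
      sub_apply, smul_apply, smul_eq_mul, hηξ]
    have e1 := h.fderiv_eta_phi v.2 w.2
    have e2 := h.fderiv_eta_phi w.2 v.2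
    have e3 := h.fderiv_eta_xi v.2
    have e4 := h.fderiv_eta_xi w.2
    have e5 := h.deta_xi v.2
    have e6 := h.deta_xi w.2
    have e7 := h.deta_phi v.2 w.2
    field_simp
    linear_combination z.1 * (z.1 * e7 - z.1 * e1 + z.1 * e2 + w.1 * e3 - v.1 * e4 - w.1 * e5 + v.1 * e6)
  · simp only [Prod.snd_add, Prod.snd_sub, Prod.snd_zero, map_add, map_sub, map_smul,
      sub_apply, smul_apply, hφξ, smul_zero]
    have e1 := h.normal v.2 w.2
    have e2 := h.lie_xi_phi v.2
    have e3 := h.lie_xi_phi w.2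
    have hz1 : z.1⁻¹ * z.1 = 1 := inv_mul_cancel₀ hz
    have hz2 : (z.1 ^ 2)⁻¹ = z.1⁻¹ * z.1⁻¹ := by rw [sq, mul_inv]
    rw [hz2]
    have key : ∀ a b : ℝ, z.1⁻¹ * (a + z.1 * b) = z.1⁻¹ * a + b := fun a b => by
      rw [mul_add, ← mul_assoc, hz1, one_mul]
    have key2 : ∀ a b : ℝ, z.1 * a * b * (z.1⁻¹ * z.1⁻¹) = z.1⁻¹ * (a * b) := fun a b => by
      rw [← one_mul (z.1⁻¹ * (a * b)), ← hz1]; ring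
    rw [key, key, key2, key2]
    have e5 := congrArg₂ (· + ·) e1 (congrArg₂ (· - ·) (congrArg ((z.1⁻¹ * w.1) • ·) e2)
      (congrArg ((z.1⁻¹ * v.1) • ·) e3))
    simp only [smul_zero, sub_zero, add_zero] at e5
    rw [← e5]
    module

theorem localCovDeriv_cone [FiniteDimensional ℝ E] (h : SasakianAt G φ ξ η z.2)
    (hz : z.1 ≠ 0) (v w : ℝ × E) : localCovDeriv (coneForm G) (coneEnd φ ξ η) z v w = 0 :=
  (h.toContactMetricAt.almostHermitianAt_cone hz).localCovDeriv_eq_zero (h.toContactMetricAt.fundamentalForm_closed hz)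
    (h.nijenhuis_cone hz) v w

/-- Read off from `∇J = 0` on the cone: at `r = 1` one has `J ∂_r = -ξ` and `∇_v ∂_r = v`, so the
base component of `(∇_v J) ∂_r = 0` is this identity. -/
theorem covDeriv_xi [FiniteDimensional ℝ E] {s : E} (h : SasakianAt G φ ξ η s) (v : E) :
    fderiv ℝ ξ s v + christoffel G s v (ξ s) = -φ s v := by
  have h' : SasakianAt G φ ξ η ((1, s) : ℝ × E).2 := h
  have h1 := congrArg Prod.snd (h'.localCovDeriv_cone one_ne_zero (0, v) (1, 0))
  simp only [localCovDeriv, fderiv_coneEnd h'.smooth_φ h'.smooth_ξ h'.smooth_η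
    (z := (1, s)) one_ne_zero, coneEnd_apply, christoffel_coneForm h'.smooth_metric
    (z := (1, s)) one_ne_zero h'.pos.self_of_nhds] at h1
  simp [← christoffelCLM_apply] at h1
  rw [← christoffelCLM_apply, ← sub_eq_zero, ← neg_eq_zero, ← h1]
  abel

/-- The Reeb field is Killing. -/
theorem lie_xi_metric [FiniteDimensional ℝ E] {s : E} (h : SasakianAt G φ ξ η s) (v w : E) :
    fderiv ℝ G s (ξ s) v w + G s (fderiv ℝ ξ s v) w + G s v (fderiv ℝ ξ s w) = 0 := by
  have hd := h.smooth_metric.differentiableAt (by simp)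
  have hi := isInvertible_of_posDef h.pos.self_of_nhds
  rw [fderiv_metric hd hi h.symm, eq_sub_of_add_eq (h.covDeriv_xi v),
    eq_sub_of_add_eq (h.covDeriv_xi w), christoffel_symm hd hi h.symm v,
    christoffel_symm hd hi h.symm w]
  have := h.phi_skew v w
  simp only [map_sub, map_neg, sub_apply, neg_apply]
  linarith

end SasakianAt

end LocalSasakian

/-! ### Radial functions on the cone and the conformal metric -/

section ConeCalculus

variable {E : Type*} [NormedAddCommGroup E] [NormedSpace ℝ E] [FiniteDimensional ℝ E]
  {G : E → E →L[ℝ] E →L[ℝ] ℝ} {z : ℝ × E}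

theorem sharp_coneForm (hz : z.1 ≠ 0) (hp : ∀ v, v ≠ 0 → 0 < G z.2 v v) (a : ℝ) :
    sharp (coneForm G z) (a • ContinuousLinearMap.fst ℝ ℝ E) = (a, 0) := by
  refine sharp_eq (isInvertible_of_posDef (coneForm_posDef hz hp)) fun w => ?_
  simp [coneForm_apply]

theorem sharp_coneForm_fst (hz : z.1 ≠ 0) (hp : ∀ v, v ≠ 0 → 0 < G z.2 v v) :
    sharp (coneForm G z) (ContinuousLinearMap.fst ℝ ℝ E) = (1, 0) := by
  have := sharp_coneForm hz hp 1
  rwa [one_smul] at this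

theorem christoffel_coneForm_fst (hG : ContDiffAt ℝ ∞ G z.2) (hz : z.1 ≠ 0)
    (hp : ∀ v, v ≠ 0 → 0 < G z.2 v v) (v w : ℝ × E) :
    (christoffel (coneForm G) z v w).1 = z.1⁻¹ * (v.1 * w.1 - coneForm G z v w) := by
  rw [christoffel_coneForm hG hz hp, coneForm_apply]
  field_simp
  ring

/-- The Laplacian of a radial function. -/
theorem laplacian_radial (hG : ContDiffAt ℝ ∞ G z.2) (hz : z.1 ≠ 0)
    (hp : ∀ v, v ≠ 0 → 0 < G z.2 v v) (hs : ∀ v w, G z.2 v w = G z.2 w v) {c : ℝ → ℝ}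
    (hc : ContDiffAt ℝ 2 c z.1) :
    metricTrace (coneForm G z) (fun v w => fderiv ℝ (fderiv ℝ (fun x : ℝ × E => c x.1)) z v w
        - fderiv ℝ (fun x : ℝ × E => c x.1) z (christoffel (coneForm G) z v w))
      = deriv (deriv c) z.1 + (Module.finrank ℝ E : ℝ) * (deriv c z.1 / z.1) := by
  have hi := isInvertible_of_posDef (coneForm_posDef hz hp)
  -- The Hessian of a radial function is `(c'' - c'/r) dr² + (c'/r) ĝ`; both summands have known
  -- traces.
  have h1 : ∀ v w : ℝ × E, fderiv ℝ (fderiv ℝ (fun x : ℝ × E => c x.1)) z v w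
        - fderiv ℝ (fun x : ℝ × E => c x.1) z (christoffel (coneForm G) z v w)
      = (ContinuousLinearMap.fst ℝ ℝ E) v • ((deriv (deriv c) z.1 - deriv c z.1 / z.1) •
          (ContinuousLinearMap.fst ℝ ℝ E).toLinearMap) w
        + coneForm G z v w • (deriv c z.1 / z.1) := by
    intro v w
    rw [fderiv_fderiv_radial hc, fderiv_radial (hc.differentiableAt (by simp))]
    simp only [smul_apply, ContinuousLinearMap.coe_fst', christoffel_coneForm_fst hG hz hp,
      smul_eq_mul, LinearMap.smul_apply, ContinuousLinearMap.coe_coe]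
    field_simp
    ring
  simp only [h1]
  rw [metricTrace_add, metricTrace_form_left, metricTrace_self hi (coneForm_symm hs),
    sharp_coneForm_fst hz hp, Module.finrank_prod, Module.finrank_self]
  simp
  ring

/-- The metric `r⁻⁴ (dr² + r² g)` in coordinates. -/
noncomputable def conformalForm (G : E → E →L[ℝ] E →L[ℝ] ℝ) (z : ℝ × E) :
    (ℝ × E) →L[ℝ] (ℝ × E) →L[ℝ] ℝ :=
  (z.1 ^ 4)⁻¹ • coneForm G z

/-- The conformal change formula for `e^{2f} ĝ` with `f = -2 ln r`, so that `grad f = -(2/r) ∂_r`.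
-/
theorem christoffel_conformalForm (hG : ContDiffAt ℝ ∞ G z.2) (hz : z.1 ≠ 0)
    (hp : ∀ v, v ≠ 0 → 0 < G z.2 v v) (v w : ℝ × E) :
    christoffel (conformalForm G) z v w = christoffel (coneForm G) z v w
      - (2 / z.1) • (v.1 • w + w.1 • v) + (2 / z.1 * coneForm G z v w) • ((1, 0) : ℝ × E) := by
  have hz4 : (z.1 ^ 4)⁻¹ ≠ 0 := inv_ne_zero (pow_ne_zero _ hz)
  have hi := isInvertible_of_posDef (coneForm_posDef hz hp)
  have hi' : (conformalForm G z).IsInvertible := by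
    refine isInvertible_of_posDef fun v hv => ?_
    have h1 : 0 < (z.1 ^ 4)⁻¹ := by positivity
    simpa [conformalForm] using mul_pos h1 (coneForm_posDef hz hp v hv)
  have hd : ∀ a b x : ℝ × E, fderiv ℝ (conformalForm G) z a b x
      = (z.1 ^ 4)⁻¹ * (fderiv ℝ (coneForm G) z a b x - 4 / z.1 * a.1 * coneForm G z b x) := by
    intro a b x
    have h0 := ((contDiffAt_coneForm hG).differentiableAt (by simp)).hasFDerivAt
    have h1 := ((hasDerivAt_inv (pow_ne_zero 4 hz)).comp_hasFDerivAt z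
      ((hasFDerivAt_fst (𝕜 := ℝ) (E := ℝ) (F := E)).pow 4)).smul h0
    have h2 : conformalForm G = ((fun x => x⁻¹) ∘ fun x : ℝ × E => x.1 ^ 4) • coneForm G := rfl
    rw [h2, h1.fderiv]
    simp
    field_simp
    ring
  refine christoffel_eq hi' fun x => ?_
  rw [hd, hd, hd, conformalForm]
  have h1 : ∀ b : ℝ × E, coneForm G z (1, 0) b = b.1 := fun b => by simp [coneForm_apply]
  simp only [smul_apply, map_add, map_sub, map_smul, add_apply, sub_apply, smul_eq_mul,
    christoffel_spec hi, h1]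
  ring

end ConeCalculus

/-! ### Tension and bitension fields for the conformal metric -/

section Biharmonic

variable {E F : Type*} [NormedAddCommGroup E] [NormedSpace ℝ E] [FiniteDimensional ℝ E]
  [NormedAddCommGroup F] [NormedSpace ℝ F]
  {G : E → E →L[ℝ] E →L[ℝ] ℝ} {H : F → F →L[ℝ] F →L[ℝ] ℝ} {u V : ℝ × E → F} {y z : ℝ × E}

theorem metricTrace_conformalForm (hz : z.1 ≠ 0) (hp : ∀ v, v ≠ 0 → 0 < G z.2 v v)
    (T : (ℝ × E) →ₗ[ℝ] (ℝ × E) →ₗ[ℝ] F) :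
    metricTrace (conformalForm G z) (fun v w => T v w)
      = z.1 ^ 4 • metricTrace (coneForm G z) (fun v w => T v w) := by
  rw [conformalForm, metricTrace_smul_form (isInvertible_of_posDef (coneForm_posDef hz hp))
    (inv_ne_zero (pow_ne_zero _ hz)), inv_inv]

/-- Only the change of Christoffel symbols contributes. Its trace is `(2/r)(2 - 4) du(∂_r)` in real
dimension 4, and the inverse metric supplies the factor `r⁴`. -/
theorem tensionField_conformalForm (hdim : Module.finrank ℝ E = 3) (hG : ContDiffAt ℝ ∞ G z.2)
    (hz : z.1 ≠ 0) (hp : ∀ v, v ≠ 0 → 0 < G z.2 v v) (hs : ∀ v w, G z.2 v w = G z.2 w v)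
    (hu : ContDiffAt ℝ ∞ u z) (h0 : metricTrace (coneForm G z)
      (secondFundamentalForm (coneForm G) H u z) = 0) :
    tensionField (conformalForm G) H u z = (-4 * z.1 ^ 3) • fderiv ℝ u z (1, 0) := by
  have hi := isInvertible_of_posDef (coneForm_posDef hz hp)
  rw [tensionField]
  have h1 : secondFundamentalForm (conformalForm G) H u z
      = fun v w => (secondFundamentalFormCLM (conformalForm G) H u z).toLinearMap₁₂ v w := by
    ext v w; exact secondFundamentalFormCLM_apply hu v w
  have h2 : ∀ v w, (secondFundamentalFormCLM (conformalForm G) H u z).toLinearMap₁₂ v w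
      = secondFundamentalForm (coneForm G) H u z v w
        + ((ContinuousLinearMap.fst ℝ ℝ E v • ((2 / z.1) • (fderiv ℝ u z).toLinearMap) w
        + ContinuousLinearMap.fst ℝ ℝ E w • ((2 / z.1) • (fderiv ℝ u z).toLinearMap) v)
        + coneForm G z v w • -((2 / z.1) • fderiv ℝ u z (1, 0))) := by
    intro v w
    change secondFundamentalFormCLM (conformalForm G) H u z v w = _
    rw [← secondFundamentalFormCLM_apply hu, secondFundamentalForm_eq hu,
      secondFundamentalForm_eq hu]
    simp only [christoffelCLM_apply, christoffel_conformalForm hG hz hp, map_add, map_sub, map_smul,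
      ContinuousLinearMap.coe_fst', LinearMap.smul_apply, ContinuousLinearMap.coe_coe]
    module
  rw [h1, metricTrace_conformalForm hz hp]
  simp only [h2]
  rw [metricTrace_add, metricTrace_add, metricTrace_add, h0, metricTrace_form_left,
    metricTrace_form_right hi (coneForm_symm hs), metricTrace_self hi (coneForm_symm hs),
    sharp_coneForm_fst hz hp, Module.finrank_prod, Module.finrank_self, hdim]
  simp only [LinearMap.smul_apply, ContinuousLinearMap.coe_coe, zero_add, smul_neg, smul_smul,
    ← add_smul, ← sub_eq_add_neg, ← sub_smul]
  congr 1
  push_cast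
  field_simp
  ring

/-- For a tension field `-4r² V`, the Leibniz rule and the conformal Christoffel symbols separate
the Jacobi operator of `V`, which vanishes by `hJ`, from terms of order at most one in `V`. -/
theorem bitensionField_conformalForm (hdim : Module.finrank ℝ E = 3) (hG : ContDiffAt ℝ ∞ G y.2)
    (hy : y.1 ≠ 0) (hp : ∀ v, v ≠ 0 → 0 < G y.2 v v) (hs : ∀ v w, G y.2 v w = G y.2 w v)
    (hu : ContDiffAt ℝ ∞ u y) (hV : ∀ᶠ z in nhds y, ContDiffAt ℝ ∞ V z)
    (hH : ContDiffAt ℝ ∞ (christoffelCLM H) (u y))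
    (hsH : ∀ᶠ q in nhds (u y), ∀ v w, christoffelCLM H q v w = christoffelCLM H q w v)
    (hτ : tensionField (conformalForm G) H u =ᶠ[nhds y] fun z => (-4 * z.1 ^ 2) • V z)
    (hJ : metricTrace (coneForm G y) (jacobiForm (coneForm G) H u V y) = 0) :
    bitensionField (conformalForm G) H u y = 0 := by
  have hi := isInvertible_of_posDef (coneForm_posDef hy hp)
  have hHd : DifferentiableAt ℝ (christoffelCLM H) (u y) := hH.differentiableAt (by simp)
  have hV0 := hV.self_of_nhds
  obtain ⟨T, hT⟩ := exists_jacobiForm_linear (G := coneForm G) hu hV0 hHd hsH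
  set L : (ℝ × E) →ₗ[ℝ] F := (fderiv ℝ V y
    + ((christoffelCLM H (u y)).flip (V y)).comp (fderiv ℝ u y)).toLinearMap with hL
  have hLa : ∀ v, pullbackDeriv H u V v y = L v := fun v => by
    rw [pullbackDeriv_eq, hL]; simp
  have hf1 : ∀ x : ℝ × E, HasFDerivAt (fun x : ℝ × E => -4 * x.1 ^ 2)
      ((-8 * x.1) • ContinuousLinearMap.fst ℝ ℝ E) x := by
    intro x
    have h := ((hasFDerivAt_fst (𝕜 := ℝ) (E := ℝ) (F := E) (p := x)).pow 2).const_mul (-4)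
    refine h.congr_fderiv ?_
    ext <;> simp
    ring
  have hf2 : ∀ v : ℝ × E, HasFDerivAt (fun x : ℝ × E => -8 * x.1 * v.1)
      ((-8 * v.1) • ContinuousLinearMap.fst ℝ ℝ E) y := by
    intro v
    have h := ((hasFDerivAt_fst (𝕜 := ℝ) (E := ℝ) (F := E) (p := y)).const_mul (-8)).mul_const v.1
    refine h.congr_fderiv ?_
    ext <;> simp
    ring
  have hpd1 : ∀ w, pullbackDeriv H u (tensionField (conformalForm G) H u) w =ᶠ[nhds y]
      fun x => (-8 * x.1 * w.1) • V x + (-4 * x.1 ^ 2) • pullbackDeriv H u V w x := by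
    intro w
    refine (pullbackDeriv_congr hτ w).trans ?_
    filter_upwards [hV] with x hx
    rw [pullbackDeriv_smul (hf1 x).differentiableAt (hx.differentiableAt (by simp)), (hf1 x).fderiv]
    simp
  have hpdd : ∀ w, DifferentiableAt ℝ (pullbackDeriv H u V w) y := by
    intro w
    have h1 : pullbackDeriv H u V w = fun z =>
        fderiv ℝ V z w + christoffelCLM H (u z) (fderiv ℝ u z w) (V z) :=
      funext fun z => pullbackDeriv_eq w z
    have hV2 : ContDiffAt ℝ 1 (fderiv ℝ V) y := hV0.fderiv_right (by norm_cast)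
    have hu2 : ContDiffAt ℝ 1 (fderiv ℝ u) y := hu.fderiv_right (by norm_cast)
    have hu1 : DifferentiableAt ℝ u y := hu.differentiableAt (by simp)
    rw [h1]
    exact ((hV2.differentiableAt (by simp)).clm_apply (differentiableAt_const w)).add
      (((hHd.comp y hu1).clm_apply ((hu2.differentiableAt (by simp)).clm_apply
        (differentiableAt_const w))).clm_apply (hV0.differentiableAt (by simp)))
  have hpd2 : ∀ v w, pullbackDeriv H u (pullbackDeriv H u (tensionField (conformalForm G) H u) w) v y
      = (-8 * w.1 * v.1) • V y + (-8 * y.1 * w.1) • L v + (-8 * y.1 * v.1) • L w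
        + (-4 * y.1 ^ 2) • pullbackDeriv H u (pullbackDeriv H u V w) v y := by
    intro v w
    rw [(pullbackDeriv_congr (hpd1 w) v).self_of_nhds, pullbackDeriv_add
      ((hf2 w).differentiableAt.fun_smul (hV0.differentiableAt (by simp)))
      ((hf1 y).differentiableAt.fun_smul (hpdd w)), pullbackDeriv_smul (hf2 w).differentiableAt
      (hV0.differentiableAt (by simp)), pullbackDeriv_smul (hf1 y).differentiableAt (hpdd w),
      (hf1 y).fderiv, (hf2 w).fderiv, hLa, hLa]
    simp only [smul_apply, ContinuousLinearMap.coe_fst', smul_eq_mul]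
    abel
  -- In the `dr²` coefficient, `-32 = -8 - 24`: the Hessian of `-4r²` gives `-8`, the radial part of
  -- the conformal Christoffel symbol gives `-24`.
  have hsum : ∀ v w, pullbackDeriv H u (pullbackDeriv H u (tensionField (conformalForm G) H u) w) v y
        - pullbackDeriv H u (tensionField (conformalForm G) H u) (christoffel (conformalForm G) y v w) y
        + curvature H (u y) (tensionField (conformalForm G) H u y) (fderiv ℝ u y v) (fderiv ℝ u y w)
      = ((-4 * y.1 ^ 2) • T v w
        + (ContinuousLinearMap.fst ℝ ℝ E v • ((-16 * y.1) • L) w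
        + ContinuousLinearMap.fst ℝ ℝ E w • ((-16 * y.1) • L) v))
        + (ContinuousLinearMap.fst ℝ ℝ E v •
            ((-32 : ℝ) • (ContinuousLinearMap.fst ℝ ℝ E).smulRight (V y)).toLinearMap w
        + coneForm G y v w • ((8 * y.1) • L (1, 0) + (8 : ℝ) • V y)) := by
    intro v w
    rw [hpd2, (hpd1 _).self_of_nhds]
    beta_reduce
    rw [hLa, hτ.self_of_nhds, curvature_smul_left _ hHd, ← hT,
      jacobiForm, hLa, christoffel_conformalForm hG hy hp]
    simp only [map_add, map_sub, map_smul, Prod.fst_add, Prod.fst_sub, Prod.smul_fst,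
      christoffel_coneForm_fst hG hy hp, smul_eq_mul, LinearMap.smul_apply,
      ContinuousLinearMap.coe_coe, smul_apply, ContinuousLinearMap.smulRight_apply,
      ContinuousLinearMap.coe_fst']
    match_scalars <;> field_simp <;> ring
  set X : (ℝ × E) → (ℝ × E) → F := fun v w =>
    pullbackDeriv H u (pullbackDeriv H u (tensionField (conformalForm G) H u) w) v y
        - pullbackDeriv H u (tensionField (conformalForm G) H u) (christoffel (conformalForm G) y v w) y
        + curvature H (u y) (tensionField (conformalForm G) H u y) (fderiv ℝ u y v) (fderiv ℝ u y w)
    with hX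
  obtain ⟨M, hM⟩ : ∃ M : (ℝ × E) →ₗ[ℝ] (ℝ × E) →ₗ[ℝ] F, ∀ v w, X v w = M v w := by
    refine ⟨LinearMap.mk₂ ℝ X ?_ ?_ ?_ ?_, fun v w => rfl⟩
    all_goals
      intros
      simp only [hX, hsum, map_add, map_smul, LinearMap.add_apply, LinearMap.smul_apply, add_apply,
        smul_apply]
      module
  have h1 : bitensionField (conformalForm G) H u y = metricTrace (conformalForm G y) X := by
    rw [bitensionField, roughLaplacian, ← metricTrace_add]
  have h2 : X = fun v w => M v w := by ext v w; exact hM v w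
  have h3 : jacobiForm (coneForm G) H u V y = fun v w => T v w := by ext v w; exact hT v w
  rw [h3] at hJ
  rw [h1, h2, metricTrace_conformalForm hy hp, ← h2]
  simp only [hX, hsum]
  -- The traces are `-16r - 16r + 4·8r = 0` for `∇_{∂_r} V` and `-32 + 4·8 = 0` for `V`; dimension 4
  -- is essential.
  rw [metricTrace_add, metricTrace_add, metricTrace_add, metricTrace_add, metricTrace_smul, hJ,
    metricTrace_form_left, metricTrace_form_left,
    metricTrace_form_right hi (coneForm_symm hs), metricTrace_self hi (coneForm_symm hs),
    sharp_coneForm_fst hy hp, Module.finrank_prod, Module.finrank_self, hdim]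
  simp
  module

end Biharmonic

/-! ### Biharmonicity of holomorphic maps in cone coordinates -/

section BiharmonicCone

variable {E F : Type*} [NormedAddCommGroup E] [NormedSpace ℝ E] [FiniteDimensional ℝ E]
  [NormedAddCommGroup F] [NormedSpace ℝ F] [CompleteSpace F]
  {G : E → E →L[ℝ] E →L[ℝ] ℝ} {φ : E → E →L[ℝ] E} {ξ : E → E} {η : E → E →L[ℝ] ℝ}
  {H : F → F →L[ℝ] F →L[ℝ] ℝ} {B : F → F →L[ℝ] F} {u : ℝ × E → F} {y : ℝ × E}

theorem bitensionField_holomorphic_cone (hdim : Module.finrank ℝ E = 3) (hy : y.1 ≠ 0)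
    (hS : ∀ᶠ s in nhds y.2, ContDiffAt ℝ ∞ G s ∧ (∀ v, v ≠ 0 → 0 < G s v v) ∧
      ∀ v w, G s v w = G s w v)
    (hu : ∀ᶠ z in nhds y, ContDiffAt ℝ ∞ u z)
    (hK : ∀ᶠ z in nhds y, AlmostHermitianAt (coneForm G) (coneEnd φ ξ η) z ∧
      ∀ v w, localCovDeriv (coneForm G) (coneEnd φ ξ η) z v w = 0)
    (hH : ∀ᶠ q in nhds (u y), AlmostHermitianAt H B q ∧ ∀ v w, localCovDeriv H B q v w
      + localCovDeriv H B q (B q v) (B q w) = 0)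
    (hhol : ∀ᶠ z in nhds y, ∀ v, fderiv ℝ u z (coneEnd φ ξ η z v) = B (u z) (fderiv ℝ u z v)) :
    bitensionField (conformalForm G) H u y = 0 := by
  obtain ⟨hG, hp, hs⟩ := hS.self_of_nhds
  -- The Euler field `r ∂_r` is linear in these coordinates, and `id + tP` is the dilation `r ↦ (1 +
  -- t) r`, which respects the connection and `J`.
  set P : (ℝ × E) →L[ℝ] (ℝ × E) :=
    (ContinuousLinearMap.inl ℝ ℝ E).comp (ContinuousLinearMap.fst ℝ ℝ E) with hP
  have hPa : ∀ v : ℝ × E, P v = (v.1, 0) := fun v => rfl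
  have hne : ∀ᶠ t in nhds (0 : ℝ), 1 + t ≠ 0 := by
    have : Continuous fun t : ℝ => 1 + t := by fun_prop
    exact this.continuousAt.eventually_ne (by norm_num)
  have hfst : ∀ᶠ x : ℝ × E in nhds y, x.1 ≠ 0 := continuous_fst.continuousAt.eventually_ne hy
  have hsnd : Filter.Tendsto (fun x : ℝ × E => x.2) (nhds y) (nhds y.2) :=
    continuous_snd.tendsto y
  have hline : ∀ (t : ℝ) (v : ℝ × E), v + t • P v = ((1 + t) * v.1, v.2) := fun t v => by
    rw [hPa]
    ext <;> simp
    ring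
  have hJ := metricTrace_jacobiForm_eq_zero P hu hK hH hhol (by
      filter_upwards [hne] with t ht v w
      simp only [christoffelCLM_apply, hline]
      have e1 := christoffel_coneForm (z := ((1 + t) * y.1, y.2)) hG (mul_ne_zero ht hy) hp
      rw [e1, christoffel_coneForm hG hy hp]
      refine Prod.ext ?_ ?_
      · simp only []
        ring
      · simp only []
        match_scalars <;> field_simp) (by
      filter_upwards [hne] with t ht v
      simp only [hline, coneEnd_apply]
      refine Prod.ext ?_ ?_
      · simp only []
        ring
      · simp only []
        match_scalars <;> field_simp)
  have hu0 := hu.self_of_nhds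
  have hsH : ∀ᶠ q in nhds (u y), ∀ v w, christoffelCLM H q v w = christoffelCLM H q w v := by
    filter_upwards [hH] with q hq v w
    rw [christoffelCLM_apply, christoffelCLM_apply, hq.1.christoffel_symm]
  refine bitensionField_conformalForm hdim hG hy hp hs hu0
    (hu.mono fun z hz => contDiffAt_fderiv_linear P hz)
    (contDiffAt_christoffelCLM hH.self_of_nhds.1.contDiff_metric hH.self_of_nhds.1.invertible)
    hsH ?_ hJ
  filter_upwards [hfst, hu, hK, hu0.continuousAt.eventually hH, hhol.eventually_nhds,
    hsnd.eventually hS] with z h1 h2 h3 h4 h5 h6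
  rw [tensionField_conformalForm hdim h6.1 h1 h6.2.1 h6.2.2 h2
    (metricTrace_secondFundamentalForm_eq_zero h2 h3.1 h3.2 h4.1 h4.2 h5)]
  have : P z = z.1 • ((1, 0) : ℝ × E) := by rw [hPa]; simp
  rw [this, map_smul, smul_smul]
  congr 1
  ring

end BiharmonicCone

/-! ### Smoothness of coordinate expressions -/

section ChartFrames

variable {E : Type*} [NormedAddCommGroup E] [NormedSpace ℝ E]
  {H : Type*} [TopologicalSpace H] {I : ModelWithCorners ℝ E H}
  {M : Type*} [TopologicalSpace M] [ChartedSpace H M] {x : M} {y : E}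

theorem extChartAt_symm_mem_source (hy : y ∈ (extChartAt I x).target) :
    (extChartAt I x).symm y ∈ (chartAt H x).source := by
  rw [← extChartAt_source I x]
  exact (extChartAt I x).map_target hy

theorem chartMetric_apply (g : ∀ p : M, TangentSpace I p →L[ℝ] TangentSpace I p →L[ℝ] ℝ)
    (v w : E) : chartMetric I g x y v w
      = g ((extChartAt I x).symm y) (chartFrame I x y v) (chartFrame I x y w) := rfl

theorem chartForm_apply (η : ∀ p : M, TangentSpace I p →L[ℝ] ℝ) (v : E) :
    chartForm I η x y v = η ((extChartAt I x).symm y) (chartFrame I x y v) := rfl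

variable [I.Boundaryless]

theorem target_mem_nhds (hy : y ∈ (extChartAt I x).target) :
    ∀ᶠ z in nhds y, z ∈ (extChartAt I x).target :=
  (isOpen_extChartAt_target x).mem_nhds hy

/-- Links smoothness of sections, which is phrased with trivialisations of the tangent bundle, to
smoothness of coordinate expressions, which are built from `chartFrame`. -/
theorem symmL_eq_chartFrame [IsManifold I 1 M] (hy : y ∈ (extChartAt I x).target) :
    (trivializationAt E (TangentSpace I) x).symmL ℝ ((extChartAt I x).symm y)
      = chartFrame I x y := by
  rw [TangentBundle.symmL_trivializationAt (extChartAt_symm_mem_source hy), I.range_eq_univ,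
    mfderivWithin_univ]
  have : ∀ z, z = y → (mfderiv 𝓘(ℝ, E) I (extChartAt I x).symm z : E →L[ℝ] E)
      = chartFrame I x y := by rintro z rfl; rfl
  exact this _ ((extChartAt I x).right_inv hy)

theorem continuousLinearMapAt_eq_inverse [IsManifold I 1 M] (hy : y ∈ (extChartAt I x).target) :
    (trivializationAt E (TangentSpace I) x).continuousLinearMapAt ℝ ((extChartAt I x).symm y)
      = (chartFrame I x y).inverse := by
  have hb : (extChartAt I x).symm y ∈ (trivializationAt E (TangentSpace I) x).baseSet := by
    simpa using extChartAt_symm_mem_source hy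
  symm
  rw [← symmL_eq_chartFrame hy]
  apply ContinuousLinearMap.inverse_eq
  · ext v
    exact (trivializationAt E (TangentSpace I) x).symmL_continuousLinearMapAt hb v
  · ext v
    exact (trivializationAt E (TangentSpace I) x).continuousLinearMapAt_symmL hb v

variable [IsManifold I ∞ M]

theorem chartFrame_isInvertible (hy : y ∈ (extChartAt I x).target) :
    (chartFrame I x y).IsInvertible := by
  have : IsManifold I 1 M := IsManifold.of_le (n := ∞) (by norm_cast)
  have h := isInvertible_mfderivWithin_extChartAt_symm (I := I) hy
  rwa [I.range_eq_univ, mfderivWithin_univ] at h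

theorem chartFrame_inverse_apply (hy : y ∈ (extChartAt I x).target)
    (v : TangentSpace I ((extChartAt I x).symm y)) :
    chartFrame I x y ((chartFrame I x y).inverse v) = v :=
  DFunLike.congr_fun (chartFrame_isInvertible hy).self_comp_inverse v

theorem inverse_chartFrame_apply (hy : y ∈ (extChartAt I x).target) (v : E) :
    (chartFrame I x y).inverse (chartFrame I x y v) = v :=
  DFunLike.congr_fun (chartFrame_isInvertible hy).inverse_comp_self v

theorem chartFrame_chartEnd (J : ∀ p : M, TangentSpace I p →L[ℝ] TangentSpace I p)
    (hy : y ∈ (extChartAt I x).target) (v : E) :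
    chartFrame I x y (chartEnd I J x y v)
      = J ((extChartAt I x).symm y) (chartFrame I x y v) :=
  chartFrame_inverse_apply hy _

theorem chartFrame_chartField (X : ∀ p : M, TangentSpace I p)
    (hy : y ∈ (extChartAt I x).target) :
    chartFrame I x y (chartField I X x y) = X ((extChartAt I x).symm y) :=
  chartFrame_inverse_apply hy _

theorem chartFrame_injective (hy : y ∈ (extChartAt I x).target) :
    Function.Injective (chartFrame I x y) :=
  Function.LeftInverse.injective (inverse_chartFrame_apply hy)

theorem contDiffAt_of_contMDiffAt_comp {W : Type*} [NormedAddCommGroup W] [NormedSpace ℝ W]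
    {f : M → W} (hy : y ∈ (extChartAt I x).target)
    (hf : ContMDiffAt I 𝓘(ℝ, W) ∞ f ((extChartAt I x).symm y)) :
    ContDiffAt ℝ ∞ (fun z => f ((extChartAt I x).symm z)) y := by
  rw [← contMDiffAt_iff_contDiffAt]
  have h1 : ContMDiffAt 𝓘(ℝ, E) I ∞ (extChartAt I x).symm y :=
    (contMDiffOn_extChartAt_symm x).contMDiffAt (target_mem_nhds hy)
  exact hf.comp y h1

theorem contDiffAt_chartEnd {J : ∀ p : M, TangentSpace I p →L[ℝ] TangentSpace I p}
    (hJ : SmoothEnd I J) (hy : y ∈ (extChartAt I x).target) :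
    ContDiffAt ℝ ∞ (chartEnd I J x) y := by
  have : IsManifold I 1 M := IsManifold.of_le (n := ∞) (by norm_cast)
  have hb : (extChartAt I x).symm y ∈ (trivializationAt (E →L[ℝ] E)
      (fun p : M => TangentSpace I p →L[ℝ] TangentSpace I p) x).baseSet := by
    rw [hom_trivializationAt_baseSet]
    simpa using extChartAt_symm_mem_source hy
  have h1 := (Bundle.Trivialization.contMDiffAt_section_iff (n := ∞) (IB := I) _ hb).1
    (hJ ((extChartAt I x).symm y))
  refine (contDiffAt_of_contMDiffAt_comp hy h1).congr_of_eventuallyEq ?_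
  filter_upwards [target_mem_nhds hy] with z hz
  rw [hom_trivializationAt_apply, ContinuousLinearMap.inCoordinates]
  dsimp only
  rw [continuousLinearMapAt_eq_inverse hz, symmL_eq_chartFrame hz]
  rfl

theorem contDiffAt_chartField {X : ∀ p : M, TangentSpace I p}
    (hX : SmoothField I X) (hy : y ∈ (extChartAt I x).target) :
    ContDiffAt ℝ ∞ (chartField I X x) y := by
  have : IsManifold I 1 M := IsManifold.of_le (n := ∞) (by norm_cast)
  have hb : (extChartAt I x).symm y ∈ (trivializationAt E (TangentSpace I) x).baseSet := by
    simpa using extChartAt_symm_mem_source hy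
  have h1 := (Bundle.Trivialization.contMDiffAt_section_iff (n := ∞) (IB := I) _ hb).1
    (hX ((extChartAt I x).symm y))
  refine (contDiffAt_of_contMDiffAt_comp hy h1).congr_of_eventuallyEq ?_
  filter_upwards [target_mem_nhds hy] with z hz
  rw [chartField, ← continuousLinearMapAt_eq_inverse hz,
    Bundle.Trivialization.continuousLinearMapAt_apply, Bundle.Trivialization.linearMapAt_apply,
    if_pos]
  simpa using extChartAt_symm_mem_source hz

theorem contDiffAt_chartForm {η : ∀ p : M, TangentSpace I p →L[ℝ] ℝ}
    (hη : SmoothForm I η) (hy : y ∈ (extChartAt I x).target) :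
    ContDiffAt ℝ ∞ (chartForm I η x) y := by
  have : IsManifold I 1 M := IsManifold.of_le (n := ∞) (by norm_cast)
  have hb : (extChartAt I x).symm y ∈ (trivializationAt (E →L[ℝ] ℝ)
      (fun p : M => TangentSpace I p →L[ℝ] ℝ) x).baseSet := by
    rw [hom_trivializationAt_baseSet]
    simpa using extChartAt_symm_mem_source hy
  have h1 := (Bundle.Trivialization.contMDiffAt_section_iff (n := ∞) (IB := I) _ hb).1
    (hη ((extChartAt I x).symm y))
  refine (contDiffAt_of_contMDiffAt_comp hy h1).congr_of_eventuallyEq ?_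
  filter_upwards [target_mem_nhds hy] with z hz
  rw [hom_trivializationAt_apply, ContinuousLinearMap.inCoordinates]
  dsimp only
  rw [symmL_eq_chartFrame hz]
  ext v
  simp [chartForm]

theorem contDiffAt_chartMetric (g : SmoothMetric I M) (hy : y ∈ (extChartAt I x).target) :
    ContDiffAt ℝ ∞ (chartMetric I g.inner x) y := by
  have : IsManifold I 1 M := IsManifold.of_le (n := ∞) (by norm_cast)
  have hb : (extChartAt I x).symm y ∈ (trivializationAt (E →L[ℝ] E →L[ℝ] ℝ)
      (fun p : M => TangentSpace I p →L[ℝ] TangentSpace I p →L[ℝ] ℝ) x).baseSet := by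
    rw [hom_trivializationAt_baseSet, hom_trivializationAt_baseSet]
    simpa using extChartAt_symm_mem_source hy
  have h1 := (Bundle.Trivialization.contMDiffAt_section_iff (n := ∞) (IB := I) _ hb).1
    (g.contMDiff ((extChartAt I x).symm y))
  refine (contDiffAt_of_contMDiffAt_comp hy h1).congr_of_eventuallyEq ?_
  filter_upwards [target_mem_nhds hy] with z hz
  have hbz : (extChartAt I x).symm z ∈ (trivializationAt E (TangentSpace I) x).baseSet := by
    simpa using extChartAt_symm_mem_source hz
  rw [hom_trivializationAt_apply]
  dsimp only
  ext v w
  rw [inCoordinates_apply_eq₂ hbz hbz (by simp), chartMetric_apply, ← symmL_eq_chartFrame hz,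
    Bundle.Trivialization.symmL_apply _ hbz, Bundle.Trivialization.symmL_apply _ hbz]
  simp

/-- The tangent space at `x` is the model space read in the preferred chart at `x`, so at the centre
coordinate vectors are tangent vectors. -/
theorem chartFrame_self : chartFrame I x (extChartAt I x x) = ContinuousLinearMap.id ℝ E := by
  have : IsManifold I 1 M := IsManifold.of_le (n := ∞) (by norm_cast)
  have h1 := mfderiv_extChartAt_comp_mfderivWithin_extChartAt_symm (I := I)
    (mem_extChartAt_target (I := I) x)
  rw [I.range_eq_univ, mfderivWithin_univ] at h1
  have h2 : ∀ p, p = x → (mfderiv I 𝓘(ℝ, E) (extChartAt I x) p : E →L[ℝ] E)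
      = ContinuousLinearMap.id ℝ E := by
    rintro p rfl
    exact mfderiv_extChartAt_self
  have h3 := h2 _ ((extChartAt I x).left_inv (mem_extChartAt_source x))
  ext v
  have h4 := DFunLike.congr_fun h1 v
  have h5 := DFunLike.congr_fun h3 (chartFrame I x (extChartAt I x x) v)
  exact h5.symm.trans h4

end ChartFrames

/-! ### Tensor fields in different charts -/

section ChartTransitions

variable {E : Type*} [NormedAddCommGroup E] [NormedSpace ℝ E]
  {H : Type*} [TopologicalSpace H] {I : ModelWithCorners ℝ E H}
  {M : Type*} [TopologicalSpace M] [ChartedSpace H M] {x x' : M} {y : E}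

/-- The coordinate change from the chart at `x` to the chart at `x'`. -/
noncomputable def transition (I : ModelWithCorners ℝ E H) (x x' : M) : E → E :=
  extChartAt I x' ∘ (extChartAt I x).symm

theorem transition_mem_target (hy' : (extChartAt I x).symm y ∈ (extChartAt I x').source) :
    transition I x x' y ∈ (extChartAt I x').target :=
  (extChartAt I x').map_source hy'

theorem symm_transition (hy' : (extChartAt I x).symm y ∈ (extChartAt I x').source) :
    (extChartAt I x').symm (transition I x x' y) = (extChartAt I x).symm y :=
  (extChartAt I x').left_inv hy'

variable [I.Boundaryless]

theorem eventually_transition_source (hy : y ∈ (extChartAt I x).target)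
    (hy' : (extChartAt I x).symm y ∈ (extChartAt I x').source) :
    ∀ᶠ z in nhds y, z ∈ (extChartAt I x).target ∧
      (extChartAt I x).symm z ∈ (extChartAt I x').source := by
  have h1 : ContinuousAt (extChartAt I x).symm y :=
    (continuousOn_extChartAt_symm x).continuousAt (target_mem_nhds hy)
  exact (target_mem_nhds hy).and
    (h1.eventually ((isOpen_extChartAt_source x').mem_nhds hy'))

variable [IsManifold I ∞ M]

theorem contDiffAt_transition (hy : y ∈ (extChartAt I x).target)
    (hy' : (extChartAt I x).symm y ∈ (extChartAt I x').source) :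
    ContDiffAt ℝ ∞ (transition I x x') y := by
  have h := contDiffWithinAt_ext_coord_change (I := I) (n := ∞) x' x (y := y) ⟨hy, hy'⟩
  rwa [I.range_eq_univ, contDiffWithinAt_univ] at h

theorem chartFrame_transition (hy : y ∈ (extChartAt I x).target)
    (hy' : (extChartAt I x).symm y ∈ (extChartAt I x').source) (v : E) :
    (chartFrame I x y v : E)
      = chartFrame I x' (transition I x x' y) (fderiv ℝ (transition I x x') y v) := by
  have hτ : MDifferentiableAt 𝓘(ℝ, E) 𝓘(ℝ, E) (transition I x x') y :=
    ((contDiffAt_transition hy hy').differentiableAt (by simp)).mdifferentiableAt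
  have hs : MDifferentiableAt 𝓘(ℝ, E) I (extChartAt I x').symm (transition I x x' y) :=
    ((contMDiffOn_extChartAt_symm (n := ∞) x').contMDiffAt
      (target_mem_nhds (transition_mem_target hy'))).mdifferentiableAt (by simp)
  have he : (extChartAt I x).symm =ᶠ[nhds y] (extChartAt I x').symm ∘ transition I x x' := by
    filter_upwards [eventually_transition_source hy hy'] with z hz
    exact (symm_transition hz.2).symm
  have h1 := he.mfderiv_eq (I := 𝓘(ℝ, E)) (I' := I)
  have h2 := mfderiv_comp y hs hτ
  rw [mfderiv_eq_fderiv] at h2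
  exact DFunLike.congr_fun (h1.trans h2) v

theorem chartMetric_transition (g : ∀ p : M, TangentSpace I p →L[ℝ] TangentSpace I p →L[ℝ] ℝ)
    (hy : y ∈ (extChartAt I x).target)
    (hy' : (extChartAt I x).symm y ∈ (extChartAt I x').source) (v w : E) :
    chartMetric I g x y v w = chartMetric I g x' (transition I x x' y)
      (fderiv ℝ (transition I x x') y v) (fderiv ℝ (transition I x x') y w) := by
  -- The two base points are equal only propositionally. Reading every fibre as `E` lets the points
  -- be identified by substitution; the same device recurs below.
  have key : ∀ p q : M, p = q → ∀ a b c d : E, a = c → b = d →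
      (g p : E →L[ℝ] E →L[ℝ] ℝ) a b = (g q : E →L[ℝ] E →L[ℝ] ℝ) c d := by
    rintro p _ rfl a b _ _ rfl rfl
    rfl
  exact key _ _ (symm_transition hy').symm _ _ _ _ (chartFrame_transition hy hy' v)
    (chartFrame_transition hy hy' w)

theorem chartForm_transition (η : ∀ p : M, TangentSpace I p →L[ℝ] ℝ)
    (hy : y ∈ (extChartAt I x).target)
    (hy' : (extChartAt I x).symm y ∈ (extChartAt I x').source) (v : E) :
    chartForm I η x y v = chartForm I η x' (transition I x x' y)
      (fderiv ℝ (transition I x x') y v) := by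
  have key : ∀ p q : M, p = q → ∀ a c : E, a = c →
      (η p : E →L[ℝ] ℝ) a = (η q : E →L[ℝ] ℝ) c := by
    rintro p _ rfl a _ rfl
    rfl
  exact key _ _ (symm_transition hy').symm _ _ (chartFrame_transition hy hy' v)

theorem chartEnd_transition (J : ∀ p : M, TangentSpace I p →L[ℝ] TangentSpace I p)
    (hy : y ∈ (extChartAt I x).target)
    (hy' : (extChartAt I x).symm y ∈ (extChartAt I x').source) (v : E) :
    chartEnd I J x' (transition I x x' y) (fderiv ℝ (transition I x x') y v)
      = fderiv ℝ (transition I x x') y (chartEnd I J x y v) := by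
  have key : ∀ p q : M, p = q → ∀ a c : E, a = c →
      ((J p : E →L[ℝ] E) a : E) = (J q : E →L[ℝ] E) c := by
    rintro p _ rfl a _ rfl
    rfl
  apply chartFrame_injective (transition_mem_target hy')
  refine (chartFrame_chartEnd J (transition_mem_target hy') _).trans ?_
  refine Eq.trans ?_ (chartFrame_transition hy hy' _)
  refine Eq.trans ?_ (chartFrame_chartEnd J hy v).symm
  exact key _ _ (symm_transition hy') _ _ (chartFrame_transition hy hy' v).symm

theorem fderiv_transition_injective (hy : y ∈ (extChartAt I x).target)
    (hy' : (extChartAt I x).symm y ∈ (extChartAt I x').source) :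
    Function.Injective (fderiv ℝ (transition I x x') y) := by
  intro v w h
  apply chartFrame_injective hy
  refine (chartFrame_transition hy hy' v).trans ?_
  rw [h]
  exact (chartFrame_transition hy hy' w).symm

theorem fderiv_transition_surjective (hy : y ∈ (extChartAt I x).target)
    (hy' : (extChartAt I x).symm y ∈ (extChartAt I x').source) :
    Function.Surjective (fderiv ℝ (transition I x x') y) := by
  intro w
  obtain ⟨e, he⟩ := chartFrame_isInvertible hy
  obtain ⟨v, hv⟩ := e.surjective (chartFrame I x' (transition I x x' y) w)
  refine ⟨v, ?_⟩
  apply chartFrame_injective (transition_mem_target hy')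
  refine (chartFrame_transition hy hy' v).symm.trans (Eq.trans ?_ hv)
  rw [← he]
  rfl

theorem localCovDeriv_chart_transition
    (g : ∀ p : M, TangentSpace I p →L[ℝ] TangentSpace I p →L[ℝ] ℝ)
    (J : ∀ p : M, TangentSpace I p →L[ℝ] TangentSpace I p)
    (hy : y ∈ (extChartAt I x).target)
    (hy' : (extChartAt I x).symm y ∈ (extChartAt I x').source)
    (hG : AlmostHermitianAt (chartMetric I g x) (chartEnd I J x) y)
    (hG' : AlmostHermitianAt (chartMetric I g x') (chartEnd I J x') (transition I x x' y))
    (v w : E) :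
    localCovDeriv (chartMetric I g x') (chartEnd I J x') (transition I x x' y)
        (fderiv ℝ (transition I x x') y v) (fderiv ℝ (transition I x x') y w)
      = fderiv ℝ (transition I x x') y
          (localCovDeriv (chartMetric I g x) (chartEnd I J x) y v w) := by
  refine localCovDeriv_transition ((contDiffAt_transition hy hy').of_le (by norm_cast))
    hG'.differentiable_metric hG.differentiable_metric hG.differentiable_end hG'.differentiable_end
    hG.invertible hG'.invertible hG'.symm (fderiv_transition_surjective hy hy') ?_ ?_ v w
  · filter_upwards [eventually_transition_source hy hy'] with z hz v w
    exact chartMetric_transition g hz.1 hz.2 v w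
  · filter_upwards [eventually_transition_source hy hy'] with z hz v
    exact chartEnd_transition J hz.1 hz.2 v

/-- Change to the chart centred at the point itself, whose frame there is the identity. -/
theorem chartFrame_eq_fderiv (hy : y ∈ (extChartAt I x).target) (v : E) :
    (chartFrame I x y v : E) = fderiv ℝ (transition I x ((extChartAt I x).symm y)) y v := by
  refine (chartFrame_transition hy (mem_extChartAt_source _) v).trans ?_
  have h : transition I x ((extChartAt I x).symm y) y
    = extChartAt I ((extChartAt I x).symm y) ((extChartAt I x).symm y) := rfl
  rw [h]
  exact DFunLike.congr_fun chartFrame_self _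

/-- A Kähler structure is Kähler in every chart. -/
theorem localCovDeriv_eq_zero_of_isKahler
    {g : ∀ p : M, TangentSpace I p →L[ℝ] TangentSpace I p →L[ℝ] ℝ}
    {J : ∀ p : M, TangentSpace I p →L[ℝ] TangentSpace I p} (hK : IsKahler I g J)
    (hG : ∀ (x : M), ∀ y ∈ (extChartAt I x).target,
      AlmostHermitianAt (chartMetric I g x) (chartEnd I J x) y)
    (hy : y ∈ (extChartAt I x).target) (v w : E) :
    localCovDeriv (chartMetric I g x) (chartEnd I J x) y v w = 0 := by
  have hy' := mem_extChartAt_source (I := I) ((extChartAt I x).symm y)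
  have h := localCovDeriv_chart_transition g J hy hy' (hG _ _ hy)
    (hG _ _ (transition_mem_target hy')) v w
  have h2 := hK.2 ((extChartAt I x).symm y)
    (fderiv ℝ (transition I x ((extChartAt I x).symm y)) y v)
    (fderiv ℝ (transition I x ((extChartAt I x).symm y)) y w)
  apply fderiv_transition_injective hy hy'
  rw [← h, map_zero]
  exact h2

/-- A (1,2)-symplectic structure is (1,2)-symplectic in every chart. -/
theorem localCovDeriv_of_isOneTwoSymplectic
    {g : ∀ p : M, TangentSpace I p →L[ℝ] TangentSpace I p →L[ℝ] ℝ}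
    {J : ∀ p : M, TangentSpace I p →L[ℝ] TangentSpace I p} (hK : IsOneTwoSymplectic I g J)
    (hG : ∀ (x : M), ∀ y ∈ (extChartAt I x).target,
      AlmostHermitianAt (chartMetric I g x) (chartEnd I J x) y)
    (hy : y ∈ (extChartAt I x).target) (v w : E) :
    localCovDeriv (chartMetric I g x) (chartEnd I J x) y v w
      + localCovDeriv (chartMetric I g x) (chartEnd I J x) y
        (chartEnd I J x y v) (chartEnd I J x y w) = 0 := by
  have hy' := mem_extChartAt_source (I := I) ((extChartAt I x).symm y)
  have h := localCovDeriv_chart_transition g J hy hy' (hG _ _ hy)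
    (hG _ _ (transition_mem_target hy'))
  have h2 := hK.2 ((extChartAt I x).symm y)
    (fderiv ℝ (transition I x ((extChartAt I x).symm y)) y v)
    (fderiv ℝ (transition I x ((extChartAt I x).symm y)) y w)
  apply fderiv_transition_injective hy hy'
  rw [map_add, ← h, ← h, map_zero, ← chartEnd_transition J hy hy', ← chartEnd_transition J hy hy']
  exact h2

theorem chartMetric_posDef (g : SmoothMetric I M) (hy : y ∈ (extChartAt I x).target) (v : E)
    (hv : v ≠ 0) : 0 < chartMetric I g.inner x y v v := by
  rw [chartMetric_apply]
  refine g.pos _ _ fun h => hv (chartFrame_injective hy ?_)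
  rw [h, map_zero]

theorem chartEnd_sq {J : ∀ p : M, TangentSpace I p →L[ℝ] TangentSpace I p}
    (hJ : ∀ (p : M) (v : TangentSpace I p), J p (J p v) = -v)
    (hy : y ∈ (extChartAt I x).target) (v : E) :
    chartEnd I J x y (chartEnd I J x y v) = -v := by
  apply chartFrame_injective hy
  rw [chartFrame_chartEnd J hy, chartFrame_chartEnd J hy, hJ, map_neg]

theorem almostHermitianAt_chart [FiniteDimensional ℝ E] (g : SmoothMetric I M)
    {J : ∀ p : M, TangentSpace I p →L[ℝ] TangentSpace I p} (hs : SmoothEnd I J)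
    (hJ : IsAlmostHermitian I g.inner J) (hy : y ∈ (extChartAt I x).target) :
    AlmostHermitianAt (chartMetric I g.inner x) (chartEnd I J x) y := by
  refine ⟨contDiffAt_chartMetric g hy, contDiffAt_chartEnd hs hy,
    isInvertible_of_posDef (chartMetric_posDef g hy), ?_, ?_, ?_⟩
  · exact Filter.Eventually.of_forall fun z v w => g.symm _ _ _
  · filter_upwards [target_mem_nhds hy] with z hz v
    exact chartEnd_sq hJ.1 hz v
  · filter_upwards [target_mem_nhds hy] with z hz v w
    rw [chartMetric_apply, chartFrame_chartEnd J hz, chartFrame_chartEnd J hz, hJ.2,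
      ← chartMetric_apply]

end ChartTransitions

/-! ### The chart of the half-line is the inclusion -/

section HalfLineCharts

theorem extChartAt_halfLine (p q : HalfLine) : extChartAt 𝓘(ℝ, ℝ) p q = q := by
  rfl

theorem extChartAt_halfLine_target (p : HalfLine) :
    (extChartAt 𝓘(ℝ, ℝ) p).target = Set.Ioi 0 := by
  simp only [extChartAt, TopologicalSpace.Opens.chartAt_eq, OpenPartialHomeomorph.subtypeRestr_def,
    chartAt_self_eq]
  simp

theorem extChartAt_halfLine_symm (p : HalfLine) {r : ℝ} (hr : 0 < r) :
    ((extChartAt 𝓘(ℝ, ℝ) p).symm r : ℝ) = r := by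
  have h : r ∈ (extChartAt 𝓘(ℝ, ℝ) p).target := by rwa [extChartAt_halfLine_target]
  rw [← extChartAt_halfLine p, (extChartAt 𝓘(ℝ, ℝ) p).right_inv h]

end HalfLineCharts

/-! ### Cone structures in product charts -/

section ConeCharts

variable {E : Type*} [NormedAddCommGroup E] [NormedSpace ℝ E]
  {S : Type*} [TopologicalSpace S] [ChartedSpace E S]
  {p : Cone S} {y : ℝ × E}

theorem mem_cone_target : y ∈ (extChartAt (coneModel E) p).target
    ↔ 0 < y.1 ∧ y.2 ∈ (extChartAt 𝓘(ℝ, E) p.2).target := by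
  rw [extChartAt_prod, PartialEquiv.prod_target, Set.mem_prod, extChartAt_halfLine_target,
    Set.mem_Ioi]

theorem cone_symm_fst (hy : y ∈ (extChartAt (coneModel E) p).target) :
    (((extChartAt (coneModel E) p).symm y).1 : ℝ) = y.1 := by
  rw [extChartAt_prod]
  exact extChartAt_halfLine_symm _ (mem_cone_target.1 hy).1

theorem cone_symm_snd :
    ((extChartAt (coneModel E) p).symm y).2 = (extChartAt 𝓘(ℝ, E) p.2).symm y.2 := by
  rw [extChartAt_prod]
  rfl

theorem extChartAt_cone_apply (q : Cone S) :
    extChartAt (coneModel E) p q = ((q.1 : ℝ), extChartAt 𝓘(ℝ, E) p.2 q.2) := by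
  rw [extChartAt_prod]
  exact Prod.ext (extChartAt_halfLine _ _) rfl

variable [IsManifold 𝓘(ℝ, E) ∞ S]

/-- Coordinate changes of the cone are the identity in `r` times those of `S`. -/
theorem chartFrame_cone (hy : y ∈ (extChartAt (coneModel E) p).target) (v : ℝ × E) :
    (chartFrame (coneModel E) p y v : ℝ × E) = (v.1, chartFrame 𝓘(ℝ, E) p.2 y.2 v.2) := by
  have hy2 := (mem_cone_target.1 hy).2
  refine (chartFrame_eq_fderiv hy v).trans ?_
  have h1 : transition (coneModel E) p ((extChartAt (coneModel E) p).symm y) =ᶠ[nhds y]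
      fun z => (z.1, transition 𝓘(ℝ, E) p.2 ((extChartAt 𝓘(ℝ, E) p.2).symm y.2) z.2) := by
    filter_upwards [target_mem_nhds hy] with z hz
    rw [transition, Function.comp_apply, extChartAt_cone_apply, cone_symm_fst hz, cone_symm_snd,
      cone_symm_snd]
    rfl
  have h2 := (hasFDerivAt_fst (𝕜 := ℝ) (p := y)).prodMk
    (hasFDerivAt_comp_snd (z := y) ((contDiffAt_transition hy2
      (mem_extChartAt_source _)).differentiableAt (by simp)))
  rw [h1.fderiv_eq, h2.fderiv]
  exact Prod.ext rfl (chartFrame_eq_fderiv hy2 v.2).symm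

variable (σ : SasakianStructure E S)

theorem coneMetric_apply (p : Cone S) (v w : ℝ × E) :
    σ.coneMetric p v w = v.1 * w.1 + (p.1 : ℝ) ^ 2 * σ.g.inner p.2 v.2 w.2 := rfl

theorem coneJ_apply (p : Cone S) (v : ℝ × E) :
    σ.coneJ p v = ((p.1 : ℝ) * σ.η p.2 v.2, σ.φ p.2 v.2 - ((p.1 : ℝ)⁻¹ * v.1) • σ.ξ p.2) := by
  refine Prod.ext rfl ?_
  rw [← smul_smul]
  rfl

theorem chartMetric_cone (hy : y ∈ (extChartAt (coneModel E) p).target) :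
    chartMetric (coneModel E) σ.coneMetric p y
      = coneForm (chartMetric 𝓘(ℝ, E) σ.g.inner p.2) y := by
  refine ContinuousLinearMap.ext fun v => ContinuousLinearMap.ext fun w => ?_
  rw [coneForm_apply, chartMetric_apply]
  refine (coneMetric_apply σ _ _ _).trans ?_
  rw [chartFrame_cone hy, chartFrame_cone hy, cone_symm_fst hy, chartMetric_apply]
  have key : ∀ q q' : S, q = q' → ∀ a b : E, (σ.g.inner q : E →L[ℝ] E →L[ℝ] ℝ) a b
      = (σ.g.inner q' : E →L[ℝ] E →L[ℝ] ℝ) a b := by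
    rintro q _ rfl a b; rfl
  exact congrArg (fun t => v.1 * w.1 + y.1 ^ 2 * t) (key _ _ cone_symm_snd _ _)

/-- A field that is tangent to the slices and proportional to the Reeb field. -/
theorem chartField_cone_xi (F : ℝ → ℝ) (hy : y ∈ (extChartAt (coneModel E) p).target) :
    chartField (coneModel E)
        (fun q : Cone S => ((0, F q.1 • σ.ξ q.2) : ℝ × E)) p y
      = (0, F y.1 • chartField 𝓘(ℝ, E) σ.ξ p.2 y.2) := by
  apply chartFrame_injective hy
  refine (chartFrame_chartField _ hy).trans (Eq.trans ?_ (chartFrame_cone hy _).symm)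
  have key : ∀ q q' : S, q = q' → (σ.ξ q : E) = (σ.ξ q' : E) := by rintro q _ rfl; rfl
  have h := chartFrame_chartField σ.ξ (mem_cone_target.1 hy).2
  simp only [map_smul, cone_symm_fst hy]
  refine Prod.ext rfl (congrArg (F y.1 • ·) ?_)
  exact (key _ _ cone_symm_snd).trans h.symm

theorem chartField_cone_radial (F : ℝ → ℝ) (hy : y ∈ (extChartAt (coneModel E) p).target) :
    chartField (coneModel E) (fun q : Cone S => ((F q.1, 0) : ℝ × E)) p y = (F y.1, 0) := by
  apply chartFrame_injective hy
  refine (chartFrame_chartField _ hy).trans (Eq.trans ?_ (chartFrame_cone hy _).symm)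
  simp only [map_zero, cone_symm_fst hy]
  rfl

theorem chartEnd_cone (hy : y ∈ (extChartAt (coneModel E) p).target) :
    chartEnd (coneModel E) σ.coneJ p y = coneEnd (chartEnd 𝓘(ℝ, E) σ.φ p.2)
      (chartField 𝓘(ℝ, E) σ.ξ p.2) (chartForm 𝓘(ℝ, E) σ.η p.2) y := by
  have hy2 := (mem_cone_target.1 hy).2
  refine ContinuousLinearMap.ext fun v => ?_
  apply chartFrame_injective hy
  refine (chartFrame_chartEnd _ hy v).trans (Eq.trans ?_ (chartFrame_cone hy _).symm)
  refine (coneJ_apply σ _ _).trans ?_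
  rw [coneEnd_apply, chartFrame_cone hy, cone_symm_fst hy, chartForm_apply]
  have k1 : ∀ q q' : S, q = q' → (σ.ξ q : E) = (σ.ξ q' : E) := by rintro q _ rfl; rfl
  have k2 : ∀ q q' : S, q = q' → ∀ a : E, (σ.η q : E →L[ℝ] ℝ) a = (σ.η q' : E →L[ℝ] ℝ) a := by
    rintro q _ rfl a; rfl
  have k3 : ∀ q q' : S, q = q' → ∀ a : E, (σ.φ q : E →L[ℝ] E) a = (σ.φ q' : E →L[ℝ] E) a := by
    rintro q _ rfl a; rfl
  simp only [map_sub, map_smul]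
  refine Prod.ext (congrArg (y.1 * ·) (k2 _ _ cone_symm_snd _)) ?_
  have h1 := (k1 _ _ (cone_symm_snd (p := p) (y := y))).trans (chartFrame_chartField σ.ξ hy2).symm
  have h2 := (k3 _ _ (cone_symm_snd (p := p) (y := y)) _).trans
    (chartFrame_chartEnd σ.φ hy2 v.2).symm
  exact congrArg₂ (fun a b : E => a - (y.1⁻¹ * v.1) • b) h2 h1

theorem contactMetricAt_chart {x : S} {s : E} (hs : s ∈ (extChartAt 𝓘(ℝ, E) x).target) :
    ContactMetricAt (chartMetric 𝓘(ℝ, E) σ.g.inner x) (chartEnd 𝓘(ℝ, E) σ.φ x)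
      (chartField 𝓘(ℝ, E) σ.ξ x) (chartForm 𝓘(ℝ, E) σ.η x) s := by
  have ht := target_mem_nhds hs
  refine ⟨contDiffAt_chartMetric σ.g hs, contDiffAt_chartEnd σ.smooth_φ hs,
    contDiffAt_chartField σ.smooth_ξ hs, contDiffAt_chartForm σ.smooth_η hs,
    Filter.Eventually.of_forall fun z v w => σ.g.symm _ _ _,
    ht.mono fun z hz => chartMetric_posDef σ.g hz, ?_, ?_, ?_, ?_⟩
  · filter_upwards [ht] with z hz
    rw [chartForm_apply, chartFrame_chartField σ.ξ hz, σ.η_ξ]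
  · filter_upwards [ht] with z hz v
    apply chartFrame_injective hz
    rw [chartFrame_chartEnd σ.φ hz, chartFrame_chartEnd σ.φ hz, σ.φ_φ, map_add, map_neg, map_smul,
      chartFrame_chartField σ.ξ hz, chartForm_apply]
  · filter_upwards [ht] with z hz v w
    rw [chartMetric_apply, chartFrame_chartEnd σ.φ hz, chartFrame_chartEnd σ.φ hz, σ.compatible]
    rfl
  · filter_upwards [ht] with z hz v w
    -- The contact condition is given at chart centres only, so pass to the chart centred at the
    -- point with coordinates `z`.
    have hz' := mem_extChartAt_source (I := 𝓘(ℝ, E)) ((extChartAt 𝓘(ℝ, E) x).symm z)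
    rw [extDeriv_transition ((contDiffAt_transition hz hz').of_le (by norm_cast))
      ((contDiffAt_chartForm σ.smooth_η (transition_mem_target hz')).differentiableAt (by simp))
      ((contDiffAt_chartForm σ.smooth_η hz).differentiableAt (by simp))
      ((eventually_transition_source hz hz').mono fun t ht => chartForm_transition σ.η ht.1 ht.2),
      chartMetric_transition σ.g.inner hz hz', ← chartEnd_transition σ.φ hz hz']
    exact σ.contact _ _ _

/-- Normality is needed at the centre only: it is never differentiated, and the resulting `∇J = 0`
on the cone is transported afterwards. -/
theorem sasakianAt_chart (x : S) :
    SasakianAt (chartMetric 𝓘(ℝ, E) σ.g.inner x) (chartEnd 𝓘(ℝ, E) σ.φ x)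
      (chartField 𝓘(ℝ, E) σ.ξ x) (chartForm 𝓘(ℝ, E) σ.η x) (extChartAt 𝓘(ℝ, E) x x) :=
  ⟨contactMetricAt_chart σ (mem_extChartAt_target x), σ.normal x⟩

end ConeCharts

/-! ### Dependence on germs only -/

section Congruence

variable {E F : Type*} [NormedAddCommGroup E] [NormedSpace ℝ E] [NormedAddCommGroup F]
  [NormedSpace ℝ F] {G G' : E → E →L[ℝ] E →L[ℝ] ℝ} {H : F → F →L[ℝ] F →L[ℝ] ℝ} {u : E → F} {y : E}

theorem christoffel_congr (h : G =ᶠ[nhds y] G') : christoffel G y = christoffel G' y := by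
  ext v w
  rw [christoffel, christoffel, h.fderiv_eq, h.self_of_nhds]

theorem localCovDeriv_congr {A A' : E → E →L[ℝ] E} (h : G =ᶠ[nhds y] G') (hA : A =ᶠ[nhds y] A') :
    localCovDeriv G A y = localCovDeriv G' A' y := by
  ext v w
  rw [localCovDeriv, localCovDeriv, christoffel_congr h, hA.fderiv_eq, hA.self_of_nhds]

theorem AlmostHermitianAt.congr {A A' : E → E →L[ℝ] E} (hH : AlmostHermitianAt G A y)
    (h : G' =ᶠ[nhds y] G) (hA : A' =ᶠ[nhds y] A) : AlmostHermitianAt G' A' y := by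
  refine ⟨hH.contDiff_metric.congr_of_eventuallyEq h, hH.contDiff_end.congr_of_eventuallyEq hA,
    h.self_of_nhds ▸ hH.invertible, ?_, ?_, ?_⟩
  · filter_upwards [h, hH.symm] with z h1 h2
    rwa [h1]
  · filter_upwards [hA, hH.sq] with z h1 h2
    rwa [h1]
  · filter_upwards [h, hA, hH.isometry] with z h1 h2 h3
    rwa [h1, h2]

theorem tensionField_congr [FiniteDimensional ℝ E] (h : G =ᶠ[nhds y] G') :
    tensionField G H u =ᶠ[nhds y] tensionField G' H u := by
  filter_upwards [h.eventuallyEq_nhds] with z hz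
  have : secondFundamentalForm G H u z = secondFundamentalForm G' H u z := by
    ext v w
    rw [secondFundamentalForm, secondFundamentalForm, christoffel_congr hz]
  rw [tensionField, tensionField, this, hz.self_of_nhds]

theorem bitensionField_congr [FiniteDimensional ℝ E] (h : G =ᶠ[nhds y] G') :
    bitensionField G H u y = bitensionField G' H u y := by
  have ht := tensionField_congr (H := H) (u := u) h
  have h1 := fun w => pullbackDeriv_congr (H := H) (u := u) ht w
  have h2 := fun v w => (pullbackDeriv_congr (H := H) (u := u) (h1 w) v).self_of_nhds
  rw [bitensionField, bitensionField, roughLaplacian, roughLaplacian]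
  simp only [h2, (h1 _).self_of_nhds, christoffel_congr h, h.self_of_nhds, ht.self_of_nhds]

end Congruence

/-! ### Kähler property, radial and Reeb fields on the cone -/

section ConeGeometry

variable {E : Type*} [NormedAddCommGroup E] [NormedSpace ℝ E]
  {S : Type*} [TopologicalSpace S] [ChartedSpace E S]
  {p : Cone S} {y : ℝ × E}

theorem cone_center_fst (p : Cone S) : (extChartAt (coneModel E) p p).1 = (p.1 : ℝ) := by
  rw [extChartAt_cone_apply]

theorem cone_center_snd (p : Cone S) :
    (extChartAt (coneModel E) p p).2 = extChartAt 𝓘(ℝ, E) p.2 p.2 := by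
  rw [extChartAt_cone_apply]

theorem cone_center_ne_zero (p : Cone S) : (extChartAt (coneModel E) p p).1 ≠ 0 := by
  rw [cone_center_fst]
  exact ne_of_gt p.1.2

theorem radial_eventuallyEq (c : ℝ → ℝ) (hy : y ∈ (extChartAt (coneModel E) p).target) :
    (fun z => (fun q : Cone S => c q.1) ((extChartAt (coneModel E) p).symm z))
      =ᶠ[nhds y] fun z => c z.1 :=
  (target_mem_nhds hy).mono fun z hz => by
    change c ((extChartAt (coneModel E) p).symm z).1 = c z.1
    rw [cone_symm_fst hz]

theorem mfderiv_radial {c : ℝ → ℝ} (hc : DifferentiableAt ℝ c p.1) :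
    (mfderiv (coneModel E) 𝓘(ℝ, ℝ) (fun q : Cone S => c q.1) p : ℝ × E →L[ℝ] ℝ)
      = deriv c p.1 • ContinuousLinearMap.fst ℝ ℝ E := by
  refine HasMFDerivAt.mfderiv (I := coneModel E) (I' := 𝓘(ℝ, ℝ)) ⟨?_, ?_⟩
  · exact ContinuousAt.comp (f := fun q : Cone S => (q.1 : ℝ)) hc.continuousAt
      (continuous_subtype_val.comp continuous_fst).continuousAt
  · have hc' : DifferentiableAt ℝ c (extChartAt (coneModel E) p p).1 := by rwa [cone_center_fst]
    have h := hc'.hasDerivAt.comp_hasFDerivAt (extChartAt (coneModel E) p p)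
      (hasFDerivAt_fst (𝕜 := ℝ) (E := ℝ) (F := E))
    rw [cone_center_fst] at h
    have h' : HasFDerivAt (𝕜 := ℝ) (E := ℝ × E) (F := ℝ)
        (writtenInExtChartAt (coneModel E) 𝓘(ℝ, ℝ) p (fun q : Cone S => c q.1))
        (deriv c p.1 • ContinuousLinearMap.fst ℝ ℝ E) (extChartAt (coneModel E) p p) :=
      h.congr_of_eventuallyEq
        ((radial_eventuallyEq c (mem_extChartAt_target p)).mono fun z hz => hz)
    exact h'.hasFDerivWithinAt

variable [IsManifold 𝓘(ℝ, E) ∞ S]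

variable (σ : SasakianStructure E S)

theorem sasakianAt_cone_center (p : Cone S) :
    SasakianAt (chartMetric 𝓘(ℝ, E) σ.g.inner p.2) (chartEnd 𝓘(ℝ, E) σ.φ p.2)
      (chartField 𝓘(ℝ, E) σ.ξ p.2) (chartForm 𝓘(ℝ, E) σ.η p.2) (extChartAt (coneModel E) p p).2 := by
  rw [cone_center_snd]
  exact sasakianAt_chart σ p.2

theorem chartMetric_cone_eventuallyEq (hy : y ∈ (extChartAt (coneModel E) p).target) :
    chartMetric (coneModel E) σ.coneMetric p
      =ᶠ[nhds y] coneForm (chartMetric 𝓘(ℝ, E) σ.g.inner p.2) :=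
  (target_mem_nhds hy).mono fun _ hz => chartMetric_cone σ hz

theorem chartEnd_cone_eventuallyEq (hy : y ∈ (extChartAt (coneModel E) p).target) :
    chartEnd (coneModel E) σ.coneJ p =ᶠ[nhds y] coneEnd (chartEnd 𝓘(ℝ, E) σ.φ p.2)
      (chartField 𝓘(ℝ, E) σ.ξ p.2) (chartForm 𝓘(ℝ, E) σ.η p.2) :=
  (target_mem_nhds hy).mono fun _ hz => chartEnd_cone σ hz

theorem isAlmostHermitian_cone : IsAlmostHermitian (coneModel E) σ.coneMetric σ.coneJ := by
  have hξ : ∀ s : S, σ.φ s (σ.ξ s) = 0 := fun s =>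
    phi_xi (E := E) (φ := σ.φ s) (η := σ.η s) (σ.η_ξ s) (σ.φ_φ s)
  have aux : ∀ a b c : E, a = -c + b → a - b = -c := fun a b c h => by rw [h, add_sub_cancel_right]
  have hη : ∀ (s : S) (v : E), σ.η s (σ.φ s v) = 0 := fun s v =>
    eta_phi (E := E) (φ := σ.φ s) (η := σ.η s) (σ.η_ξ s) (σ.φ_φ s) v
  have hg : ∀ (s : S) (v : E), σ.g.inner s v (σ.ξ s) = σ.η s v := fun s v => by
    have := σ.compatible s v (σ.ξ s)
    rw [hξ, σ.η_ξ, map_zero] at this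
    linarith
  refine ⟨fun p (v : ℝ × E) => ?_, fun p (v w : ℝ × E) => ?_⟩
  · have hp : (p.1 : ℝ) ≠ 0 := ne_of_gt p.1.2
    rw [coneJ_apply]
    refine (coneJ_apply σ p _).trans ?_
    refine Prod.ext ?_ ?_
    · change (p.1 : ℝ) * σ.η p.2 (σ.φ p.2 v.2 - ((p.1 : ℝ)⁻¹ * v.1) • σ.ξ p.2) = -v.1
      rw [map_sub, map_smul, hη, σ.η_ξ, smul_eq_mul]
      field_simp
      ring
    · change σ.φ p.2 (σ.φ p.2 v.2 - ((p.1 : ℝ)⁻¹ * v.1) • σ.ξ p.2)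
        - ((p.1 : ℝ)⁻¹ * ((p.1 : ℝ) * σ.η p.2 v.2)) • σ.ξ p.2 = -v.2
      rw [map_sub, map_smul, hξ, inv_mul_cancel_left₀ hp, smul_zero, sub_zero]
      exact aux _ _ _ (σ.φ_φ p.2 v.2)
  · have hp : (p.1 : ℝ) ≠ 0 := ne_of_gt p.1.2
    rw [coneJ_apply, coneJ_apply]
    refine (coneMetric_apply σ p _ _).trans (Eq.trans ?_ (coneMetric_apply σ p v w).symm)
    have e1 := σ.compatible p.2 v.2 w.2
    have e2 : σ.g.inner p.2 (σ.φ p.2 v.2) (σ.ξ p.2) = 0 := (hg _ _).trans (hη _ _)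
    have e3 : σ.g.inner p.2 (σ.ξ p.2) (σ.φ p.2 w.2) = 0 :=
      (σ.g.symm _ _ _).trans ((hg _ _).trans (hη _ _))
    have e4 : σ.g.inner p.2 (σ.ξ p.2) (σ.ξ p.2) = 1 := (hg _ _).trans (σ.η_ξ _)
    change ((p.1 : ℝ) * σ.η p.2 v.2) * ((p.1 : ℝ) * σ.η p.2 w.2) + (p.1 : ℝ) ^ 2 * σ.g.inner p.2
      (σ.φ p.2 v.2 - ((p.1 : ℝ)⁻¹ * v.1) • σ.ξ p.2) (σ.φ p.2 w.2 - ((p.1 : ℝ)⁻¹ * w.1) • σ.ξ p.2) = _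
    rw [map_sub, map_sub, map_smul, map_smul]
    simp only [sub_apply, smul_apply, smul_eq_mul]
    rw [e1, e2, e3, e4]
    field_simp
    ring

/-- The Lie derivative of `J` along `F ∂_r` is `F - rF'` times a tensor that vanishes nowhere. -/
theorem isHolomorphicField_radial_iff [Nonempty S] {F : ℝ → ℝ}
    (hF : ∀ r, 0 < r → DifferentiableAt ℝ F r) :
    IsHolomorphicField (coneModel E) σ.coneJ (fun q : Cone S => ((F q.1, 0) : ℝ × E))
      ↔ ∀ r, 0 < r → F r = r * deriv F r := by
  have key : ∀ (p : Cone S) (v : ℝ × E),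
      fderiv ℝ (chartEnd (coneModel E) σ.coneJ p) (extChartAt (coneModel E) p p)
          (chartField (coneModel E) (fun q : Cone S => ((F q.1, 0) : ℝ × E)) p
            (extChartAt (coneModel E) p p)) v
        - fderiv ℝ (chartField (coneModel E) (fun q : Cone S => ((F q.1, 0) : ℝ × E)) p)
          (extChartAt (coneModel E) p p)
          (chartEnd (coneModel E) σ.coneJ p (extChartAt (coneModel E) p p) v)
        + chartEnd (coneModel E) σ.coneJ p (extChartAt (coneModel E) p p)
          (fderiv ℝ (chartField (coneModel E) (fun q : Cone S => ((F q.1, 0) : ℝ × E)) p)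
            (extChartAt (coneModel E) p p) v)
      = ((F p.1 - p.1 * deriv F p.1)
            * chartForm 𝓘(ℝ, E) σ.η p.2 (extChartAt (coneModel E) p p).2 v.2,
          ((F p.1 - p.1 * deriv F p.1) * v.1 * ((p.1 : ℝ) ^ 2)⁻¹)
            • chartField 𝓘(ℝ, E) σ.ξ p.2 (extChartAt (coneModel E) p p).2) := by
    intro p v
    have hy := mem_extChartAt_target (I := coneModel E) p
    have hm := chartEnd_cone_eventuallyEq σ hy
    have hX : chartField (coneModel E) (fun q : Cone S => ((F q.1, 0) : ℝ × E)) p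
        =ᶠ[nhds (extChartAt (coneModel E) p p)] fun z => (F z.1, 0) :=
      (target_mem_nhds hy).mono fun z hz => chartField_cone_radial F hz
    have hs := sasakianAt_cone_center σ p
    have hp : (p.1 : ℝ) ≠ 0 := ne_of_gt p.1.2
    have hF' : DifferentiableAt ℝ F (extChartAt (coneModel E) p p).1 :=
      hF _ (by rw [cone_center_fst]; exact p.1.2)
    have hd := ((hF'.hasDerivAt.comp_hasFDerivAt (extChartAt (coneModel E) p p)
        (hasFDerivAt_fst (𝕜 := ℝ) (E := ℝ) (F := E))).prodMk
          (hasFDerivAt_const (0 : E) (extChartAt (coneModel E) p p))).fderiv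
    simp only [Function.comp_def] at hd
    rw [hm.fderiv_eq, hX.fderiv_eq, hX.self_of_nhds, hm.self_of_nhds, hd]
    simp only [coneEnd_apply, fderiv_coneEnd hs.smooth_φ hs.smooth_ξ hs.smooth_η
      (cone_center_ne_zero p)]
    simp only [extChartAt_cone_apply]
    refine Prod.ext ?_ ?_
    · simp
      ring
    · simp
      match_scalars
      field_simp
      ring
  constructor
  · intro h r hr
    obtain ⟨s⟩ := ‹Nonempty S›
    have hs := sasakianAt_cone_center σ ((⟨r, hr⟩, s) : Cone S)
    -- Testing on `ξ`, where `η = 1`, isolates the factor `F - rF'`.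
    have h1 := h (⟨r, hr⟩, s) (0, chartField 𝓘(ℝ, E) σ.ξ s
      (extChartAt (coneModel E) ((⟨r, hr⟩, s) : Cone S) (⟨r, hr⟩, s)).2)
    dsimp only at h1
    rw [key] at h1
    have h2 := congrArg Prod.fst h1
    dsimp only at h2
    rw [hs.η_ξ.self_of_nhds, mul_one] at h2
    exact sub_eq_zero.mp h2
  · intro h p v
    dsimp only
    rw [key, sub_eq_zero.mpr (h _ p.1.2)]
    simp

variable [FiniteDimensional ℝ E]

theorem almostHermitianAt_cone_chart (hy : y ∈ (extChartAt (coneModel E) p).target) :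
    AlmostHermitianAt (chartMetric (coneModel E) σ.coneMetric p)
      (chartEnd (coneModel E) σ.coneJ p) y := by
  have h := (contactMetricAt_chart σ (mem_cone_target.1 hy).2).almostHermitianAt_cone
    (z := y) (ne_of_gt (mem_cone_target.1 hy).1)
  exact h.congr (chartMetric_cone_eventuallyEq σ hy) (chartEnd_cone_eventuallyEq σ hy)

/-- The cone over a Sasakian manifold is Kähler. -/
theorem isKahler_cone : IsKahler (coneModel E) σ.coneMetric σ.coneJ := by
  refine ⟨isAlmostHermitian_cone σ, fun x v w => ?_⟩
  change localCovDeriv _ _ _ _ _ = 0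
  rw [localCovDeriv_congr (chartMetric_cone_eventuallyEq σ (mem_extChartAt_target x))
    (chartEnd_cone_eventuallyEq σ (mem_extChartAt_target x))]
  exact (sasakianAt_cone_center σ x).localCovDeriv_cone (cone_center_ne_zero x) v w

theorem riemGrad_radial {c : ℝ → ℝ} (hc : DifferentiableAt ℝ c p.1) :
    (riemGrad (coneModel E) σ.coneMetric (fun q : Cone S => c q.1) p : ℝ × E)
      = (deriv c p.1, 0) := by
  have hp : (p.1 : ℝ) ≠ 0 := ne_of_gt p.1.2
  have hpos : ∀ v : ℝ × E, v ≠ 0 → 0 < (σ.coneMetric p : (ℝ × E) →L[ℝ] (ℝ × E) →L[ℝ] ℝ) v v :=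
    fun v hv => (coneForm_posDef (E := E) (G := fun _ => (σ.g.inner p.2 : E →L[ℝ] E →L[ℝ] ℝ))
      (z := ((p.1 : ℝ), 0)) hp (fun v : E => σ.g.pos p.2 v) v hv).trans_eq (coneForm_apply _ _ _ _)
  refine sharp_eq (E := ℝ × E) (isInvertible_of_posDef hpos) fun w => ?_
  have h := DFunLike.congr_fun (mfderiv_radial (p := p) hc) w
  refine Eq.trans ?_ h.symm
  refine (coneMetric_apply σ p _ _).trans ?_
  have hz : ∀ B : E →L[ℝ] E →L[ℝ] ℝ, B 0 w.2 = 0 := fun B => by simp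
  exact (congrArg (fun t => deriv c p.1 * w.1 + (p.1 : ℝ) ^ 2 * t) (hz (σ.g.inner p.2))).trans
    (by rw [mul_zero, add_zero]; rfl)

theorem conformalOperator_radial {n : ℕ} (hn : Module.finrank ℝ E + 1 = 2 * n) {c : ℝ → ℝ}
    (hc : ContDiffAt ℝ 2 c p.1) :
    conformalOperator (coneModel E) n σ.coneMetric (fun q : Cone S => c q.1) p
      = deriv (deriv c) p.1 + (2 * (n : ℝ) - 1) * (deriv c p.1 / p.1)
        + ((n : ℝ) - 1) * deriv c p.1 ^ 2 := by
  have hn' : (Module.finrank ℝ E : ℝ) = 2 * n - 1 := by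
    have : ((Module.finrank ℝ E + 1 : ℕ) : ℝ) = ((2 * n : ℕ) : ℝ) := by rw [hn]
    push_cast at this
    linarith
  have hs := sasakianAt_cone_center σ p
  have hy := mem_extChartAt_target (I := coneModel E) p
  have hc' : ContDiffAt ℝ 2 c (extChartAt (coneModel E) p p).1 := by rwa [cone_center_fst]
  have h1 : laplaceBeltrami (coneModel E) σ.coneMetric (fun q : Cone S => c q.1) p
      = deriv (deriv c) p.1 + (2 * (n : ℝ) - 1) * (deriv c p.1 / p.1) := by
    have hl := laplacian_radial hs.smooth_metric (cone_center_ne_zero p) hs.pos.self_of_nhds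
      hs.symm.self_of_nhds hc'
    rw [hn', cone_center_fst] at hl
    rw [← hl, laplaceBeltrami]
    have hr := radial_eventuallyEq (E := E) (p := p) c hy
    have hr2 : fderiv ℝ (fun z => (fun q : Cone S => c q.1) ((extChartAt (coneModel E) p).symm z))
        =ᶠ[nhds (extChartAt (coneModel E) p p)] fderiv ℝ (fun z : ℝ × E => c z.1) := by
      filter_upwards [hr.eventuallyEq_nhds] with z hz
      exact hz.fderiv_eq
    have hm := chartMetric_cone_eventuallyEq σ hy
    dsimp only at hr hr2 ⊢
    rw [hr2.fderiv_eq, hr.fderiv_eq, christoffel_congr hm, hm.self_of_nhds]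
  have h2 : σ.coneMetric p (riemGrad (coneModel E) σ.coneMetric (fun q : Cone S => c q.1) p)
      (riemGrad (coneModel E) σ.coneMetric (fun q : Cone S => c q.1) p) = deriv c p.1 ^ 2 := by
    refine (coneMetric_apply σ p _ _).trans ?_
    rw [riemGrad_radial σ (hc.differentiableAt (by simp))]
    change deriv c p.1 * deriv c p.1 + (p.1 : ℝ) ^ 2 * (σ.g.inner p.2 : E →L[ℝ] E →L[ℝ] ℝ) 0 0
      = deriv c p.1 ^ 2
    rw [map_zero, mul_zero, add_zero, sq]
  rw [conformalOperator, h1, h2]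

/-- As `ξ` is Killing, only the derivative of `F` contributes: `L_{Fξ} ĝ = r²F' (dr ⊗ η + η ⊗ dr)`.
Evaluating on `∂_r` and `ξ` recovers `F'`. -/
theorem isKilling_xi_iff [Nonempty S] {F : ℝ → ℝ} (hF : ∀ r, 0 < r → DifferentiableAt ℝ F r) :
    IsKilling (coneModel E) σ.coneMetric (fun q : Cone S => ((0, F q.1 • σ.ξ q.2) : ℝ × E))
      ↔ ∀ r, 0 < r → deriv F r = 0 := by
  have key : ∀ (p : Cone S) (v w : ℝ × E),
      fderiv ℝ (chartMetric (coneModel E) σ.coneMetric p) (extChartAt (coneModel E) p p)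
          (chartField (coneModel E) (fun q : Cone S => ((0, F q.1 • σ.ξ q.2) : ℝ × E)) p
            (extChartAt (coneModel E) p p)) v w
        + chartMetric (coneModel E) σ.coneMetric p (extChartAt (coneModel E) p p)
          (fderiv ℝ (chartField (coneModel E)
            (fun q : Cone S => ((0, F q.1 • σ.ξ q.2) : ℝ × E)) p) (extChartAt (coneModel E) p p) v) w
        + chartMetric (coneModel E) σ.coneMetric p (extChartAt (coneModel E) p p) v
          (fderiv ℝ (chartField (coneModel E)
            (fun q : Cone S => ((0, F q.1 • σ.ξ q.2) : ℝ × E)) p) (extChartAt (coneModel E) p p) w)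
      = (p.1 : ℝ) ^ 2 * deriv F p.1
          * (v.1 * chartForm 𝓘(ℝ, E) σ.η p.2 (extChartAt (coneModel E) p p).2 w.2
            + w.1 * chartForm 𝓘(ℝ, E) σ.η p.2 (extChartAt (coneModel E) p p).2 v.2) := by
    intro p v w
    have hy := mem_extChartAt_target (I := coneModel E) p
    have hm := chartMetric_cone_eventuallyEq σ hy
    have hX : chartField (coneModel E) (fun q : Cone S => ((0, F q.1 • σ.ξ q.2) : ℝ × E)) p
        =ᶠ[nhds (extChartAt (coneModel E) p p)]
          fun z => (0, F z.1 • chartField 𝓘(ℝ, E) σ.ξ p.2 z.2) :=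
      (target_mem_nhds hy).mono fun z hz => chartField_cone_xi σ F hz
    have hs := sasakianAt_cone_center σ p
    have hF' : DifferentiableAt ℝ F (extChartAt (coneModel E) p p).1 :=
      hF _ (by rw [cone_center_fst]; exact p.1.2)
    have hd := ((hasFDerivAt_const (0 : ℝ) (extChartAt (coneModel E) p p)).prodMk
      ((hF'.hasDerivAt.comp_hasFDerivAt (extChartAt (coneModel E) p p)
        (hasFDerivAt_fst (𝕜 := ℝ) (E := ℝ) (F := E))).smul
          (hasFDerivAt_comp_snd (hs.smooth_ξ.differentiableAt (by simp))))).fderiv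
    simp only [Function.comp_def, Pi.smul_def'] at hd
    rw [hm.fderiv_eq, hX.fderiv_eq, hX.self_of_nhds, hm.self_of_nhds, hd]
    simp only [coneForm_apply, fderiv_coneForm hs.smooth_metric]
    have e1 := hs.lie_xi_metric v.2 w.2
    have e2 := hs.metric_xi.self_of_nhds
    have e3 := hs.symm.self_of_nhds
    simp only [ContinuousLinearMap.prod_apply, add_apply,
      smul_apply, ContinuousLinearMap.smulRight_apply,
      ContinuousLinearMap.comp_apply, ContinuousLinearMap.coe_fst', ContinuousLinearMap.coe_snd',
      zero_apply, map_add, map_smul, smul_eq_mul,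
      e2, e3 (chartField 𝓘(ℝ, E) σ.ξ p.2 (extChartAt (coneModel E) p p).2), cone_center_fst]
    linear_combination (p.1 : ℝ) ^ 2 * F p.1 * e1
  constructor
  · intro h r hr
    obtain ⟨s⟩ := ‹Nonempty S›
    have hs := sasakianAt_cone_center σ ((⟨r, hr⟩, s) : Cone S)
    have h1 := h (⟨r, hr⟩, s) (1, 0) (0, chartField 𝓘(ℝ, E) σ.ξ s
      (extChartAt (coneModel E) ((⟨r, hr⟩, s) : Cone S) (⟨r, hr⟩, s)).2)
    dsimp only at h1
    rw [key] at h1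
    rw [hs.η_ξ.self_of_nhds] at h1
    have h2 : r ^ 2 * deriv F r = 0 := by linear_combination h1
    exact (mul_eq_zero.mp h2).resolve_left (pow_ne_zero 2 hr.ne')
  · intro h p v w
    dsimp only
    rw [key, h _ p.1.2]
    ring

end ConeGeometry

/-! ### Ordinary differential equations for radial functions -/

section RadialEquations

/-- With `a = n - 3` the function is the coefficient of `ξ` in `J(e^{(n-3)γ} grad γ)`. The
derivative is factored so that a positive factor splits off the Killing equation. -/
theorem hasDerivAt_twistedFlux {c : ℝ → ℝ} (a : ℝ) {r : ℝ} (hr : 0 < r) (hc : ContDiffAt ℝ 2 c r) :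
    HasDerivAt (fun t => -(t⁻¹ * (Real.exp (a * c t) * deriv c t)))
      (r⁻¹ * Real.exp (a * c r) * (deriv c r / r - a * deriv c r ^ 2 - deriv (deriv c) r)) r := by
  have h1 := (hc.differentiableAt (by simp)).hasDerivAt
  have h2 : HasDerivAt (deriv c) (deriv (deriv c) r) r :=
    (((hc.fderiv_right (m := 1) (by norm_num)).differentiableAt (by simp)).clm_apply
      (differentiableAt_const (1 : ℝ))).hasDerivAt
  refine ((hasDerivAt_inv hr.ne').mul ((h1.const_mul a).exp.mul h2)).neg.congr_deriv ?_
  rw [Pi.mul_apply]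
  field_simp
  ring

theorem eqOn_const_of_deriv_eq_zero {f : ℝ → ℝ} (hf : ∀ r, 0 < r → HasDerivAt f 0 r) :
    ∃ k, ∀ r, 0 < r → f r = k := by
  obtain ⟨k, hk⟩ := isOpen_Ioi.exists_is_const_of_deriv_eq_zero (s := Set.Ioi (0 : ℝ)) (f := f)
    (convex_Ioi 0).isPreconnected
    (fun r hr => (hf r hr).differentiableAt.differentiableWithinAt) (fun r hr => (hf r hr).deriv)
  exact ⟨k, fun r hr => hk r hr⟩

theorem hasDerivAt_neg_log_sq {r : ℝ} (hr : r ≠ 0) :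
    HasDerivAt (fun t : ℝ => -Real.log (t ^ 2)) (-(2 / r)) r := by
  refine ((hasDerivAt_pow 2 r).log (pow_ne_zero 2 hr)).neg.congr_deriv ?_
  field_simp
  simp [mul_comm]

theorem deriv_eq_of_eqOn {c d : ℝ → ℝ} (h : ∀ r, 0 < r → c r = d r) {r : ℝ} (hr : 0 < r) :
    deriv c r = deriv d r :=
  Filter.EventuallyEq.deriv_eq ((eventually_gt_nhds hr).mono h)

theorem deriv_neg_log_sq {c : ℝ → ℝ} {k : ℝ} (hc : ∀ r, 0 < r → c r = -Real.log (r ^ 2) + k)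
    {r : ℝ} (hr : 0 < r) : deriv c r = -(2 / r) := by
  rw [deriv_eq_of_eqOn hc hr]
  exact ((hasDerivAt_neg_log_sq hr.ne').add_const k).deriv

theorem deriv_deriv_neg_log_sq {c : ℝ → ℝ} {k : ℝ}
    (hc : ∀ r, 0 < r → c r = -Real.log (r ^ 2) + k) {r : ℝ} (hr : 0 < r) :
    deriv (deriv c) r = 2 / r ^ 2 := by
  rw [deriv_eq_of_eqOn (fun t ht => deriv_neg_log_sq hc ht) hr]
  refine ((((hasDerivAt_inv hr.ne').const_mul 2).neg.congr_of_eventuallyEq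
    (Filter.Eventually.of_forall fun t => ?_)).congr_deriv ?_).deriv
  · simp [div_eq_mul_inv]
  · field_simp

/-- The solutions of the two radial equations of the cone. -/
theorem radial_solutions {n : ℕ} (hn : 2 ≤ n) {c : ℝ → ℝ} (hc : ∀ r, 0 < r → ContDiffAt ℝ 2 c r)
    (h1 : ∀ r, 0 < r → deriv (deriv c) r = deriv c r / r - ((n : ℝ) - 3) * deriv c r ^ 2)
    (h2 : ∀ r, 0 < r → deriv (deriv c) r + (2 * (n : ℝ) - 1) * (deriv c r / r)
      + ((n : ℝ) - 1) * deriv c r ^ 2 = 0) :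
    (∃ k : ℝ, ∀ r : ℝ, 0 < r → c r = k) ∨
      (n = 2 ∧ ∃ k : ℝ, ∀ r : ℝ, 0 < r → c r = -Real.log (r ^ 2) + k) := by
  have hd : ∀ r, 0 < r → HasDerivAt c (deriv c r) r := fun r hr =>
    ((hc r hr).differentiableAt (by simp)).hasDerivAt
  -- The first equation says that this flux is constant. It is a nowhere vanishing multiple of `c'`,
  -- so `c'` vanishes everywhere or nowhere.
  obtain ⟨K, hK⟩ := eqOn_const_of_deriv_eq_zero
    (f := fun t => -(t⁻¹ * (Real.exp (((n : ℝ) - 3) * c t) * deriv c t))) fun r hr => by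
      refine (hasDerivAt_twistedFlux ((n : ℝ) - 3) hr (hc r hr)).congr_deriv ?_
      rw [h1 r hr]
      ring
  by_cases hK0 : K = 0
  · refine Or.inl (eqOn_const_of_deriv_eq_zero fun r hr => ?_)
    have h := hK r hr
    rw [hK0, neg_eq_zero] at h
    have h0 : deriv c r = 0 :=
      (mul_eq_zero.mp ((mul_eq_zero.mp h).resolve_left (inv_ne_zero hr.ne'))).resolve_left
        (Real.exp_ne_zero _)
    exact h0 ▸ hd r hr
  · have hc0 : ∀ r, 0 < r → deriv c r ≠ 0 := fun r hr h0 => hK0 (by rw [← hK r hr, h0]; simp)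
    have hcn : ∀ r, 0 < r → deriv c r = -(n * r⁻¹) := fun r hr => by
      have h3 := h2 r hr
      rw [h1 r hr] at h3
      -- Eliminating `c''` between the two equations leaves `2c'(c' + n/r) = 0`.
      have h4 : deriv c r * (deriv c r + n * r⁻¹) = 0 := by
        rw [div_eq_mul_inv] at h3
        linear_combination h3 / 2
      exact eq_neg_of_add_eq_zero_left ((mul_eq_zero.mp h4).resolve_left (hc0 r hr))
    have hcc : deriv (deriv c) 1 = n := by
      rw [deriv_eq_of_eqOn hcn one_pos]
      exact (((hasDerivAt_inv (one_ne_zero (α := ℝ))).const_mul (n : ℝ)).neg.congr_deriv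
        (by norm_num)).deriv
    have h3 := h1 1 one_pos
    rw [hcc, hcn 1 one_pos] at h3
    have hn0 : (n : ℝ) ≠ 0 := by positivity
    -- For `c' = -n/r` the first equation at `r = 1` reads `n = -n - (n - 3)n²`.
    have h4 : (n : ℝ) * (((n : ℝ) - 1) * ((n : ℝ) - 2)) = 0 := by
      rw [inv_one, div_one] at h3
      linear_combination h3
    have hn1 : (n : ℝ) - 1 ≠ 0 := by
      have : (2 : ℝ) ≤ n := by exact_mod_cast hn
      linarith
    have hn2 : (n : ℝ) = 2 := by
      have := (mul_eq_zero.mp ((mul_eq_zero.mp h4).resolve_left hn0)).resolve_left hn1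
      linarith
    refine Or.inr ⟨by exact_mod_cast hn2, ?_⟩
    obtain ⟨k, hk⟩ := eqOn_const_of_deriv_eq_zero (f := fun t => c t - -Real.log (t ^ 2))
      fun r hr => by
        refine ((hd r hr).sub (hasDerivAt_neg_log_sq hr.ne')).congr_deriv ?_
        rw [hcn r hr, hn2]
        field_simp
        ring
    exact ⟨k, fun r hr => by linarith [hk r hr]⟩

end RadialEquations

/-! ### Killing and holomorphic fields from radial functions -/

section RadialFields

variable {E : Type*} [NormedAddCommGroup E] [NormedSpace ℝ E] [FiniteDimensional ℝ E]
  {S : Type*} [TopologicalSpace S] [ChartedSpace E S] [IsManifold 𝓘(ℝ, E) ∞ S]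
  (σ : SasakianStructure E S)

/-- Combine `grad γ = γ' ∂_r` with `J ∂_r = -ξ/r`. -/
theorem twistedGradient_radial (n : ℕ) {c : ℝ → ℝ} (hc : ∀ r, 0 < r → DifferentiableAt ℝ c r) :
    twistedGradient (coneModel E) n σ.coneMetric σ.coneJ (fun q : Cone S => c q.1)
      = fun q : Cone S => ((0, (-((q.1 : ℝ)⁻¹ * (Real.exp (((n : ℝ) - 3) * c q.1) * deriv c q.1)))
          • σ.ξ q.2) : ℝ × E) := by
  funext p
  rw [twistedGradient, riemGrad_radial σ (hc _ p.1.2)]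
  refine (coneJ_apply σ p _).trans ?_
  have h1 : ∀ A : E →L[ℝ] ℝ, (p.1 : ℝ) * A (Real.exp (((n : ℝ) - 3) * c p.1) • (0 : E)) = 0 :=
    fun A => by simp
  have h2 : ∀ (A : E →L[ℝ] E) (v : E), A (Real.exp (((n : ℝ) - 3) * c p.1) • (0 : E))
      - ((p.1 : ℝ)⁻¹ * (Real.exp (((n : ℝ) - 3) * c p.1) * deriv c p.1)) • v
      = (-((p.1 : ℝ)⁻¹ * (Real.exp (((n : ℝ) - 3) * c p.1) * deriv c p.1))) • v :=
    fun A v => by rw [smul_zero, map_zero, zero_sub, neg_smul]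
  exact Prod.ext (h1 (σ.η p.2)) (h2 (σ.φ p.2) (σ.ξ p.2))

theorem isKilling_twistedGradient_iff [Nonempty S] (n : ℕ) {c : ℝ → ℝ}
    (hc : ∀ r, 0 < r → ContDiffAt ℝ 2 c r) :
    IsKilling (coneModel E) σ.coneMetric
        (twistedGradient (coneModel E) n σ.coneMetric σ.coneJ (fun q : Cone S => c q.1))
      ↔ ∀ r, 0 < r → deriv (deriv c) r = deriv c r / r - ((n : ℝ) - 3) * deriv c r ^ 2 := by
  have hF := fun r hr => hasDerivAt_twistedFlux ((n : ℝ) - 3) hr (hc r hr)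
  rw [twistedGradient_radial σ n fun r hr => (hc r hr).differentiableAt (by simp)]
  refine (isKilling_xi_iff σ fun r hr => (hF r hr).differentiableAt).trans
    (forall₂_congr fun r hr => ?_)
  have h0 : r⁻¹ * Real.exp (((n : ℝ) - 3) * c r) ≠ 0 :=
    mul_ne_zero (inv_ne_zero hr.ne') (Real.exp_ne_zero _)
  rw [(hF r hr).deriv, mul_eq_zero, or_iff_right h0, sub_eq_zero, eq_comm]

theorem isKilling_twistedGradient_log_iff [Nonempty S] (n : ℕ) :
    IsKilling (coneModel E) σ.coneMetric (twistedGradient (coneModel E) n σ.coneMetric σ.coneJ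
      (fun q : Cone S => -Real.log ((q.1 : ℝ) ^ 2))) ↔ n = 2 := by
  have hk : ∀ r : ℝ, 0 < r → (fun t : ℝ => -Real.log (t ^ 2)) r = -Real.log (r ^ 2) + 0 :=
    fun r _ => (add_zero _).symm
  refine (isKilling_twistedGradient_iff σ n (c := fun t => -Real.log (t ^ 2)) fun r hr =>
    ((contDiffAt_id.pow 2).log (pow_ne_zero 2 hr.ne')).neg).trans ?_
  have h : ∀ r, 0 < r → (deriv (deriv fun t : ℝ => -Real.log (t ^ 2)) r
      = deriv (fun t : ℝ => -Real.log (t ^ 2)) r / r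
        - ((n : ℝ) - 3) * deriv (fun t : ℝ => -Real.log (t ^ 2)) r ^ 2 ↔ n = 2) := by
    intro r hr
    rw [deriv_deriv_neg_log_sq hk hr, deriv_neg_log_sq hk hr]
    field_simp
    refine ⟨fun h => ?_, fun h => ?_⟩
    · have : (n : ℝ) = 2 := by linarith
      exact_mod_cast this
    · rw [h]
      norm_num
  exact ⟨fun h' => (h 1 one_pos).1 (h' 1 one_pos), fun h' r hr => (h r hr).2 h'⟩

theorem conformalOperator_log {n : ℕ} (hn : Module.finrank ℝ E + 1 = 2 * n) {c : ℝ → ℝ} {k : ℝ}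
    (hc : ∀ r, 0 < r → c r = -Real.log (r ^ 2) + k) (p : Cone S) :
    conformalOperator (coneModel E) n σ.coneMetric (fun q : Cone S => c q.1) p = 0 := by
  have hp : 0 < (p.1 : ℝ) := p.1.2
  have hs : ContDiffAt ℝ 2 c p.1 :=
    ((((contDiffAt_id.pow 2).log (pow_ne_zero 2 hp.ne')).neg).add contDiffAt_const
      : ContDiffAt ℝ 2 (fun t : ℝ => -Real.log (t ^ 2) + k) p.1).congr_of_eventuallyEq
        ((eventually_gt_nhds hp).mono hc)
  rw [conformalOperator_radial σ hn hs, deriv_deriv_neg_log_sq hc hp, deriv_neg_log_sq hc hp]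
  field_simp
  ring

/-- With `m = 6 - 2n` the gradient is `m r^{m-1} ∂_r`, and `F = rF'` asks for degree one, so `m =
2`. The case `n = 3` is excluded because there `m = 0` and the gradient is zero. -/
theorem isHolomorphicField_grad_zpow_iff [Nonempty S] {n : ℕ} (hn : n ≠ 3) :
    IsHolomorphicField (coneModel E) σ.coneJ (riemGrad (coneModel E) σ.coneMetric
      (fun q : Cone S => (q.1 : ℝ) ^ (6 - 2 * (n : ℤ)))) ↔ n = 2 := by
  set m : ℤ := 6 - 2 * (n : ℤ) with hm
  have hd : ∀ (k : ℤ) (r : ℝ), 0 < r → HasDerivAt (fun t : ℝ => t ^ k) (k * r ^ (k - 1)) r :=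
    fun k r hr => hasDerivAt_zpow k r (Or.inl hr.ne')
  have hg : riemGrad (coneModel E) σ.coneMetric (fun q : Cone S => (q.1 : ℝ) ^ m)
      = fun q : Cone S => (((m : ℝ) * (q.1 : ℝ) ^ (m - 1), 0) : ℝ × E) := by
    funext p
    refine (riemGrad_radial σ (c := fun t => t ^ m) (hd m _ p.1.2).differentiableAt).trans ?_
    rw [(hd m _ p.1.2).deriv]
  have hd' := fun r (hr : 0 < r) => (hd (m - 1) r hr).const_mul (m : ℝ)
  rw [hg, isHolomorphicField_radial_iff σ (F := fun t => (m : ℝ) * t ^ (m - 1)) fun r hr =>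
    (hd' r hr).differentiableAt]
  have h : ∀ r : ℝ, 0 < r → ((m : ℝ) * r ^ (m - 1)
      = r * deriv (fun t => (m : ℝ) * t ^ (m - 1)) r ↔ n = 2) := by
    intro r hr
    have hm0 : m ≠ 0 := by omega
    have h1 : r * r ^ (m - 1 - 1) = r ^ (m - 1) := by
      rw [← zpow_one_add₀ hr.ne']
      ring_nf
    have h2 : r * ((m : ℝ) * (((m - 1 : ℤ) : ℝ) * r ^ (m - 1 - 1)))
        = (m : ℝ) * r ^ (m - 1) * ((m - 1 : ℤ) : ℝ) := by
      rw [← h1]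
      ring
    rw [(hd' r hr).deriv, h2, left_eq_mul₀ (mul_ne_zero (by exact_mod_cast hm0)
      (zpow_ne_zero _ hr.ne'))]
    norm_cast
    omega
  exact ⟨fun h' => (h 1 one_pos).1 (h' 1 one_pos), fun h' r hr => (h r hr).2 h'⟩

theorem killing_and_conformal_iff [Nonempty S] {n : ℕ} (hn : Module.finrank ℝ E + 1 = 2 * n)
    (hn2 : 2 ≤ n) {c : ℝ → ℝ} (hc : ∀ r, 0 < r → ContDiffAt ℝ 2 c r) :
    (IsKilling (coneModel E) σ.coneMetric
          (twistedGradient (coneModel E) n σ.coneMetric σ.coneJ (fun q : Cone S => c q.1)) ∧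
        ∀ p : Cone S,
          conformalOperator (coneModel E) n σ.coneMetric (fun q : Cone S => c q.1) p = 0) ↔
      ((∃ k : ℝ, ∀ r : ℝ, 0 < r → c r = k) ∨
        (n = 2 ∧ ∃ k : ℝ, ∀ r : ℝ, 0 < r → c r = -Real.log (r ^ 2) + k)) := by
  rw [isKilling_twistedGradient_iff σ n hc]
  constructor
  · rintro ⟨h1, h2⟩
    obtain ⟨s⟩ := ‹Nonempty S›
    exact radial_solutions hn2 hc h1 fun r hr =>
      (conformalOperator_radial σ hn (p := (⟨r, hr⟩, s)) (hc r hr)).symm.trans (h2 _)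
  · rintro (⟨k, hk⟩ | ⟨rfl, k, hk⟩)
    · have e1 : ∀ r, 0 < r → deriv c r = 0 := fun r hr => by
        rw [deriv_eq_of_eqOn hk hr, deriv_const]
      have e2 : ∀ r, 0 < r → deriv (deriv c) r = 0 := fun r hr => by
        rw [deriv_eq_of_eqOn e1 hr, deriv_const]
      refine ⟨fun r hr => by rw [e1 r hr, e2 r hr]; simp, fun p => ?_⟩
      rw [conformalOperator_radial σ hn (hc _ p.1.2), e1 _ p.1.2, e2 _ p.1.2]
      simp
    · refine ⟨fun r hr => ?_, conformalOperator_log σ hn hk⟩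
      rw [deriv_deriv_neg_log_sq hk hr, deriv_neg_log_sq hk hr]
      field_simp
      norm_num

end RadialFields

/-! ### Holomorphic maps in charts -/

section LocalExpressions

variable {E : Type*} [NormedAddCommGroup E] [NormedSpace ℝ E]
  {H : Type*} [TopologicalSpace H] {I : ModelWithCorners ℝ E H}
  {M : Type*} [TopologicalSpace M] [ChartedSpace H M]
  {F : Type*} [NormedAddCommGroup F] [NormedSpace ℝ F]
  {H' : Type*} [TopologicalSpace H'] {I' : ModelWithCorners ℝ F H'}
  {N : Type*} [TopologicalSpace N] [ChartedSpace H' N]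
  {f : M → N} {x : M} {y : E}

theorem symm_writtenInExtChartAt
    (hfy : f ((extChartAt I x).symm y) ∈ (extChartAt I' (f x)).source) :
    (extChartAt I' (f x)).symm (writtenInExtChartAt I I' x f y) = f ((extChartAt I x).symm y) :=
  (extChartAt I' (f x)).left_inv hfy

theorem writtenInExtChartAt_mem_target
    (hfy : f ((extChartAt I x).symm y) ∈ (extChartAt I' (f x)).source) :
    writtenInExtChartAt I I' x f y ∈ (extChartAt I' (f x)).target :=
  (extChartAt I' (f x)).map_source hfy

variable [I.Boundaryless]

theorem eventually_mem_source (hf : Continuous f) (hy : y ∈ (extChartAt I x).target)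
    (hfy : f ((extChartAt I x).symm y) ∈ (extChartAt I' (f x)).source) :
    ∀ᶠ z in nhds y, f ((extChartAt I x).symm z) ∈ (extChartAt I' (f x)).source := by
  have h : ContinuousAt (fun z => f ((extChartAt I x).symm z)) y :=
    hf.continuousAt.comp ((continuousOn_extChartAt_symm x).continuousAt (target_mem_nhds hy))
  exact h.eventually_mem ((isOpen_extChartAt_source (f x)).mem_nhds hfy)

variable [IsManifold I ∞ M] [IsManifold I' ∞ N]

theorem contDiffAt_writtenInExtChartAt (hf : ContMDiff I I' ∞ f)
    (hy : y ∈ (extChartAt I x).target)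
    (hfy : f ((extChartAt I x).symm y) ∈ (extChartAt I' (f x)).source) :
    ContDiffAt ℝ ∞ (writtenInExtChartAt I I' x f) y := by
  rw [extChartAt_source] at hfy
  exact contDiffAt_of_contMDiffAt_comp (f := extChartAt I' (f x) ∘ f) hy
    ((contMDiffAt_extChartAt' hfy).comp _ hf.contMDiffAt)

variable [I'.Boundaryless]

theorem chartFrame_fderiv_writtenInExtChartAt (hf : ContMDiff I I' ∞ f)
    (hy : y ∈ (extChartAt I x).target)
    (hfy : f ((extChartAt I x).symm y) ∈ (extChartAt I' (f x)).source) (v : E) :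
    (chartFrame I' (f x) (writtenInExtChartAt I I' x f y)
        (fderiv ℝ (writtenInExtChartAt I I' x f) y v) : F)
      = mfderiv I I' f ((extChartAt I x).symm y) (chartFrame I x y v) := by
  have hu := (contDiffAt_writtenInExtChartAt hf hy hfy).differentiableAt (by simp)
  have h1 : MDifferentiableAt 𝓘(ℝ, E) I (extChartAt I x).symm y :=
    ((contMDiffOn_extChartAt_symm (n := ∞) x).contMDiffAt (target_mem_nhds hy)).mdifferentiableAt
      (by simp)
  have h2 : MDifferentiableAt 𝓘(ℝ, F) I' (extChartAt I' (f x)).symm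
      (writtenInExtChartAt I I' x f y) :=
    ((contMDiffOn_extChartAt_symm (n := ∞) (f x)).contMDiffAt
      (target_mem_nhds (writtenInExtChartAt_mem_target hfy))).mdifferentiableAt (by simp)
  have h3 : (extChartAt I' (f x)).symm ∘ writtenInExtChartAt I I' x f
      =ᶠ[nhds y] f ∘ (extChartAt I x).symm :=
    (eventually_mem_source hf.continuous hy hfy).mono fun z hz => symm_writtenInExtChartAt hz
  have e1 := mfderiv_comp y h2 hu.mdifferentiableAt
  have e2 := mfderiv_comp y (hf.mdifferentiableAt (by simp)) h1
  have e3 := h3.mfderiv_eq (I := 𝓘(ℝ, E)) (I' := I')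
  have e4 := DFunLike.congr_fun e1 v
  have e5 := DFunLike.congr_fun e2 v
  have e6 := DFunLike.congr_fun (show (mfderiv 𝓘(ℝ, E) I'
    ((extChartAt I' (f x)).symm ∘ writtenInExtChartAt I I' x f) y : E →L[ℝ] F) = _ from e3) v
  rw [mfderiv_eq_fderiv] at e4
  exact e4.symm.trans (e6.trans e5)

/-- The coordinate expression of a holomorphic map intertwines the coordinate expressions of the
almost complex structures. -/
theorem fderiv_writtenInExtChartAt_chartEnd
    {J : ∀ p : M, TangentSpace I p →L[ℝ] TangentSpace I p}
    {J' : ∀ q : N, TangentSpace I' q →L[ℝ] TangentSpace I' q}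
    (hf : IsHolomorphicMap I I' J J' f) (hy : y ∈ (extChartAt I x).target)
    (hfy : f ((extChartAt I x).symm y) ∈ (extChartAt I' (f x)).source) (v : E) :
    fderiv ℝ (writtenInExtChartAt I I' x f) y (chartEnd I J x y v)
      = chartEnd I' J' (f x) (writtenInExtChartAt I I' x f y)
        (fderiv ℝ (writtenInExtChartAt I I' x f) y v) := by
  have ht := writtenInExtChartAt_mem_target hfy
  apply chartFrame_injective ht
  refine (chartFrame_fderiv_writtenInExtChartAt hf.1 hy hfy _).trans
    (Eq.trans ?_ (chartFrame_chartEnd J' ht _).symm)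
  rw [chartFrame_chartEnd J hy, hf.2]
  have key : ∀ q q' : N, q = q' → ∀ a b : F, a = b →
      (J' q : F →L[ℝ] F) a = (J' q' : F →L[ℝ] F) b := by
    rintro q _ rfl a _ rfl; rfl
  exact key _ _ (symm_writtenInExtChartAt hfy).symm _ _
    (chartFrame_fderiv_writtenInExtChartAt hf.1 hy hfy v).symm

end LocalExpressions

/-! ### Biharmonicity on the manifold -/

section Biharmonic

variable {E : Type*} [NormedAddCommGroup E] [NormedSpace ℝ E]
  {S : Type*} [TopologicalSpace S] [ChartedSpace E S] [IsManifold 𝓘(ℝ, E) ∞ S]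

theorem chartMetric_conformal (σ : SasakianStructure E S) {p : Cone S} {y : ℝ × E}
    (hy : y ∈ (extChartAt (coneModel E) p).target) :
    chartMetric (coneModel E) (fun q : Cone S => ((q.1 : ℝ) ^ 4)⁻¹ • σ.coneMetric q) p y
      = conformalForm (chartMetric 𝓘(ℝ, E) σ.g.inner p.2) y := by
  rw [conformalForm, ← chartMetric_cone σ hy, ← cone_symm_fst hy]
  rfl

variable [FiniteDimensional ℝ E]
  {F : Type*} [NormedAddCommGroup F] [NormedSpace ℝ F] [FiniteDimensional ℝ F]
  {N : Type*} [TopologicalSpace N] [ChartedSpace F N] [IsManifold 𝓘(ℝ, F) ∞ N]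

/-- Holomorphic maps from the cone over a Sasakian 3-manifold, with the metric
`r⁻⁴ (dr² + r² g)`, into (1,2)-symplectic manifolds are biharmonic. -/
theorem isBiharmonic_of_isHolomorphicMap (hdim : Module.finrank ℝ E = 3)
    (σ : SasakianStructure E S) (κ : OneTwoSymplecticStructure F N) {f : Cone S → N}
    (hf : IsHolomorphicMap (coneModel E) 𝓘(ℝ, F) σ.coneJ κ.J f) :
    IsBiharmonic (coneModel E) 𝓘(ℝ, F)
      (fun p => ((p.1 : ℝ) ^ 4)⁻¹ • σ.coneMetric p) κ.h.inner f := by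
  intro x
  have : CompleteSpace F := FiniteDimensional.complete ℝ F
  have hy := mem_extChartAt_target (I := coneModel E) x
  have ht := target_mem_nhds hy
  have hfx : f ((extChartAt (coneModel E) x).symm (extChartAt (coneModel E) x x))
      ∈ (extChartAt 𝓘(ℝ, F) (f x)).source := by
    rw [extChartAt_to_inv]
    exact mem_extChartAt_source _
  have hsrc := eventually_mem_source hf.1.continuous hy hfx
  rw [bitensionField_congr (ht.mono fun z hz => chartMetric_conformal σ hz)]
  refine bitensionField_holomorphic_cone (φ := chartEnd 𝓘(ℝ, E) σ.φ x.2)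
    (ξ := chartField 𝓘(ℝ, E) σ.ξ x.2) (η := chartForm 𝓘(ℝ, E) σ.η x.2)
    (B := chartEnd 𝓘(ℝ, F) κ.J (f x)) hdim (cone_center_ne_zero x) ?_ ?_ ?_ ?_ ?_
  · filter_upwards [target_mem_nhds (mem_cone_target.1 hy).2] with s hs
    exact ⟨contDiffAt_chartMetric σ.g hs, chartMetric_posDef σ.g hs, fun v w => σ.g.symm _ _ _⟩
  · filter_upwards [ht, hsrc] with z hz hfz
    exact contDiffAt_writtenInExtChartAt hf.1 hz hfz
  · filter_upwards [ht] with z hz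
    have h1 := chartMetric_cone_eventuallyEq σ hz
    have h2 := chartEnd_cone_eventuallyEq σ hz
    refine ⟨(almostHermitianAt_cone_chart σ hz).congr h1.symm h2.symm, fun v w => ?_⟩
    rw [← localCovDeriv_congr h1 h2]
    -- The point `z` need not be a chart centre, so the Kähler condition is transported to it from
    -- the chart centred there.
    exact localCovDeriv_eq_zero_of_isKahler (isKahler_cone σ)
      (fun p y hy => almostHermitianAt_cone_chart σ hy) hz v w
  · filter_upwards [target_mem_nhds (writtenInExtChartAt_mem_target hfx)] with q hq
    exact ⟨almostHermitianAt_chart κ.h κ.smooth_J κ.oneTwoSymplectic.1 hq, fun v w =>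
      localCovDeriv_of_isOneTwoSymplectic κ.oneTwoSymplectic (fun p y hy =>
        almostHermitianAt_chart κ.h κ.smooth_J κ.oneTwoSymplectic.1 hy) hq v w⟩
  · filter_upwards [ht, hsrc] with z hz hfz v
    rw [← chartEnd_cone σ hz]
    exact fderiv_writtenInExtChartAt_chartEnd hf hz hfz v

end Biharmonic

end HoloBiharmonic

/-! ### The main theorem -/

theorem mainTheorem10
    {E : Type*} [NormedAddCommGroup E] [NormedSpace ℝ E] [FiniteDimensional ℝ E]
    {S : Type*} [TopologicalSpace S] [ChartedSpace E S] [IsManifold 𝓘(ℝ, E) ∞ S] [Nonempty S]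
    (n : ℕ) (hn : Module.finrank ℝ E + 1 = 2 * n) (σ : SasakianStructure E S) :
    -- the cone is Kähler
    IsKahler (coneModel E) σ.coneMetric σ.coneJ ∧
    -- the operator `Δγ + (n - 1) |grad γ|²` on a radial function `γ = c(r)`
    (∀ c : ℝ → ℝ, ContDiffOn ℝ ∞ c (Set.Ioi 0) → ∀ p : Cone S,
      conformalOperator (coneModel E) n σ.coneMetric (fun q : Cone S => c q.1) p
        = deriv (deriv c) p.1 + (2 * (n : ℝ) - 1) * (deriv c p.1 / p.1)
          + ((n : ℝ) - 1) * deriv c p.1 ^ 2) ∧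
    -- it vanishes on the function `γ = -ln r²`
    (∀ p : Cone S, conformalOperator (coneModel E) n σ.coneMetric
      (fun q : Cone S => -Real.log ((q.1 : ℝ) ^ 2)) p = 0) ∧
    -- for `γ = -ln r²`, the field `J (e^{(n-3)γ} grad γ)` is Killing if and only if `n = 2`
    (IsKilling (coneModel E) σ.coneMetric
        (twistedGradient (coneModel E) n σ.coneMetric σ.coneJ
          (fun q : Cone S => -Real.log ((q.1 : ℝ) ^ 2))) ↔ n = 2) ∧
    -- for `n ≠ 3`, the field `grad r^{6-2n}` is holomorphic if and only if `n = 2`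
    (n ≠ 3 →
      (IsHolomorphicField (coneModel E) σ.coneJ
        (riemGrad (coneModel E) σ.coneMetric
          (fun q : Cone S => (q.1 : ℝ) ^ (6 - 2 * (n : ℤ)))) ↔ n = 2)) ∧
    -- the radial functions that satisfy both conditions, for `n ≥ 2`
    (2 ≤ n → ∀ c : ℝ → ℝ, ContDiffOn ℝ ∞ c (Set.Ioi 0) →
      ((IsKilling (coneModel E) σ.coneMetric
            (twistedGradient (coneModel E) n σ.coneMetric σ.coneJ (fun q : Cone S => c q.1)) ∧
          ∀ p : Cone S,
            conformalOperator (coneModel E) n σ.coneMetric (fun q : Cone S => c q.1) p = 0) ↔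
        ((∃ k : ℝ, ∀ r : ℝ, 0 < r → c r = k) ∨
          (n = 2 ∧ ∃ k : ℝ, ∀ r : ℝ, 0 < r → c r = -Real.log (r ^ 2) + k)))) ∧
    -- if `S` has dimension 3, holomorphic maps from the cone with the metric `r⁻⁴ (dr² + r² g)`
    -- into (1,2)-symplectic manifolds are biharmonic
    (n = 2 →
      ∀ {F : Type*} [NormedAddCommGroup F] [NormedSpace ℝ F] [FiniteDimensional ℝ F]
        {N : Type*} [TopologicalSpace N] [ChartedSpace F N] [IsManifold 𝓘(ℝ, F) ∞ N]
        (κ : OneTwoSymplecticStructure F N) (f : Cone S → N),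
        IsHolomorphicMap (coneModel E) 𝓘(ℝ, F) σ.coneJ κ.J f →
        IsBiharmonic (coneModel E) 𝓘(ℝ, F)
          (fun p => ((p.1 : ℝ) ^ 4)⁻¹ • σ.coneMetric p) κ.h.inner f) := by
  have hsm : ∀ {c : ℝ → ℝ}, ContDiffOn ℝ ∞ c (Set.Ioi 0) → ∀ r, 0 < r → ContDiffAt ℝ 2 c r :=
    fun hc r hr => (hc.contDiffAt (Ioi_mem_nhds hr)).of_le (by norm_cast)
  refine ⟨isKahler_cone σ, fun c hc p => conformalOperator_radial σ hn (hsm hc _ p.1.2),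
    conformalOperator_log σ hn (c := fun r => -Real.log (r ^ 2)) fun r _ => (add_zero _).symm,
    isKilling_twistedGradient_log_iff σ n, fun hn3 => isHolomorphicField_grad_zpow_iff σ hn3,
    fun hn2 c hc => killing_and_conformal_iff σ hn hn2 (hsm hc), ?_⟩
  intro hn2 F _ _ _ N _ _ _ κ f hf
  exact isBiharmonic_of_isHolomorphicMap (by omega) σ κ hf
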